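/- **Lemma (Estimates of $U_0$).** Let $\alpha\in(\tfrac12,1)$, $m\in\mathbb Z_{\ge 0}$, $\beta\in(0,1]$, and let $u_0(x)=|x|^{1-2\alpha}\,\bar u_0\!\left(\tfrac{x}{|x|}\right)$ be a vector field $\mathbb R^2\setminus\{0\}\to\mathbb R^2$ that is divergence free on $\mathbb R^2\setminus\{0\}$ (in the sense of distributions), with $\bar u_0\in C^{m,\beta}(\mathbb S^1)$ and $\|\bar u_0\|_{C^{m,\beta}(\mathbb S^1)}\le M<\infty$. Let $$U_0(x):=e^{-\Lambda^{2\alpha}}u_0(x)=\int_{\mathbb R^2}H(x-y)\,u_0(y)\,dy,\qquad H(x)=\frac1{4\pi^2}\int_{\mathbb R^2}e^{ix\cdot\xi}e^{-|\xi|^{2\alpha}}\,d\xi .$$ Then the integral defining $U_0$ converges absolutely for every $x\in\mathbb R^2$, $U_0$ is $C^\infty$ and divergence free on $\mathbb R^2$, and for every integer $k\ge 0$ and every $x\in\mathbb R^2$ $$|\nabla^kU_0(x)|\le\frac{C(M,\alpha,\beta,k)}{(1+|x|)^{2\alpha-1+\bar k}},\qquad \bar k:=\min(k,m+\beta).$$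 Moreover, for every $\gamma\in(0,\beta)$ the fractional Laplacian $$(-\Delta)^{\gamma/2}U_0(x)=c_\gamma\lim_{\varepsilon\to0^+}\int_{|x-y|>\varepsilon}\frac{U_0(x)-U_0(y)}{|x-y|^{2+\gamma}}\,dy,\qquad c_\gamma=\frac{2^{\gamma}\,\Gamma(1+\gamma/2)}{\pi\,|\Gamma(-\gamma/2)|},$$ exists for every $x\in\mathbb R^2$ and is a $C^\infty$ function of $x$, and for every integer $k\ge 0$ and every $x\in\mathbb R^2$ $$|\nabla^k(-\Delta)^{\gamma/2}U_0(x)|\le\frac{C(\gamma,M,\alpha,\beta,k)}{(1+|x|)^{2\alpha-1+\gamma+\bar k}},\qquad \bar k:=\min(k,m+\beta-\gamma).$$ The constants depend only on the quantities indicated. -/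

import Mathlib

open MeasureTheory Filter Topology
open scoped ENNReal NNReal ContDiff

noncomputable section

namespace FracHeat

/-- The Euclidean plane `ℝ²`. -/
abbrev Plane : Type := EuclideanSpace ℝ (Fin 2)

/-- The unit circle `𝕊¹ ⊆ ℝ²`. -/
abbrev UnitCircle : Type := Metric.sphere (0 : Plane) 1

/-- The point `(cos θ, sin θ)` of the unit circle. -/
def circlePoint (θ : ℝ) : UnitCircle :=
  ⟨!₂[Real.cos θ, Real.sin θ], by
    simp [EuclideanSpace.norm_eq, Fin.sum_univ_two]⟩

/-- A field on the circle as a `2π`-periodic function of the angle (arc length). -/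
def angular (v : UnitCircle → Plane) (θ : ℝ) : Plane := v (circlePoint θ)

/-- The `C^{m,β}(𝕊¹)` norm: the sup norms of the angular derivatives of order `≤ m`, plus the
`β`-Hölder seminorm of the one of order `m`. By periodicity the Hölder seminorm over the angle
`θ ∈ ℝ` is the Hölder seminorm for the arc-length distance on the circle. -/
def circleHolderNorm (m : ℕ) (β : ℝ) (v : UnitCircle → Plane) : ℝ≥0∞ :=
  (∑ j ∈ Finset.range (m + 1), ⨆ θ : ℝ, ‖iteratedDeriv j (angular v) θ‖ₑ)
    + eHolderNorm β.toNNReal (iteratedDeriv m (angular v))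

/-- `v ∈ C^{m,β}(𝕊¹)` with norm at most `M`. -/
def HolderBound (m : ℕ) (β : ℝ) (M : ℝ≥0) (v : UnitCircle → Plane) : Prop :=
  ContDiff ℝ m (angular v) ∧ circleHolderNorm m β v ≤ M

/-- The `(1 - 2α)`-homogeneous field `x ↦ |x|^{1-2α} v(x/|x|)` on `ℝ² ∖ {0}`
(with the value `0` at the origin, which plays no role). -/
def homogeneousField (α : ℝ) (v : UnitCircle → Plane) (x : Plane) : Plane :=
  if h : x = 0 then 0
  else ‖x‖ ^ (1 - 2 * α) • v ⟨‖x‖⁻¹ • x, by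
    have hx : ‖x‖ ≠ 0 := norm_ne_zero_iff.mpr h
    simp [norm_smul, hx]⟩

/-- `div u = 0` on `ℝ² ∖ {0}`, in the sense of distributions: `∫ u · ∇φ = 0` for every test
function `φ ∈ C_c^∞(ℝ² ∖ {0})`. -/
def DivFreeOffOrigin (u : Plane → Plane) : Prop :=
  ∀ φ : Plane → ℝ, ContDiff ℝ ∞ φ → HasCompactSupport φ → (0 : Plane) ∉ tsupport φ →
    ∫ x, fderiv ℝ φ x (u x) = 0

/-- The classical divergence `∂₁ u₁ + ∂₂ u₂`. -/
def divergence (u : Plane → Plane) (x : Plane) : ℝ :=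
  ∑ i : Fin 2, (fderiv ℝ u x (EuclideanSpace.single i 1)) i

/-- `(4π²)⁻¹ ∫ e^{i x·ξ} e^{-|ξ|^{2α}} dξ`, the inverse Fourier transform of
`e^{-|ξ|^{2α}}` on `ℝ²`. -/
def heatKernelC (α : ℝ) (x : Plane) : ℂ :=
  (4 * (Real.pi : ℂ) ^ 2)⁻¹ *
    ∫ ξ : Plane, Complex.exp (Complex.I * (inner ℝ x ξ : ℝ)) *
      (Real.exp (-‖ξ‖ ^ (2 * α)) : ℂ)

/-- The kernel of `e^{-Λ^{2α}}`, at time one, as a real-valued function. -/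
def heatKernel (α : ℝ) (x : Plane) : ℝ := (heatKernelC α x).re

/-- The kernel is real, so that taking the real part loses nothing. -/
theorem heatKernelC_eq (α : ℝ) (x : Plane) : heatKernelC α x = (heatKernel α x : ℂ) := by
  symm
  apply Complex.conj_eq_iff_re.mp
  unfold heatKernelC
  rw [map_mul, ← integral_conj, ← integral_neg_eq_self]
  congr 1
  · simp only [map_inv₀, map_mul, map_pow, Complex.conj_ofReal, map_ofNat]
  · congr 1
    funext ξ
    rw [map_mul, Complex.conj_ofReal, ← Complex.exp_conj]
    simp

/-- `e^{-Λ^{2α}} u`, the convolution of `u` with the kernel. -/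
def heatFlow (α : ℝ) (u : Plane → Plane) (x : Plane) : Plane :=
  ∫ y, heatKernel α (x - y) • u y

/-- The integrand of the singular integral for `(-Δ)^s f(x)`. -/
def fracIntegrand (s : ℝ) (f : Plane → Plane) (x y : Plane) : Plane :=
  (‖x - y‖ ^ (2 + 2 * s))⁻¹ • (f x - f y)

/-- The constant `c_{2,s} = 4^s Γ(1+s) / (π |Γ(-s)|)`, for which the singular integral is the
Fourier multiplier `|ξ|^{2s}` on `ℝ²`. -/
def fracConst (s : ℝ) : ℝ :=
  4 ^ s * Real.Gamma (1 + s) / (Real.pi * |Real.Gamma (-s)|)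

/-- The singular integral, truncated to `|x - y| > ε`. -/
def fracLaplacianTrunc (s ε : ℝ) (f : Plane → Plane) (x : Plane) : Plane :=
  fracConst s • ∫ y in {y : Plane | ε < ‖x - y‖}, fracIntegrand s f x y

/-- `(-Δ)^s f(x)`, `0 < s < 1`, as a principal value. -/
def fracLaplacian (s : ℝ) (f : Plane → Plane) (x : Plane) : Plane :=
  limUnder (𝓝[>] (0 : ℝ)) fun ε => fracLaplacianTrunc s ε f x

/-- The principal value that defines `(-Δ)^s f(x)` exists. -/
def FracLaplacianExists (s : ℝ) (f : Plane → Plane) (x : Plane) : Prop :=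
  (∀ ε : ℝ, 0 < ε → IntegrableOn (fracIntegrand s f x) {y : Plane | ε < ‖x - y‖}) ∧
    ∃ L : Plane, Tendsto (fun ε => fracLaplacianTrunc s ε f x) (𝓝[>] (0 : ℝ)) (𝓝 L)

end FracHeat

end

noncomputable section

namespace FracHeat

/-! Kernel decay. The kernel H satisfies |∇^k H(x)| ≤ C(1+|x|)^(-k-3)
(`exists_iteratedFDeriv_heatKernel_le`). The symbol e^{-|ξ|^{2α}} falls off rapidly, so only its
singularity at ξ = 0 limits the decay of H. The symbol is approximated by symbols smoothed where
|cξ| < 1/4, with c = 2^J. Two consecutive ones differ by a function of cξ supported in a fixed ball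
and of size O(c^{-2α}) in every C^q. After rescaling, this difference adds O(c^{1-2α}) to |w|^{k+3}
times the k-th derivative of the Fourier transform, and these terms form a convergent geometric
series because α > 1/2. The exponent k+3 is smaller than the natural k+2+2α, but it is an integer
and it suffices.

Decay of U₀. Since |u₀(y)| ≤ M|y|^{-(2α-1)} is locally integrable, every derivative of U₀ is
bounded. For |x| ≈ R ≥ 1, split u₀ into its restriction to an annulus |y| ≈ R and a rest that
vanishes near x. By homogeneity the annular piece has m-th derivatives of size R^{-(2α-1+m)} and
β-Hölder seminorm of these of size R^{-(2α-1+m+β)} (`exists_annulusField_le`, resting on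
`exists_holder_clm_direction`). In its convolution with H, m derivatives fall on the field; any
further ones fall on H, whose derivatives have mean zero, so they see only Hölder differences
(`DecayingKernel.exists_holder_convolution_le`). The rest gains an extra factor 1/R from the kernel
decay (`exists_iteratedFDeriv_farFlow_le`). The rate for the k-th derivative saturates once k ≤ m,
so larger m reduce to m = k and only finitely many m matter: this makes the constants independent of
m (`exists_bound_of_forall_le`).

Divergence. The field u₀ is tested against H(x-·) times a cutoff away from 0 and ∞. The gradient of
the cutoff is O(1/|y|), and |y|^{-2α} is integrable at 0 in the plane because α < 1, so the cutoff
can be removed by dominated convergence.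

Fractional Laplacian. Because γ < 1, the singular integral of a smooth function with bounded
derivatives converges absolutely and commutes with ∇^k. For decay its kernel is split at |z| ≈ |x|.
The near part uses the Hölder bound of ∇^m U₀ when k = m, and bounds for ∇^k U₀ and ∇^{k+1} U₀ when
k > m (`exists_integral_nearKernel_heatFlow_le`). In the far part the term with ∇^k U₀(x) gains
|x|^{-γ} from the mass of the kernel; in the other term all k derivatives are moved onto the smooth
far kernel, since ∇^k U₀(x-z) need not be small when x-z is near 0
(`exists_integral_farKernel_smul_le`). -/

/-! ### Differentiation under the integral sign, to all orders. -/

/-- The isometry `L` stands for currying: it lets the next iterated derivative, a multilinear map,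
serve as the Fréchet derivative of the previous one without losing norms or integrals. -/
theorem hasFDerivAt_integral_of_equiv {X E G G' : Type*} [MeasurableSpace X] {μ : Measure X}
    [NormedAddCommGroup E] [NormedSpace ℝ E] [NormedAddCommGroup G] [NormedSpace ℝ G]
    [CompleteSpace G] [NormedAddCommGroup G'] [NormedSpace ℝ G'] [CompleteSpace G']
    {Ψ : E → X → G} {P : E → X → G'} (L : G' ≃ₗᵢ[ℝ] (E →L[ℝ] G)) {b : X → ℝ} {x : E}
    (hm : ∀ x, AEStronglyMeasurable (Ψ x) μ) (hi : Integrable (Ψ x) μ)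
    (hPi : Integrable (P x) μ) (hb : Integrable b μ)
    (hbb : ∀ y, ∀ z ∈ Metric.ball x 1, ‖P z y‖ ≤ b y)
    (hd : ∀ y, ∀ z, HasFDerivAt (fun x => Ψ x y) (L (P z y)) z) :
    HasFDerivAt (fun x => ∫ y, Ψ x y ∂μ) (L (∫ y, P x y ∂μ)) x := by
  have h := L.toContinuousLinearEquiv.toContinuousLinearMap.integral_comp_comm hPi
  have h' := hasFDerivAt_integral_of_dominated_of_fderiv_le (𝕜 := ℝ)
    (Metric.ball_mem_nhds x one_pos) (Eventually.of_forall hm) hi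
    (L.continuous.comp_aestronglyMeasurable hPi.1)
    (Eventually.of_forall fun y z hz => (L.norm_map (P z y)).le.trans (hbb y z hz)) hb
    (Eventually.of_forall fun y z _ => hd y z)
  exact h ▸ h'

/-- Smoothness of a parametric integral under locally uniform domination of all derivatives. -/
theorem hasFTaylorSeriesUpTo_integral {X E F : Type*} [MeasurableSpace X] {μ : Measure X}
    [NormedAddCommGroup E] [NormedSpace ℝ E] [NormedAddCommGroup F] [NormedSpace ℝ F]
    [CompleteSpace F] {Φ : E → X → F}
    (hs : ∀ y, ContDiff ℝ ∞ fun x => Φ x y)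
    (hm : ∀ k x, AEStronglyMeasurable (fun y => iteratedFDeriv ℝ k (fun x => Φ x y) x) μ)
    (hb : ∀ (k : ℕ) (x₀ : E), ∃ b : X → ℝ, Integrable b μ ∧
      ∀ y, ∀ x ∈ Metric.ball x₀ 1, ‖iteratedFDeriv ℝ k (fun x => Φ x y) x‖ ≤ b y) :
    HasFTaylorSeriesUpTo ∞ (fun x => ∫ y, Φ x y ∂μ)
      (fun x k => ∫ y, iteratedFDeriv ℝ k (fun x => Φ x y) x ∂μ) := by
  have hint : ∀ k x, Integrable (fun y => iteratedFDeriv ℝ k (fun x => Φ x y) x) μ := by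
    intro k x
    obtain ⟨b, hbi, hbb⟩ := hb k x
    exact hbi.mono' (hm k x)
      (Eventually.of_forall fun y => hbb y x (Metric.mem_ball_self one_pos))
  have hder : ∀ (k : ℕ) (x : E), HasFDerivAt
      (fun x => ∫ y, iteratedFDeriv ℝ k (fun x => Φ x y) x ∂μ)
      (∫ y, iteratedFDeriv ℝ (k + 1) (fun x => Φ x y) x ∂μ).curryLeft x := by
    intro k x
    obtain ⟨b, hbi, hbb⟩ := hb (k + 1) x
    refine hasFDerivAt_integral_of_equiv (μ := μ)
      (Ψ := fun x y => iteratedFDeriv ℝ k (fun x => Φ x y) x)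
      (P := fun x y => iteratedFDeriv ℝ (k + 1) (fun x => Φ x y) x)
      (continuousMultilinearCurryLeftEquiv ℝ (fun _ : Fin (k + 1) => E) F)
      (hm k) (hint k x) (hint (k + 1) x) hbi hbb fun y z => ?_
    have e : continuousMultilinearCurryLeftEquiv ℝ (fun _ : Fin (k + 1) => E) F
        (iteratedFDeriv ℝ (k + 1) (fun x => Φ x y) z) =
          fderiv ℝ (iteratedFDeriv ℝ k (fun x => Φ x y)) z := by
      rw [iteratedFDeriv_succ_eq_comp_left, Function.comp_apply]
      exact LinearIsometryEquiv.apply_symm_apply _ _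
    rw [e]
    exact (((hs y).contDiffAt).differentiableAt_iteratedFDeriv
      (by exact_mod_cast WithTop.coe_lt_top _)).hasFDerivAt
  refine ⟨fun x => ?_, fun k _ x => hder k x, fun k _ => ?_⟩
  · have := (continuousMultilinearCurryFin0 ℝ E F).toContinuousLinearEquiv.integral_comp_comm (μ := μ)
      (fun y => iteratedFDeriv ℝ 0 (fun x => Φ x y) x)
    simpa using this.symm
  · exact continuous_iff_continuousAt.2 fun x => (hder k x).continuousAt

theorem contDiff_integral_of_dominated {X E F : Type*} [MeasurableSpace X] {μ : Measure X}
    [NormedAddCommGroup E] [NormedSpace ℝ E] [NormedAddCommGroup F] [NormedSpace ℝ F]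
    [CompleteSpace F] {Φ : E → X → F}
    (hs : ∀ y, ContDiff ℝ ∞ fun x => Φ x y)
    (hm : ∀ k x, AEStronglyMeasurable (fun y => iteratedFDeriv ℝ k (fun x => Φ x y) x) μ)
    (hb : ∀ (k : ℕ) (x₀ : E), ∃ b : X → ℝ, Integrable b μ ∧
      ∀ y, ∀ x ∈ Metric.ball x₀ 1, ‖iteratedFDeriv ℝ k (fun x => Φ x y) x‖ ≤ b y) :
    ContDiff ℝ ∞ (fun x => ∫ y, Φ x y ∂μ) ∧ ∀ k x,
      iteratedFDeriv ℝ k (fun x => ∫ y, Φ x y ∂μ) x =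
        ∫ y, iteratedFDeriv ℝ k (fun x => Φ x y) x ∂μ := by
  have h := hasFTaylorSeriesUpTo_integral hs hm hb
  exact ⟨h.contDiff, fun k x =>
    (h.eq_iteratedFDeriv (m := k) (by exact_mod_cast le_top) x).symm⟩

/-! ### Convolution with a smooth kernel whose derivatives decay. -/

section Convolution

variable {F : Type*} [NormedAddCommGroup F] [NormedSpace ℝ F]

theorem iteratedFDeriv_sub_smul_const {K : Plane → ℝ} (hK : ContDiff ℝ ∞ K) (k : ℕ)
    (x y : Plane) (c : F) :
    iteratedFDeriv ℝ k (fun x => K (x - y) • c) x =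
      ((ContinuousLinearMap.id ℝ ℝ).smulRight c).compContinuousMultilinearMap
        (iteratedFDeriv ℝ k K (x - y)) := by
  rw [iteratedFDeriv_smul_const_apply, iteratedFDeriv_comp_sub]
  exact ContDiff.contDiffAt (by fun_prop) |>.of_le (by exact_mod_cast le_top)

theorem norm_iteratedFDeriv_sub_smul_const_le {K : Plane → ℝ} (hK : ContDiff ℝ ∞ K) (k : ℕ)
    (x y : Plane) (c : F) :
    ‖iteratedFDeriv ℝ k (fun x => K (x - y) • c) x‖ ≤ ‖iteratedFDeriv ℝ k K (x - y)‖ * ‖c‖ := by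
  rw [iteratedFDeriv_sub_smul_const hK]
  refine (ContinuousLinearMap.norm_compContinuousMultilinearMap_le _ _).trans ?_
  rw [ContinuousLinearMap.norm_smulRight_apply, mul_comm]
  have : ‖ContinuousLinearMap.id ℝ ℝ‖ ≤ 1 := ContinuousLinearMap.norm_id_le
  calc _ ≤ ‖iteratedFDeriv ℝ k K (x - y)‖ * (1 * ‖c‖) := by gcongr
    _ = _ := by rw [one_mul]

theorem aestronglyMeasurable_iteratedFDeriv_sub_smul {K : Plane → ℝ} (hK : ContDiff ℝ ∞ K)
    {v : Plane → F} (hv : AEStronglyMeasurable v) (k : ℕ) (x : Plane) :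
    AEStronglyMeasurable (fun y => iteratedFDeriv ℝ k (fun x => K (x - y) • v y) x) := by
  simp_rw [iteratedFDeriv_sub_smul_const hK]
  have h1 : AEStronglyMeasurable (fun y => (ContinuousLinearMap.id ℝ ℝ).smulRight (v y)) :=
    (ContinuousLinearMap.smulRightL ℝ ℝ F (ContinuousLinearMap.id ℝ ℝ)).continuous.comp_aestronglyMeasurable hv
  have h2 : AEStronglyMeasurable (fun y : Plane => iteratedFDeriv ℝ k K (x - y)) := by
    have := hK.continuous_iteratedFDeriv (m := k) (by exact_mod_cast le_top)
    exact (this.comp (continuous_const.sub continuous_id)).aestronglyMeasurable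
  exact (ContinuousLinearMap.compContinuousMultilinearMapL ℝ (fun _ : Fin k => Plane) ℝ F).aestronglyMeasurable_comp₂ h1 h2

theorem one_add_norm_rpow_le {s : ℝ} (hs : 0 ≤ s) {E : Type*} [NormedAddCommGroup E] {x x₀ : E}
    (h : ‖x - x₀‖ ≤ 1) : (1 + ‖x‖) ^ (-s) ≤ 2 ^ s * (1 + ‖x₀‖) ^ (-s) := by
  have h1 : ‖x₀‖ ≤ ‖x‖ + 1 := by
    have := norm_sub_norm_le x₀ x
    rw [norm_sub_rev] at this
    linarith
  have h2 : (1 + ‖x₀‖) / 2 ≤ 1 + ‖x‖ := by linarith [norm_nonneg x]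
  have h0 : 0 < (1 + ‖x₀‖) / 2 := by positivity
  calc (1 + ‖x‖) ^ (-s) ≤ ((1 + ‖x₀‖) / 2) ^ (-s) :=
        Real.rpow_le_rpow_of_nonpos h0 h2 (by linarith)
    _ = 2 ^ s * (1 + ‖x₀‖) ^ (-s) := by
        rw [Real.div_rpow (by positivity) (by norm_num), Real.rpow_neg (by norm_num : (0:ℝ) ≤ 2)]
        field_simp

/-- Convolution with a smooth kernel all of whose derivatives decay like `(1 + |x|)^{-s}`. -/
theorem contDiff_kernel_convolution [CompleteSpace F] {K : Plane → ℝ} (hK : ContDiff ℝ ∞ K)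
    {s : ℝ} (hs : 0 ≤ s) (hKb : ∀ k : ℕ, ∃ C : ℝ, ∀ x, ‖iteratedFDeriv ℝ k K x‖ ≤ C * (1 + ‖x‖) ^ (-s))
    {v : Plane → F} (hv : AEStronglyMeasurable v)
    (hvi : ∀ x : Plane, Integrable fun y => (1 + ‖x - y‖) ^ (-s) * ‖v y‖) :
    ContDiff ℝ ∞ (fun x => ∫ y, K (x - y) • v y) ∧
    (∀ k x, Integrable fun y => iteratedFDeriv ℝ k (fun x => K (x - y) • v y) x) ∧
    (∀ k x, iteratedFDeriv ℝ k (fun x => ∫ y, K (x - y) • v y) x =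
      ∫ y, iteratedFDeriv ℝ k (fun x => K (x - y) • v y) x) ∧
    ∀ k x, ‖iteratedFDeriv ℝ k (fun x => ∫ y, K (x - y) • v y) x‖ ≤
      ∫ y, ‖iteratedFDeriv ℝ k K (x - y)‖ * ‖v y‖ := by
  have hs' : ∀ y, ContDiff ℝ ∞ (fun x => K (x - y) • v y) := fun y => by fun_prop
  have hm := aestronglyMeasurable_iteratedFDeriv_sub_smul hK hv
  have hb : ∀ (k : ℕ) (x₀ : Plane), ∃ b : Plane → ℝ, Integrable b ∧
      ∀ y, ∀ x ∈ Metric.ball x₀ 1,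
        ‖iteratedFDeriv ℝ k (fun x => K (x - y) • v y) x‖ ≤ b y := by
    intro k x₀
    obtain ⟨C, hC⟩ := hKb k
    refine ⟨fun y => |C| * 2 ^ s * ((1 + ‖x₀ - y‖) ^ (-s) * ‖v y‖), (hvi x₀).const_mul _, ?_⟩
    intro y x hx
    refine (norm_iteratedFDeriv_sub_smul_const_le hK k x y (v y)).trans ?_
    have h1 : ‖(x - y) - (x₀ - y)‖ ≤ 1 := by
      rw [sub_sub_sub_cancel_right, ← dist_eq_norm]; exact (Metric.mem_ball.1 hx).le
    calc ‖iteratedFDeriv ℝ k K (x - y)‖ * ‖v y‖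
        ≤ (|C| * (2 ^ s * (1 + ‖x₀ - y‖) ^ (-s))) * ‖v y‖ := by
          gcongr
          refine (hC _).trans ?_
          calc _ ≤ |C| * (1 + ‖x - y‖) ^ (-s) := by gcongr; exact le_abs_self C
            _ ≤ _ := by gcongr; exact one_add_norm_rpow_le hs h1
      _ = _ := by ring
  obtain ⟨h1, h2⟩ := contDiff_integral_of_dominated hs' hm hb
  refine ⟨h1, fun k x => ?_, h2, fun k x => ?_⟩
  · obtain ⟨b, hbi, hbb⟩ := hb k x
    exact hbi.mono' (hm k x)
      (Eventually.of_forall fun y => hbb y x (Metric.mem_ball_self one_pos))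
  · rw [h2]
    obtain ⟨C, hC⟩ := hKb k
    refine norm_integral_le_of_norm_le ?_ (Eventually.of_forall fun y =>
      norm_iteratedFDeriv_sub_smul_const_le hK k x y (v y))
    refine ((hvi x).const_mul |C|).mono' ?_ (Eventually.of_forall fun y => ?_)
    · have := hK.continuous_iteratedFDeriv (m := k) (by exact_mod_cast le_top)
      exact (this.comp (continuous_const.sub continuous_id)).norm.aestronglyMeasurable.mul hv.norm
    · rw [Real.norm_of_nonneg (by positivity), ← mul_assoc]
      gcongr
      exact (hC _).trans (by gcongr; exact le_abs_self C)

end Convolution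

/-! ### Weighted integrals of powers of the norm in the plane. -/

theorem integrableOn_norm_rpow_ball {a r : ℝ} (ha : a < 2) :
    IntegrableOn (fun y : Plane => ‖y‖ ^ (-a)) (Metric.ball 0 r) := by
  have h : LocallyIntegrable (fun y : Plane => ‖y‖ ^ (-a)) := by
    refine locallyIntegrable_of_norm_le_rpow (C := 1) (α := a) (by simp) (by simpa using ha)
      (Eventually.of_forall fun y => ?_) (Measurable.aestronglyMeasurable (by fun_prop))
    rw [Real.norm_of_nonneg (by positivity), one_mul]
  exact (h.integrableOn_isCompact (isCompact_closedBall 0 r)).mono_set Metric.ball_subset_closedBall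

theorem integrable_one_add_norm_sub {s : ℝ} (hs : 2 < s) (x : Plane) :
    Integrable fun y : Plane => (1 + ‖x - y‖) ^ (-s) :=
  (integrable_one_add_norm (E := Plane) (μ := volume) (r := s) (by simpa using hs)).comp_sub_left x

/-- On each side of |y| = 1 one of the two factors is at most 1. The integral of the right-hand side
does not depend on `x`, which gives bounds uniform in `x`. -/
theorem one_add_norm_mul_norm_rpow_le {s a : ℝ} (hs : 0 ≤ s) (ha : 0 ≤ a) (x y : Plane) :
    (1 + ‖x - y‖) ^ (-s) * ‖y‖ ^ (-a) ≤
      (Metric.ball (0 : Plane) 1).indicator (fun y => ‖y‖ ^ (-a)) y + (1 + ‖x - y‖) ^ (-s) := by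
  have h0 : (0:ℝ) < 1 + ‖x - y‖ := by positivity
  by_cases hy : ‖y‖ < 1
  · rw [Set.indicator_of_mem (by simpa using hy)]
    have : (1 + ‖x - y‖) ^ (-s) ≤ 1 :=
      Real.rpow_le_one_of_one_le_of_nonpos (by linarith [norm_nonneg (x - y)]) (by linarith)
    have h2 : 0 ≤ (1 + ‖x - y‖) ^ (-s) := by positivity
    have h3 : 0 ≤ ‖y‖ ^ (-a) := by positivity
    nlinarith
  · rw [Set.indicator_of_notMem (by simpa using hy), zero_add]
    have : ‖y‖ ^ (-a) ≤ 1 :=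
      Real.rpow_le_one_of_one_le_of_nonpos (not_lt.1 hy) (by linarith)
    exact mul_le_of_le_one_right (by positivity) this

theorem integrable_one_add_norm_mul_norm_rpow {s a : ℝ} (hs : 2 < s) (ha : 0 ≤ a) (ha' : a < 2)
    (x : Plane) : Integrable fun y : Plane => (1 + ‖x - y‖) ^ (-s) * ‖y‖ ^ (-a) := by
  refine ((IntegrableOn.integrable_indicator (integrableOn_norm_rpow_ball (r := 1) ha')
    Metric.isOpen_ball.measurableSet).add (integrable_one_add_norm_sub hs x)).mono' ?_
    (Eventually.of_forall fun y => ?_)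
  · exact Measurable.aestronglyMeasurable (by fun_prop)
  · rw [Real.norm_of_nonneg (by positivity)]
    exact one_add_norm_mul_norm_rpow_le (by linarith) ha x y

theorem exists_integral_one_add_norm_mul_norm_rpow_le {s a : ℝ} (hs : 2 < s) (ha : 0 ≤ a)
    (ha' : a < 2) : ∃ C : ℝ, 0 ≤ C ∧ ∀ x : Plane,
      ∫ y : Plane, (1 + ‖x - y‖) ^ (-s) * ‖y‖ ^ (-a) ≤ C := by
  refine ⟨(∫ y : Plane, (Metric.ball (0 : Plane) 1).indicator (fun y => ‖y‖ ^ (-a)) y) +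
    ∫ y : Plane, (1 + ‖y‖) ^ (-s), add_nonneg (integral_nonneg fun y =>
      Set.indicator_nonneg (fun _ _ => by positivity) _) (integral_nonneg fun y => by positivity),
      fun x => ?_⟩
  have h1 : Integrable ((Metric.ball (0 : Plane) 1).indicator fun y => ‖y‖ ^ (-a)) :=
    (integrableOn_norm_rpow_ball ha').integrable_indicator Metric.isOpen_ball.measurableSet
  have h2 := integrable_one_add_norm_sub hs x
  calc _ ≤ ∫ y : Plane, ((Metric.ball (0 : Plane) 1).indicator (fun y => ‖y‖ ^ (-a)) y +
        (1 + ‖x - y‖) ^ (-s)) :=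
        integral_mono (integrable_one_add_norm_mul_norm_rpow hs ha ha' x) (h1.add h2)
          fun y => one_add_norm_mul_norm_rpow_le (by linarith) ha x y
    _ = _ := by
      rw [integral_add h1 h2]
      congr 1
      exact integral_sub_left_eq_self (fun y : Plane => (1 + ‖y‖) ^ (-s)) volume x

theorem add_norm_rpow_smul {R : ℝ} (hR : 0 < R) (s : ℝ) (z : Plane) :
    (R + ‖R • z‖) ^ (-s) = R ^ (-s) * (1 + ‖z‖) ^ (-s) := by
  rw [norm_smul, Real.norm_of_nonneg hR.le, ← Real.mul_rpow hR.le (by positivity)]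
  ring_nf

theorem add_norm_sub_mul_norm_rpow_eq {R : ℝ} (hR : 0 < R) (s a : ℝ) (x y : Plane) :
    (R + ‖x - y‖) ^ (-s) * ‖y‖ ^ (-a) = R ^ (-s - a) *
      ((1 + ‖R⁻¹ • x - R⁻¹ • y‖) ^ (-s) * ‖R⁻¹ • y‖ ^ (-a)) := by
  have h1 : x - y = R • (R⁻¹ • x - R⁻¹ • y) := by
    rw [← smul_sub, smul_smul, mul_inv_cancel₀ hR.ne', one_smul]
  have h2 : ‖y‖ = R * ‖R⁻¹ • y‖ := by
    rw [norm_smul, norm_inv, Real.norm_of_nonneg hR.le]; field_simp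
  rw [h1, add_norm_rpow_smul hR, h2, Real.mul_rpow hR.le (by positivity), sub_eq_add_neg (-s) a,
    Real.rpow_add hR]
  ring

theorem integrable_add_norm_mul_norm_rpow {s a : ℝ} (hs : 2 < s) (ha : 0 ≤ a) (ha' : a < 2)
    {R : ℝ} (hR : 0 < R) (x : Plane) :
    Integrable fun y : Plane => (R + ‖x - y‖) ^ (-s) * ‖y‖ ^ (-a) := by
  simp_rw [add_norm_sub_mul_norm_rpow_eq hR]
  exact (((integrable_comp_smul_iff volume _ (inv_ne_zero hR.ne')).2
    (integrable_one_add_norm_mul_norm_rpow hs ha ha' (R⁻¹ • x)))).const_mul _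

/-- Substituting y = R y' reduces to R = 1; the Jacobian R² and the two homogeneities produce the
exponent. This is the source of every power of R in the far-field estimates. -/
theorem exists_integral_add_norm_mul_norm_rpow_le {s a : ℝ} (hs : 2 < s) (ha : 0 ≤ a)
    (ha' : a < 2) : ∃ C : ℝ, 0 ≤ C ∧ ∀ (R : ℝ), 0 < R → ∀ x : Plane,
      ∫ y : Plane, (R + ‖x - y‖) ^ (-s) * ‖y‖ ^ (-a) ≤ C * R ^ (2 - s - a) := by
  obtain ⟨C, hC0, hC⟩ := exists_integral_one_add_norm_mul_norm_rpow_le hs ha ha'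
  refine ⟨C, hC0, fun R hR x => ?_⟩
  simp_rw [add_norm_sub_mul_norm_rpow_eq hR]
  rw [integral_const_mul, Measure.integral_comp_inv_smul_of_nonneg volume
    (fun y : Plane => (1 + ‖R⁻¹ • x - y‖) ^ (-s) * ‖y‖ ^ (-a)) hR.le]
  simp only [finrank_euclideanSpace, Fintype.card_fin, smul_eq_mul]
  have : R ^ (2 - s - a) = R ^ (-s - a) * R ^ 2 := by
    rw [← Real.rpow_natCast, ← Real.rpow_add hR]; push_cast; ring_nf
  rw [this]
  have h := hC (R⁻¹ • x)
  calc _ = R ^ (-s - a) * R ^ 2 * ∫ y : Plane, (1 + ‖R⁻¹ • x - y‖) ^ (-s) * ‖y‖ ^ (-a) := by ring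
    _ ≤ R ^ (-s - a) * R ^ 2 * C := by gcongr
    _ = _ := by ring

open scoped Pointwise in
theorem exists_integral_norm_rpow_ball_le (a : ℝ) :
    ∃ C : ℝ, 0 ≤ C ∧ ∀ r : ℝ, 0 < r →
      ∫ y in Metric.ball (0 : Plane) r, ‖y‖ ^ (-a) ≤ C * r ^ (2 - a) := by
  refine ⟨∫ y in Metric.ball (0 : Plane) 1, ‖y‖ ^ (-a), integral_nonneg fun y => by positivity,
    fun r hr => ?_⟩
  have h := Measure.setIntegral_comp_smul volume (fun y : Plane => ‖y‖ ^ (-a))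
    (Metric.ball (0 : Plane) 1) hr.ne'
  have h2 : r • Metric.ball (0 : Plane) 1 = Metric.ball 0 r := by
    rw [smul_unitBall hr.ne', Real.norm_of_nonneg hr.le]
  rw [h2] at h
  simp only [finrank_euclideanSpace, Fintype.card_fin, smul_eq_mul, norm_smul,
    Real.norm_of_nonneg hr.le, Real.mul_rpow hr.le (norm_nonneg _), integral_const_mul] at h
  rw [abs_of_pos (by positivity)] at h
  have h3 : r ^ (2 - a) = r ^ (2:ℕ) * r ^ (-a) := by
    rw [← Real.rpow_natCast, ← Real.rpow_add hr]; push_cast; ring_nf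
  rw [h3]
  field_simp at h
  linarith

/-! ### Scaling, homogeneous functions, and removal of the singularity at the origin. -/

section Scaling

variable {F : Type*} [NormedAddCommGroup F] [NormedSpace ℝ F]

theorem iteratedFDeriv_comp_smul_of_ne_zero {c : ℝ} (hc : c ≠ 0) (f : Plane → F) (k : ℕ)
    (x : Plane) :
    iteratedFDeriv ℝ k (fun z => f (c • z)) x = c ^ k • iteratedFDeriv ℝ k f (c • x) := by
  have h := ContinuousLinearEquiv.iteratedFDerivWithin_comp_right (𝕜 := ℝ)
    (ContinuousLinearEquiv.smulLeft (R₁ := ℝ) (M₁ := Plane) (Units.mk0 c hc)) f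
    (s := Set.univ) uniqueDiffOn_univ (x := x) (Set.mem_univ _) k
  simp only [Set.preimage_univ, iteratedFDerivWithin_univ] at h
  have h2 : (f ∘ (ContinuousLinearEquiv.smulLeft (R₁ := ℝ) (M₁ := Plane) (Units.mk0 c hc))) =
    fun z => f (c • z) := rfl
  rw [h2] at h
  rw [h]
  ext m
  have := (iteratedFDeriv ℝ k f (c • x)).map_smul_univ (fun _ => c) m
  simpa using this

theorem norm_iteratedFDeriv_comp_smul {c : ℝ} (hc : c ≠ 0) (f : Plane → F) (k : ℕ) (x : Plane) :
    ‖iteratedFDeriv ℝ k (fun z => f (c • z)) x‖ = |c| ^ k * ‖iteratedFDeriv ℝ k f (c • x)‖ := by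
  rw [iteratedFDeriv_comp_smul_of_ne_zero hc, norm_smul, norm_pow, Real.norm_eq_abs]

theorem continuousOn_iteratedFDeriv_compl_zero {f : Plane → F} (hf : ContDiffOn ℝ ∞ f {0}ᶜ)
    (k : ℕ) : ContinuousOn (iteratedFDeriv ℝ k f) {0}ᶜ := by
  have ho : IsOpen ({0}ᶜ : Set Plane) := isOpen_compl_singleton
  exact (hf.continuousOn_iteratedFDerivWithin (m := k) (by exact_mod_cast le_top)
    ho.uniqueDiffOn).congr fun x hx => (iteratedFDerivWithin_of_isOpen k ho hx).symm

/-- The derivatives of a homogeneous function. -/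
theorem exists_norm_iteratedFDeriv_le_of_homogeneous {f : Plane → F} {d : ℝ}
    (hf : ContDiffOn ℝ ∞ f {0}ᶜ)
    (hd : ∀ t : ℝ, 0 < t → ∀ x : Plane, x ≠ 0 → f (t • x) = t ^ d • f x) (k : ℕ) :
    ∃ C : ℝ, 0 ≤ C ∧ ∀ x : Plane, x ≠ 0 → ‖iteratedFDeriv ℝ k f x‖ ≤ C * ‖x‖ ^ (d - k) := by
  have hsub : Metric.sphere (0 : Plane) 1 ⊆ {0}ᶜ := fun x hx h0 => by
    rw [Set.mem_singleton_iff] at h0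
    simp [h0] at hx
  obtain ⟨C, hC⟩ := (isCompact_sphere (0 : Plane) 1).exists_bound_of_continuousOn
    ((continuousOn_iteratedFDeriv_compl_zero hf k).mono hsub)
  refine ⟨|C|, abs_nonneg C, fun x hx => ?_⟩
  have hr : 0 < ‖x‖ := norm_pos_iff.2 hx
  have hev : f =ᶠ[𝓝 x] fun z => ‖x‖ ^ d • f (‖x‖⁻¹ • z) := by
    filter_upwards [isOpen_compl_singleton.mem_nhds (show x ∈ ({0}ᶜ : Set Plane) from hx)]
      with z hz
    rw [← hd _ hr _ (smul_ne_zero (inv_ne_zero hr.ne') hz), smul_smul, mul_inv_cancel₀ hr.ne',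
      one_smul]
  have hx1 : ‖‖x‖⁻¹ • x‖ = 1 := by
    rw [norm_smul, norm_inv, norm_norm, inv_mul_cancel₀ hr.ne']
  have hcd : ContDiffAt ℝ k (fun z => f (‖x‖⁻¹ • z)) x := by
    have h1 : ContDiffAt ℝ k f (‖x‖⁻¹ • x) :=
      (hf.contDiffAt (isOpen_compl_singleton.mem_nhds
        (smul_ne_zero (inv_ne_zero hr.ne') hx))).of_le (by exact_mod_cast le_top)
    exact ContDiffAt.comp x (f := fun z : Plane => ‖x‖⁻¹ • z) h1 (by fun_prop)
  rw [(hev.iteratedFDeriv ℝ k).eq_of_nhds, iteratedFDeriv_const_smul_apply' hcd, norm_smul,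
    norm_iteratedFDeriv_comp_smul (inv_ne_zero hr.ne'),
    Real.norm_of_nonneg (by positivity), abs_of_pos (by positivity), Real.rpow_sub hr,
    Real.rpow_natCast, inv_pow]
  have := (hC (‖x‖⁻¹ • x) (by simpa using hx1)).trans (le_abs_self C)
  calc _ = ‖iteratedFDeriv ℝ k f (‖x‖⁻¹ • x)‖ * (‖x‖ ^ d / ‖x‖ ^ k) := by ring
    _ ≤ _ := by gcongr

/-- A smooth cutoff: `1` on the ball of radius `1/8`, supported in the ball of radius `1/4`. -/
def originBump : ContDiffBump (0 : Plane) := ⟨1 / 8, 1 / 4, by norm_num, by norm_num⟩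

theorem originBump_eq_zero {x : Plane} (hx : 1 / 4 ≤ ‖x‖) : originBump x = 0 :=
  originBump.zero_of_le_dist (by simpa [originBump] using hx)

theorem originBump_eq_one {x : Plane} (hx : ‖x‖ ≤ 1 / 8) : originBump x = 1 :=
  originBump.one_of_mem_closedBall (by simpa [originBump] using hx)

theorem contDiff_one_sub_originBump_smul {f : Plane → F} (hf : ContDiffOn ℝ ∞ f {0}ᶜ) :
    ContDiff ℝ ∞ fun x => (1 - originBump x) • f x := by
  rw [contDiff_iff_contDiffAt]
  intro x
  by_cases hx : x = 0
  · have : (fun x => (1 - originBump x) • f x) =ᶠ[𝓝 x] fun _ => 0 := by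
      filter_upwards [Metric.ball_mem_nhds x (show (0:ℝ) < 1 / 8 by norm_num)] with z hz
      rw [hx, mem_ball_zero_iff] at hz
      simp [originBump_eq_one hz.le]
    exact contDiffAt_const.congr_of_eventuallyEq this
  · have h1 : ContDiffAt ℝ ∞ f x := hf.contDiffAt (isOpen_compl_singleton.mem_nhds hx)
    exact (contDiffAt_const.sub originBump.contDiff.contDiffAt).smul h1

theorem iteratedFDeriv_one_sub_originBump_smul {f : Plane → F} (k : ℕ) {x : Plane}
    (hx : 1 / 4 < ‖x‖) :
    iteratedFDeriv ℝ k (fun x => (1 - originBump x) • f x) x = iteratedFDeriv ℝ k f x := by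
  have : (fun x => (1 - originBump x) • f x) =ᶠ[𝓝 x] f := by
    filter_upwards [(isOpen_lt continuous_const continuous_norm).mem_nhds hx] with z hz
    simp [originBump_eq_zero (le_of_lt hz)]
  exact (this.iteratedFDeriv ℝ k).eq_of_nhds

theorem exists_norm_iteratedFDeriv_one_sub_originBump_le {f : Plane → F} {d : ℝ} (hd0 : d ≤ 0)
    (hf : ContDiffOn ℝ ∞ f {0}ᶜ)
    (hd : ∀ t : ℝ, 0 < t → ∀ x : Plane, x ≠ 0 → f (t • x) = t ^ d • f x) (k : ℕ) :
    ∃ C : ℝ, 0 ≤ C ∧ ∀ x : Plane, ‖iteratedFDeriv ℝ k (fun x => (1 - originBump x) • f x) x‖ ≤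
      C * (1 + ‖x‖) ^ (d - k) := by
  obtain ⟨C, hC0, hC⟩ := exists_norm_iteratedFDeriv_le_of_homogeneous hf hd k
  obtain ⟨B, hB⟩ := (isCompact_closedBall (0 : Plane) 1).exists_bound_of_continuousOn
    ((contDiff_one_sub_originBump_smul hf).continuous_iteratedFDeriv (m := k)
      (by exact_mod_cast le_top)).continuousOn
  have hdk : d - k ≤ 0 := by have : (0:ℝ) ≤ k := k.cast_nonneg; linarith
  refine ⟨(|B| + C) * 2 ^ (-(d - k)), by positivity, fun x => ?_⟩
  have h2 : (2:ℝ) ^ (-(d - k)) * 2 ^ (d - k) = 1 := by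
    rw [← Real.rpow_add (by norm_num)]; simp
  rcases le_or_gt ‖x‖ 1 with hx | hx
  · have h1 : (2:ℝ) ^ (d - k) ≤ (1 + ‖x‖) ^ (d - k) :=
      Real.rpow_le_rpow_of_nonpos (by positivity) (by linarith) hdk
    calc _ ≤ |B| := (hB x (by simpa using hx)).trans (le_abs_self B)
      _ ≤ |B| + C := by linarith
      _ = (|B| + C) * 2 ^ (-(d - k)) * 2 ^ (d - k) := by rw [mul_assoc, h2, mul_one]
      _ ≤ _ := by gcongr
  · have hx0 : x ≠ 0 := norm_pos_iff.1 (by linarith)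
    rw [iteratedFDeriv_one_sub_originBump_smul k (by linarith)]
    have h1 : ‖x‖ ^ (d - k) ≤ 2 ^ (-(d - k)) * (1 + ‖x‖) ^ (d - k) := by
      have : ((1 + ‖x‖) / 2) ^ (d - k) = 2 ^ (-(d - k)) * (1 + ‖x‖) ^ (d - k) := by
        rw [Real.div_rpow (by positivity) (by norm_num), Real.rpow_neg (by norm_num)]
        ring
      rw [← this]
      exact Real.rpow_le_rpow_of_nonpos (by positivity) (by linarith) hdk
    calc _ ≤ C * ‖x‖ ^ (d - k) := hC x hx0
      _ ≤ C * (2 ^ (-(d - k)) * (1 + ‖x‖) ^ (d - k)) := by gcongr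
      _ ≤ (|B| + C) * (2 ^ (-(d - k)) * (1 + ‖x‖) ^ (d - k)) := by
        gcongr; linarith [abs_nonneg B]
      _ = _ := by ring

theorem contDiffOn_norm_rpow (p : ℝ) : ContDiffOn ℝ ∞ (fun x : Plane => ‖x‖ ^ p) {0}ᶜ := by
  intro x hx
  have hx : x ≠ 0 := hx
  exact ((contDiffAt_norm ℝ hx).rpow_const_of_ne (norm_ne_zero_iff.2 hx)).contDiffWithinAt

theorem norm_smul_rpow {t : ℝ} (ht : 0 < t) (p : ℝ) (x : Plane) :
    ‖t • x‖ ^ p = t ^ p * ‖x‖ ^ p := by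
  rw [norm_smul, Real.norm_of_nonneg ht.le, Real.mul_rpow ht.le (norm_nonneg x)]

end Scaling

open scoped FourierTransform

/-! ### Derivative bounds for exponentials of the smoothed power. -/

section FourierDecay

/-- `|ξ|^{2α}` with the singularity at the origin removed. -/
def smoothPower (α : ℝ) (ξ : Plane) : ℝ := (1 - originBump ξ) • ‖ξ‖ ^ (2 * α)

theorem contDiff_smoothPower (α : ℝ) : ContDiff ℝ ∞ (smoothPower α) :=
  contDiff_one_sub_originBump_smul (contDiffOn_norm_rpow (2 * α))

theorem smoothPower_nonneg (α : ℝ) (ξ : Plane) : 0 ≤ smoothPower α ξ :=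
  mul_nonneg (sub_nonneg.2 originBump.le_one) (by positivity)

theorem smoothPower_eq (α : ℝ) {ξ : Plane} (h : 1 / 4 ≤ ‖ξ‖) : smoothPower α ξ = ‖ξ‖ ^ (2 * α) := by
  simp [smoothPower, originBump_eq_zero h]

theorem norm_iteratedFDeriv_exp_neg_le (i : ℕ) {s : ℝ} :
    ‖iteratedFDeriv ℝ i (fun s : ℝ => Real.exp (-s)) s‖ = Real.exp (-s) := by
  rw [norm_iteratedFDeriv_eq_norm_iteratedDeriv]
  have := congrFun (iteratedDeriv_exp_const_mul i (-1 : ℝ)) s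
  simp only [neg_mul, one_mul] at this
  rw [this]
  simp

/-- Where |ξ| > 1, the derivatives of s = |ξ|^{2α} are O(s), so the chain rule gives at most e^{-s}
s^q up to constants, and e^{-s} beats every power of s. As 2α > 1, s ≥ |ξ|, hence powers of s
dominate powers of |ξ|. -/
theorem exists_iteratedFDeriv_exp_neg_smoothPower_le {α : ℝ} (hα : 1 / 2 < α) (q N : ℕ) :
    ∃ C : ℝ, 0 ≤ C ∧ ∀ ξ : Plane,
      ‖iteratedFDeriv ℝ q (fun ξ => Real.exp (-smoothPower α ξ)) ξ‖ ≤ C * (1 + ‖ξ‖) ^ (-(N:ℝ)) := by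
  have hP := contDiff_smoothPower α
  have hsm : ContDiff ℝ ∞ fun ξ => Real.exp (-smoothPower α ξ) := hP.neg.exp
  obtain ⟨B, hB⟩ := (isCompact_closedBall (0 : Plane) 1).exists_bound_of_continuousOn
    (hsm.continuous_iteratedFDeriv (m := q) (by exact_mod_cast le_top)).continuousOn
  have hhom := fun i : ℕ => exists_norm_iteratedFDeriv_le_of_homogeneous
    (f := fun x : Plane => ‖x‖ ^ (2 * α)) (d := 2 * α) (contDiffOn_norm_rpow (2 * α))
    (fun t ht x _ => by simpa using norm_smul_rpow ht (2 * α) x) i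
  choose A hA0 hA using hhom
  set D : ℝ := 1 + ∑ i ∈ Finset.range (q + 1), A i with hD
  have hD1 : 1 ≤ D := by
    have := Finset.sum_nonneg (s := Finset.range (q + 1)) fun i _ => hA0 i
    linarith
  have hAD : ∀ i ≤ q, A i ≤ D := fun i hi => by
    have := Finset.single_le_sum (f := A) (fun i _ => hA0 i)
      (Finset.mem_range.2 (Nat.lt_succ_of_le hi))
    linarith
  set K : ℝ := q.factorial * D ^ q * (q + N).factorial with hK
  have hN : ∀ ξ : Plane, 0 < 1 + ‖ξ‖ := fun ξ => by positivity
  refine ⟨(|B| + K) * 2 ^ N, by positivity, fun ξ => ?_⟩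
  rcases le_or_gt ‖ξ‖ 1 with hξ | hξ
  · have h1 : (2:ℝ) ^ (-(N:ℝ)) ≤ (1 + ‖ξ‖) ^ (-(N:ℝ)) :=
      Real.rpow_le_rpow_of_nonpos (hN ξ) (by linarith) (by simp)
    have h2 : (2:ℝ) ^ N * 2 ^ (-(N:ℝ)) = 1 := by
      rw [Real.rpow_neg (by norm_num), Real.rpow_natCast, mul_inv_cancel₀ (by positivity)]
    calc _ ≤ |B| := (hB ξ (by simpa using hξ)).trans (le_abs_self B)
      _ ≤ |B| + K := by have : 0 ≤ K := by positivity
                        linarith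
      _ = (|B| + K) * 2 ^ N * 2 ^ (-(N:ℝ)) := by rw [mul_assoc, h2, mul_one]
      _ ≤ _ := by gcongr
  · have hξ0 : ξ ≠ 0 := norm_pos_iff.1 (by linarith)
    set s := ‖ξ‖ ^ (2 * α) with hs
    have hs1 : ‖ξ‖ ≤ s := by
      calc ‖ξ‖ = ‖ξ‖ ^ (1:ℝ) := (Real.rpow_one _).symm
        _ ≤ _ := Real.rpow_le_rpow_of_exponent_le hξ.le (by linarith)
    have hPs : smoothPower α ξ = s := smoothPower_eq α (by linarith)
    have hcomp := norm_iteratedFDeriv_comp_le (𝕜 := ℝ) (n := q) (N := ∞)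
      (g := fun s : ℝ => Real.exp (-s)) (f := smoothPower α) (by fun_prop) hP
      (by exact_mod_cast le_top) ξ (C := Real.exp (-s)) (D := D * s)
      (fun i _ => by rw [norm_iteratedFDeriv_exp_neg_le, hPs])
      (fun i hi hiq => by
        have e : iteratedFDeriv ℝ i (smoothPower α) ξ =
            iteratedFDeriv ℝ i (fun x : Plane => ‖x‖ ^ (2 * α)) ξ :=
          iteratedFDeriv_one_sub_originBump_smul i (by linarith)
        rw [e]
        -- The composition bound wants the i-th derivative below an i-th power. A single factor D s
        -- suffices because D s ≥ 1 and i ≥ 1.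
        have hDs : 1 ≤ D * s := by nlinarith
        calc _ ≤ A i * ‖ξ‖ ^ (2 * α - i) := hA i ξ hξ0
          _ ≤ D * ‖ξ‖ ^ (2 * α) := by
            gcongr
            · exact hAD i hiq
            · exact hξ.le
            · simp
          _ ≤ (D * s) ^ i := le_self_pow₀ hDs (by omega))
    have hexp : Real.exp (-s) * s ^ (q + N) ≤ (q + N).factorial := by
      have := Real.pow_div_factorial_le_exp (x := s) (by positivity) (q + N)
      rw [Real.exp_neg, inv_mul_le_iff₀ (Real.exp_pos s)]
      rw [div_le_iff₀ (by positivity)] at this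
      exact this
    have h2 : 1 ≤ 2 ^ N * s ^ N * (1 + ‖ξ‖) ^ (-(N:ℝ)) := by
      rw [Real.rpow_neg (hN ξ).le, Real.rpow_natCast, ← div_eq_mul_inv, one_le_div (by positivity),
        ← mul_pow]
      gcongr
      linarith
    calc _ ≤ q.factorial * Real.exp (-s) * (D * s) ^ q := hcomp
      _ ≤ (q.factorial * Real.exp (-s) * (D * s) ^ q) * (2 ^ N * s ^ N * (1 + ‖ξ‖) ^ (-(N:ℝ))) :=
        le_mul_of_one_le_right (by positivity) h2
      _ = (q.factorial * D ^ q * (Real.exp (-s) * s ^ (q + N))) *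
          (2 ^ N * (1 + ‖ξ‖) ^ (-(N:ℝ))) := by rw [mul_pow, pow_add]; ring
      _ ≤ K * (2 ^ N * (1 + ‖ξ‖) ^ (-(N:ℝ))) := by rw [hK]; gcongr
      _ ≤ (|B| + K) * (2 ^ N * (1 + ‖ξ‖) ^ (-(N:ℝ))) := by
        gcongr; linarith [abs_nonneg B]
      _ = _ := by ring

/-- To first order e^{-tP} - 1 is -tP, hence the linear dependence on t. Subtracting 1 matters only
for q = 0, where 1 - e^{-s} ≤ s is used. -/
theorem exists_iteratedFDeriv_exp_neg_mul_smoothPower_sub_one_le (α : ℝ) (q : ℕ) :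
    ∃ C : ℝ, 0 ≤ C ∧ ∀ t : ℝ, 0 < t → t ≤ 1 → ∀ η ∈ Metric.closedBall (0 : Plane) 1,
      ‖iteratedFDeriv ℝ q (fun η => Real.exp (-(t * smoothPower α η)) - 1) η‖ ≤ C * t := by
  have hP := contDiff_smoothPower α
  have hbd := fun i : ℕ => (isCompact_closedBall (0 : Plane) 1).exists_bound_of_continuousOn
    (hP.continuous_iteratedFDeriv (m := i) (by exact_mod_cast le_top)).continuousOn
  choose A hA using hbd
  set D : ℝ := 1 + ∑ i ∈ Finset.range (q + 1), |A i| with hD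
  have hD1 : 1 ≤ D := by
    have := Finset.sum_nonneg (s := Finset.range (q + 1)) fun i _ => abs_nonneg (A i)
    linarith
  have hAD : ∀ i ≤ q, A i ≤ D := fun i hi => by
    have := Finset.single_le_sum (f := fun i => |A i|) (fun i _ => abs_nonneg (A i))
      (Finset.mem_range.2 (Nat.lt_succ_of_le hi))
    linarith [le_abs_self (A i)]
  refine ⟨q.factorial * D ^ (q + 1), by positivity, fun t ht ht1 η hη => ?_⟩
  rcases Nat.eq_zero_or_pos q with rfl | hq
  · rw [norm_iteratedFDeriv_zero]
    have h0 : 0 ≤ t * smoothPower α η := mul_nonneg ht.le (smoothPower_nonneg α η)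
    have h1 : Real.exp (-(t * smoothPower α η)) ≤ 1 := Real.exp_le_one_iff.2 (by linarith)
    have h2 := Real.add_one_le_exp (-(t * smoothPower α η))
    have h3 : smoothPower α η ≤ D := by
      have := hA 0 η hη
      rw [norm_iteratedFDeriv_zero] at this
      exact (le_abs_self _).trans (this.trans (hAD 0 le_rfl))
    rw [Real.norm_of_nonpos (by linarith)]
    simp only [Nat.factorial_zero, Nat.cast_one, zero_add, pow_one, one_mul]
    nlinarith
  · have hexp : ∀ i ≤ q, ‖iteratedFDeriv ℝ i (fun s : ℝ => Real.exp (-s)) (t * smoothPower α η)‖ ≤ 1 :=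
      fun i _ => by
        rw [norm_iteratedFDeriv_exp_neg_le]
        exact Real.exp_le_one_iff.2 (by
          linarith [mul_nonneg ht.le (smoothPower_nonneg α η)])
    have hq0 : (0:ℝ) < q := by exact_mod_cast hq
    -- The base D t^{1/q} is chosen so that its q-th power is exactly linear in t, while for i ≤ q
    -- and t ≤ 1 its i-th power still dominates t D^i.
    have hcomp := norm_iteratedFDeriv_comp_le (𝕜 := ℝ) (n := q) (N := ∞)
      (g := fun s : ℝ => Real.exp (-s)) (f := fun η => t * smoothPower α η) (by fun_prop)
      (contDiff_const.mul hP)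
      (by exact_mod_cast le_top) η (C := 1) (D := D * t ^ (1 / (q:ℝ))) hexp
      (fun i hi hiq => by
        have e : iteratedFDeriv ℝ i (fun η => t * smoothPower α η) η =
            t • iteratedFDeriv ℝ i (smoothPower α) η :=
          iteratedFDeriv_const_smul_apply' (𝕜 := ℝ) (i := i) (a := t) (x := η)
            (hP.contDiffAt.of_le (by exact_mod_cast le_top))
        rw [e, norm_smul, Real.norm_of_nonneg ht.le, mul_pow, ← Real.rpow_natCast (t ^ _),
          ← Real.rpow_mul ht.le, mul_comm]
        have h1 : t ≤ t ^ (1 / (q:ℝ) * i) := by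
          calc t = t ^ (1:ℝ) := (Real.rpow_one t).symm
            _ ≤ _ := Real.rpow_le_rpow_of_exponent_ge ht ht1 (by
              rw [one_div, inv_mul_le_iff₀ hq0, mul_one]; exact_mod_cast hiq)
        have h2 : ‖iteratedFDeriv ℝ i (smoothPower α) η‖ ≤ D ^ i :=
          ((hA i η hη).trans (hAD i hiq)).trans (le_self_pow₀ hD1 (by omega))
        gcongr)
    have e : iteratedFDeriv ℝ q (fun η => Real.exp (-(t * smoothPower α η)) - 1) η =
        iteratedFDeriv ℝ q ((fun s : ℝ => Real.exp (-s)) ∘ fun η => t * smoothPower α η) η := by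
      have h1 : ContDiffAt ℝ q (fun η => Real.exp (-(t * smoothPower α η))) η :=
        ((contDiff_const.mul hP).neg.exp.contDiffAt).of_le (by exact_mod_cast le_top)
      have := iteratedFDeriv_sub_apply (𝕜 := ℝ) (i := q) h1 (contDiffAt_const (c := (1:ℝ)))
      rw [iteratedFDeriv_const_of_ne (by omega)] at this
      simpa [Function.comp_def, Pi.sub_def] using this
    rw [e]
    refine hcomp.trans ?_
    rw [mul_pow, ← Real.rpow_natCast (t ^ _), ← Real.rpow_mul ht.le, one_div,
      inv_mul_cancel₀ hq0.ne', Real.rpow_one, mul_one, pow_succ]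
    have : D ^ q ≤ D ^ q * D := le_mul_of_one_le_right (by positivity) hD1
    calc _ = q.factorial * D ^ q * t := by ring
      _ ≤ q.factorial * (D ^ q * D) * t := by gcongr

end FourierDecay

open scoped FourierTransform

/-! ### Fourier transforms of real functions with finite moments. -/

section FourierDecay

/-- The Fourier transform of a real-valued function. -/
def fourierReal (h : Plane → ℝ) : Plane → ℂ := 𝓕 fun ξ => (h ξ : ℂ)

/-- A continuous function all of whose moments are absolutely convergent. -/
def HasMoments (h : Plane → ℝ) : Prop :=
  Continuous h ∧ ∀ n : ℕ, Integrable fun v => ‖v‖ ^ n * ‖h v‖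

theorem HasMoments.add {h g : Plane → ℝ} (hh : HasMoments h) (hg : HasMoments g) :
    HasMoments fun v => h v + g v := by
  refine ⟨hh.1.add hg.1, fun n => ((hh.2 n).add (hg.2 n)).mono' ?_ (Eventually.of_forall fun v => ?_)⟩
  · exact Continuous.aestronglyMeasurable
      ((continuous_norm.pow n).mul (hh.1.add hg.1).norm)
  · rw [Real.norm_of_nonneg (by positivity)]
    simp only [Pi.add_apply]
    rw [← mul_add]
    gcongr
    exact norm_add_le _ _

theorem hasMoments_of_hasCompactSupport {h : Plane → ℝ} (hc : Continuous h)
    (hs : HasCompactSupport h) : HasMoments h :=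
  ⟨hc, fun n => Continuous.integrable_of_hasCompactSupport
    ((continuous_norm.pow n).mul hc.norm) hs.norm.mul_left⟩

theorem HasMoments.integrable {h : Plane → ℝ} (hh : HasMoments h) :
    Integrable fun ξ => (h ξ : ℂ) := by
  have := hh.2 0
  simp only [pow_zero, one_mul] at this
  exact ((integrable_norm_iff hh.1.aestronglyMeasurable).1 this).ofReal

theorem HasMoments.contDiff_fourierReal {h : Plane → ℝ} (hh : HasMoments h) :
    ContDiff ℝ ∞ (fourierReal h) :=
  Real.contDiff_fourier (N := ⊤) fun n _ => by simpa using hh.2 n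

theorem iteratedFDeriv_fourierReal_add {h g : Plane → ℝ} (hh : HasMoments h) (hg : HasMoments g)
    (k : ℕ) (w : Plane) : iteratedFDeriv ℝ k (fourierReal fun v => h v + g v) w =
      iteratedFDeriv ℝ k (fourierReal h) w + iteratedFDeriv ℝ k (fourierReal g) w := by
  have e : (fourierReal fun v => h v + g v) = fourierReal h + fourierReal g := by
    funext w
    simp only [fourierReal, Pi.add_apply, Real.fourier_eq, Complex.ofReal_add, smul_add]
    refine integral_add ?_ ?_
    · exact (Real.fourierIntegral_convergent_iff w).2 hh.integrable
    · exact (Real.fourierIntegral_convergent_iff w).2 hg.integrable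
  rw [e]
  exact iteratedFDeriv_add_apply (hh.contDiff_fourierReal.contDiffAt.of_le (by exact_mod_cast le_top))
    (hg.contDiff_fourierReal.contDiffAt.of_le (by exact_mod_cast le_top))

/-- The order `N` is left free: it is `⊤` for the smooth symbols, and 0 for the remainder of the
approximation, which is only continuous. -/
theorem pow_mul_norm_iteratedFDeriv_fourierReal_le {h : Plane → ℝ} {N : ℕ∞}
    (hs : ContDiff ℝ N h)
    (hi : ∀ p q : ℕ, q ≤ N → Integrable fun v => ‖v‖ ^ p * ‖iteratedFDeriv ℝ q h v‖)
    (k n : ℕ) (hn : n ≤ N) (w : Plane) :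
    ‖w‖ ^ n * ‖iteratedFDeriv ℝ k (fourierReal h) w‖ ≤ (2 * Real.pi) ^ k * (2 * k + 2) ^ n *
      ∑ p ∈ Finset.range (k + 1) ×ˢ Finset.range (n + 1),
        ∫ v, ‖v‖ ^ p.1 * ‖iteratedFDeriv ℝ p.2 h v‖ := by
  have e : ∀ q v, ‖iteratedFDeriv ℝ q (fun ξ => (h ξ : ℂ)) v‖ = ‖iteratedFDeriv ℝ q h v‖ ∨
      ¬ (q ≤ N) := by
    intro q v
    by_cases hq : (q : ℕ∞) ≤ N
    · exact Or.inl (LinearIsometry.norm_iteratedFDeriv_comp_left Complex.ofRealLI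
        (hs.contDiffAt (x := v)) (by exact_mod_cast hq))
    · exact Or.inr hq
  have e' : ∀ q : ℕ, q ≤ N → ∀ v, ‖iteratedFDeriv ℝ q (fun ξ => (h ξ : ℂ)) v‖ =
      ‖iteratedFDeriv ℝ q h v‖ := fun q hq v => (e q v).resolve_right (not_not.2 hq)
  have := Real.pow_mul_norm_iteratedFDeriv_fourier_le (K := ⊤) (N := N)
    (f := fun ξ : Plane => (h ξ : ℂ)) (Complex.ofRealCLM.contDiff.comp hs)
    (fun p q _ hq => by simpa only [e' q hq] using hi p q hq) (k := k) (n := n) le_top hn w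
  refine this.trans_eq ?_
  congr 1
  refine Finset.sum_congr rfl fun p hp => ?_
  have hp2 : (p.2 : ℕ∞) ≤ N := by
    refine le_trans ?_ hn
    have := (Finset.mem_product.1 hp).2
    exact_mod_cast Nat.lt_succ_iff.1 (Finset.mem_range.1 this)
  simp only [e' p.2 hp2]

/-- The factor c² is the Jacobian of the dilation in the plane. -/
theorem fourierReal_comp_smul (h : Plane → ℝ) {c : ℝ} (hc : 0 < c) (w : Plane) :
    fourierReal (fun ξ => h (c • ξ)) w = (c ^ 2)⁻¹ • fourierReal h (c⁻¹ • w) := by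
  have := Measure.integral_comp_smul_of_nonneg (volume : Measure Plane) (fun v : Plane =>
    Complex.exp (((-2 * Real.pi * inner ℝ v (c⁻¹ • w) : ℝ) : ℂ) * Complex.I) • (h v : ℂ)) c
    (hR := hc.le)
  simp only [finrank_euclideanSpace, Fintype.card_fin] at this
  simp only [fourierReal, Real.fourier_eq']
  rw [← this]
  congr 1
  funext v
  rw [real_inner_smul_left, real_inner_smul_right, ← mul_assoc c, mul_inv_cancel₀ hc.ne', one_mul]

theorem norm_iteratedFDeriv_fourierReal_comp_smul {h : Plane → ℝ} (hh : HasMoments h) {c : ℝ}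
    (hc : 0 < c) (k : ℕ) (w : Plane) :
    ‖iteratedFDeriv ℝ k (fourierReal fun ξ => h (c • ξ)) w‖ =
      (c ^ 2)⁻¹ * (c ^ k)⁻¹ * ‖iteratedFDeriv ℝ k (fourierReal h) (c⁻¹ • w)‖ := by
  have e : (fourierReal fun ξ => h (c • ξ)) = fun w => (c ^ 2)⁻¹ • fourierReal h (c⁻¹ • w) :=
    funext (fourierReal_comp_smul h hc)
  have hcd : ContDiffAt ℝ k (fun w => fourierReal h (c⁻¹ • w)) w := by
    have := hh.contDiff_fourierReal
    have h2 : ContDiff ℝ ∞ (fun w : Plane => fourierReal h (c⁻¹ • w)) := by fun_prop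
    exact h2.contDiffAt.of_le (by exact_mod_cast le_top)
  rw [e, iteratedFDeriv_const_smul_apply' hcd, norm_smul,
    norm_iteratedFDeriv_comp_smul (inv_ne_zero hc.ne'), Real.norm_of_nonneg (by positivity),
    abs_of_pos (by positivity), inv_pow]
  ring

end FourierDecay

/-! ### Decay of the heat kernel by dyadic smoothing of its symbol. -/

section KernelDecay

/-- The symbol `e^{-|ξ|^{2α}}`. -/
def heatSymbol (α : ℝ) (ξ : Plane) : ℝ := Real.exp (-‖ξ‖ ^ (2 * α))

/-- The symbol, smoothed at frequencies below `1/c`. -/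
def smoothSymbol (α c : ℝ) (ξ : Plane) : ℝ :=
  Real.exp (-(c ^ (-(2 * α)) * smoothPower α (c • ξ)))

/-- The rescaled difference of two consecutive smoothed symbols. -/
def symbolIncrement (α t : ℝ) (η : Plane) : ℝ :=
  (Real.exp (-(2 ^ (-(2 * α)) * t * smoothPower α ((2:ℝ) • η))) - 1) -
    (Real.exp (-(t * smoothPower α η)) - 1)

/-- With t = c^{-2α}, doubling c multiplies t by 2^{-2α}. The two subtracted ones in
`symbolIncrement` cancel here; they make each half separately O(t). -/
theorem smoothSymbol_two_mul {α c : ℝ} (hc : 0 < c) (ξ : Plane) :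
    smoothSymbol α (2 * c) ξ =
      smoothSymbol α c ξ + symbolIncrement α (c ^ (-(2 * α))) (c • ξ) := by
  simp only [smoothSymbol, symbolIncrement, smul_smul, Real.mul_rpow zero_le_two hc.le]
  ring

theorem smoothSymbol_eq {α c : ℝ} (hc : 0 < c) {ξ : Plane} (h : 1 / 4 ≤ ‖c • ξ‖) :
    smoothSymbol α c ξ = heatSymbol α ξ := by
  rw [smoothSymbol, smoothPower_eq α h, norm_smul_rpow hc, ← mul_assoc, ← Real.rpow_add hc,
    neg_add_cancel, Real.rpow_zero, one_mul, heatSymbol]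

/-- Away from the smoothed region both exponents equal -t|η|^{2α}, by homogeneity. The increments
therefore live in one ball, independent of t. -/
theorem symbolIncrement_eq_zero {α t : ℝ} {η : Plane} (h : 1 / 4 ≤ ‖η‖) :
    symbolIncrement α t η = 0 := by
  have h2 : 1 / 4 ≤ ‖(2:ℝ) • η‖ := by
    rw [norm_smul, Real.norm_of_nonneg zero_le_two]; linarith [norm_nonneg η]
  have : (2:ℝ) ^ (-(2 * α)) * t * (2 ^ (2 * α) * ‖η‖ ^ (2 * α)) = t * ‖η‖ ^ (2 * α) := by
    have h3 : (2:ℝ) ^ (-(2 * α)) * 2 ^ (2 * α) = 1 := by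
      rw [← Real.rpow_add two_pos, neg_add_cancel, Real.rpow_zero]
    linear_combination t * ‖η‖ ^ (2 * α) * h3
  rw [symbolIncrement, smoothPower_eq α h, smoothPower_eq α h2, norm_smul_rpow two_pos, this,
    sub_self]

theorem contDiff_symbolIncrement (α t : ℝ) : ContDiff ℝ ∞ (symbolIncrement α t) := by
  have := contDiff_smoothPower α
  unfold symbolIncrement
  fun_prop

theorem tsupport_symbolIncrement_subset (α t : ℝ) :
    tsupport (symbolIncrement α t) ⊆ Metric.closedBall 0 (1 / 4) := by
  refine closure_minimal (fun η hη => ?_) Metric.isClosed_closedBall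
  rw [mem_closedBall_zero_iff]
  by_contra h
  exact hη (symbolIncrement_eq_zero (le_of_lt (not_le.1 h)))

theorem hasCompactSupport_symbolIncrement (α t : ℝ) :
    HasCompactSupport (symbolIncrement α t) :=
  (isCompact_closedBall (0 : Plane) (1 / 4)).of_isClosed_subset (isClosed_tsupport _)
    (tsupport_symbolIncrement_subset α t)

theorem exists_iteratedFDeriv_symbolIncrement_le {α : ℝ} (hα : 0 ≤ α) (q : ℕ) :
    ∃ C : ℝ, 0 ≤ C ∧ ∀ t : ℝ, 0 < t → t ≤ 1 → ∀ η : Plane,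
      ‖iteratedFDeriv ℝ q (symbolIncrement α t) η‖ ≤ C * t := by
  obtain ⟨C, hC0, hC⟩ := exists_iteratedFDeriv_exp_neg_mul_smoothPower_sub_one_le α q
  refine ⟨2 ^ q * C + C, by positivity, fun t ht ht1 η => ?_⟩
  by_cases hη : ‖η‖ ≤ 1 / 4
  · have hP := contDiff_smoothPower α
    have h2α : (2:ℝ) ^ (-(2 * α)) ≤ 1 :=
      Real.rpow_le_one_of_one_le_of_nonpos one_le_two (by linarith)
    have h2p : (0:ℝ) < 2 ^ (-(2 * α)) := by positivity
    set t' := (2:ℝ) ^ (-(2 * α)) * t with ht'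
    have ht'0 : 0 < t' := by positivity
    have ht't : t' ≤ t := mul_le_of_le_one_left ht.le h2α
    set E : ℝ → Plane → ℝ := fun t η => Real.exp (-(t * smoothPower α η)) - 1 with hE
    have hEs : ∀ t, ContDiff ℝ ∞ (E t) := fun t => by
      simp only [hE]; fun_prop
    have e : symbolIncrement α t = (fun η => E t' ((2:ℝ) • η)) - E t := rfl
    have hE2 : ContDiff ℝ ∞ fun η : Plane => E t' ((2:ℝ) • η) := by
      have := hEs t'; fun_prop
    rw [e, iteratedFDeriv_sub_apply (hE2.contDiffAt.of_le (by exact_mod_cast le_top))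
      ((hEs t).contDiffAt.of_le (by exact_mod_cast le_top))]
    refine (norm_sub_le _ _).trans ?_
    rw [norm_iteratedFDeriv_comp_smul two_ne_zero, abs_of_pos two_pos]
    have b1 := hC t' ht'0 (ht't.trans ht1) ((2:ℝ) • η) (by
      rw [mem_closedBall_zero_iff, norm_smul, Real.norm_of_nonneg zero_le_two]; linarith)
    have b2 := hC t ht ht1 η (by rw [mem_closedBall_zero_iff]; linarith)
    calc _ ≤ 2 ^ q * (C * t') + C * t := by gcongr
      _ ≤ 2 ^ q * (C * t) + C * t := by gcongr
      _ = _ := by ring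
  · have : iteratedFDeriv ℝ q (symbolIncrement α t) η = 0 := by
      by_contra h
      have := tsupport_symbolIncrement_subset α t (support_iteratedFDeriv_subset (𝕜 := ℝ) q h)
      exact hη (by simpa using this)
    rw [this, norm_zero]
    positivity

/-- All derivatives of the increment are O(t) on a support of fixed volume, so every integral in the
Fourier bound inherits the factor t. -/
theorem exists_fourierReal_symbolIncrement_le {α : ℝ} (hα : 0 ≤ α) (k n : ℕ) :
    ∃ C : ℝ, 0 ≤ C ∧ ∀ t : ℝ, 0 < t → t ≤ 1 → ∀ w : Plane,
      ‖w‖ ^ n * ‖iteratedFDeriv ℝ k (fourierReal (symbolIncrement α t)) w‖ ≤ C * t := by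
  choose A hA0 hA using exists_iteratedFDeriv_symbolIncrement_le hα
  set V : ℝ := volume.real (Metric.closedBall (0 : Plane) (1 / 4)) with hV
  refine ⟨(2 * Real.pi) ^ k * (2 * k + 2) ^ n *
      ∑ p ∈ Finset.range (k + 1) ×ˢ Finset.range (n + 1), A p.2 * V, ?_, fun t ht ht1 w => ?_⟩
  · have : 0 ≤ ∑ p ∈ Finset.range (k + 1) ×ˢ Finset.range (n + 1), A p.2 * V :=
      Finset.sum_nonneg fun p _ => mul_nonneg (hA0 _) measureReal_nonneg
    positivity
  have hsm := contDiff_symbolIncrement α t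
  have hi : ∀ p q : ℕ, (q : ℕ∞) ≤ ⊤ →
      Integrable fun v => ‖v‖ ^ p * ‖iteratedFDeriv ℝ q (symbolIncrement α t) v‖ := by
    intro p q _
    refine Continuous.integrable_of_hasCompactSupport ((continuous_norm.pow p).mul
      (hsm.continuous_iteratedFDeriv (m := q) (by exact_mod_cast le_top)).norm) ?_
    exact (((hasCompactSupport_symbolIncrement α t).iteratedFDeriv (𝕜 := ℝ) q).norm).mul_left
  have h0 : ∀ q, ∀ v ∉ Metric.closedBall (0 : Plane) (1 / 4),
      iteratedFDeriv ℝ q (symbolIncrement α t) v = 0 := by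
    intro q v hv
    by_contra h
    exact hv (tsupport_symbolIncrement_subset α t (support_iteratedFDeriv_subset (𝕜 := ℝ) q h))
  refine (pow_mul_norm_iteratedFDeriv_fourierReal_le (N := ⊤) hsm hi k n le_top w).trans ?_
  rw [mul_assoc, mul_assoc, mul_assoc, Finset.sum_mul]
  gcongr with p hp
  rw [← setIntegral_eq_integral_of_forall_compl_eq_zero (s := Metric.closedBall (0:Plane) (1 / 4))
    (fun v hv => by rw [h0 _ v hv, norm_zero, mul_zero])]
  have := norm_setIntegral_le_of_norm_le_const (μ := volume) (C := A p.2 * t)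
    (s := Metric.closedBall (0:Plane) (1 / 4))
    (f := fun v => ‖v‖ ^ p.1 * ‖iteratedFDeriv ℝ p.2 (symbolIncrement α t) v‖)
    measure_closedBall_lt_top (fun v hv => by
      rw [Real.norm_of_nonneg (by positivity)]
      have hv1 : ‖v‖ ≤ 1 := by rw [mem_closedBall_zero_iff] at hv; linarith
      calc _ ≤ 1 * (A p.2 * t) := by
            gcongr
            · exact pow_le_one₀ (norm_nonneg v) hv1
            · exact hA _ t ht ht1 v
        _ = _ := one_mul _)
  calc _ ≤ _ := le_abs_self _
    _ ≤ A p.2 * t * V := this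
    _ = _ := by ring

theorem exists_fourierReal_smoothSymbol_one_le {α : ℝ} (hα : 1 / 2 < α) (k n : ℕ) :
    ∃ C : ℝ, ∀ w : Plane,
      ‖w‖ ^ n * ‖iteratedFDeriv ℝ k (fourierReal (smoothSymbol α 1)) w‖ ≤ C := by
  have e : smoothSymbol α 1 = fun ξ => Real.exp (-smoothPower α ξ) := by
    funext ξ; simp [smoothSymbol]
  rw [e]
  have hsm : ContDiff ℝ ∞ fun ξ => Real.exp (-smoothPower α ξ) :=
    (contDiff_smoothPower α).neg.exp
  refine ⟨_, pow_mul_norm_iteratedFDeriv_fourierReal_le (N := ⊤) hsm (fun p q _ => ?_) k n le_top⟩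
  obtain ⟨C, hC0, hC⟩ := exists_iteratedFDeriv_exp_neg_smoothPower_le hα q (p + 3)
  refine ((integrable_one_add_norm (E := Plane) (μ := volume) (r := 3)
    (by rw [finrank_euclideanSpace]; norm_num)).const_mul C).mono' ?_
    (Eventually.of_forall fun v => ?_)
  · exact Continuous.aestronglyMeasurable ((continuous_norm.pow p).mul
      (hsm.continuous_iteratedFDeriv (m := q) (by exact_mod_cast le_top)).norm)
  · rw [Real.norm_of_nonneg (by positivity)]
    have h0 : 0 < 1 + ‖v‖ := by positivity
    calc _ ≤ (1 + ‖v‖) ^ p * (C * (1 + ‖v‖) ^ (-((p + 3 : ℕ):ℝ))) := by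
          gcongr
          · linarith
          · exact hC v
      _ = _ := by
          rw [← Real.rpow_natCast, mul_left_comm, ← Real.rpow_add h0]
          push_cast
          ring_nf

theorem continuous_heatSymbol {α : ℝ} (hα : 0 ≤ α) : Continuous (heatSymbol α) :=
  ((continuous_norm.rpow_const fun _ => Or.inr (by linarith)).neg).rexp

theorem continuous_smoothSymbol (α c : ℝ) : Continuous (smoothSymbol α c) := by
  have := (contDiff_smoothPower α).continuous
  unfold smoothSymbol
  fun_prop

theorem abs_heatSymbol_sub_smoothSymbol_le {α c : ℝ} (hc : 0 < c) (ξ : Plane) :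
    |heatSymbol α ξ - smoothSymbol α c ξ| ≤ 1 := by
  have h1 : heatSymbol α ξ ≤ 1 := Real.exp_le_one_iff.2 (neg_nonpos.2 (by positivity))
  have h2 : smoothSymbol α c ξ ≤ 1 := Real.exp_le_one_iff.2 (neg_nonpos.2
    (mul_nonneg (by positivity) (smoothPower_nonneg _ _)))
  have h3 : 0 < heatSymbol α ξ := Real.exp_pos _
  have h4 : 0 < smoothSymbol α c ξ := Real.exp_pos _
  rw [abs_le]
  constructor <;> linarith

theorem hasCompactSupport_heatSymbol_sub {α c : ℝ} (hc : 0 < c) :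
    HasCompactSupport fun ξ => heatSymbol α ξ - smoothSymbol α c ξ := by
  refine HasCompactSupport.intro (isCompact_closedBall (0 : Plane) (c⁻¹ / 4)) fun ξ hξ => ?_
  rw [smoothSymbol_eq hc, sub_self]
  rw [mem_closedBall_zero_iff, not_le] at hξ
  rw [norm_smul, Real.norm_of_nonneg hc.le]
  have := mul_lt_mul_of_pos_left hξ hc
  rw [mul_div_assoc', mul_inv_cancel₀ hc.ne'] at this
  exact this.le

theorem hasMoments_smoothSymbol {α : ℝ} (hα : 1 / 2 < α) (J : ℕ) :
    HasMoments (smoothSymbol α (2 ^ J)) := by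
  induction J with
  | zero =>
    rw [pow_zero]
    have e : smoothSymbol α 1 = fun ξ => Real.exp (-smoothPower α ξ) := by
      funext ξ; simp [smoothSymbol]
    refine ⟨continuous_smoothSymbol α 1, fun p => ?_⟩
    obtain ⟨C, hC0, hC⟩ := exists_iteratedFDeriv_exp_neg_smoothPower_le hα 0 (p + 3)
    refine ((integrable_one_add_norm (E := Plane) (μ := volume) (r := 3)
      (by rw [finrank_euclideanSpace]; norm_num)).const_mul C).mono' ?_
      (Eventually.of_forall fun v => ?_)
    · exact Continuous.aestronglyMeasurable ((continuous_norm.pow p).mul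
        (continuous_smoothSymbol α 1).norm)
    · rw [Real.norm_of_nonneg (by positivity)]
      have h0 : 0 < 1 + ‖v‖ := by positivity
      have h1 := hC v
      rw [norm_iteratedFDeriv_zero] at h1
      rw [e]
      calc _ ≤ (1 + ‖v‖) ^ p * (C * (1 + ‖v‖) ^ (-((p + 3 : ℕ):ℝ))) := by
            gcongr
            linarith
        _ = _ := by
            rw [← Real.rpow_natCast, mul_left_comm, ← Real.rpow_add h0]
            push_cast
            ring_nf
  | succ J ih =>
    have hc : (0:ℝ) < 2 ^ J := by positivity
    have e : smoothSymbol α (2 ^ (J + 1)) = fun ξ => smoothSymbol α (2 ^ J) ξ +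
        symbolIncrement α ((2 ^ J) ^ (-(2 * α))) ((2:ℝ) ^ J • ξ) := by
      funext ξ
      rw [pow_succ', smoothSymbol_two_mul hc]
    rw [e]
    refine ih.add (hasMoments_of_hasCompactSupport ?_ ?_)
    · have := (contDiff_symbolIncrement α ((2 ^ J) ^ (-(2 * α)))).continuous
      fun_prop
    · exact (hasCompactSupport_symbolIncrement _ _).comp_smul hc.ne'

theorem hasMoments_heatSymbol {α : ℝ} (hα : 1 / 2 < α) : HasMoments (heatSymbol α) := by
  have h := (hasMoments_smoothSymbol hα 0).add (hasMoments_of_hasCompactSupport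
    ((continuous_heatSymbol (by linarith)).sub (continuous_smoothSymbol α (2 ^ 0)))
    (hasCompactSupport_heatSymbol_sub (by norm_num)))
  simpa using h

/-- Telescoping from J = 0: the step from 2^j to 2^{j+1} costs C₁ρ^j with ρ = 2^{1-2α} < 1, so the
bound is uniform in J. The weight k+3 is what leaves the factor c^{1-2α} in each step. -/
theorem exists_fourierReal_smoothSymbol_le {α : ℝ} (hα : 1 / 2 < α) (k : ℕ) :
    ∃ C : ℝ, ∀ (J : ℕ) (w : Plane),
      ‖w‖ ^ (k + 3) * ‖iteratedFDeriv ℝ k (fourierReal (smoothSymbol α (2 ^ J))) w‖ ≤ C := by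
  obtain ⟨C₀, h₀⟩ := exists_fourierReal_smoothSymbol_one_le hα k (k + 3)
  obtain ⟨C₁, h₁0, h₁⟩ := exists_fourierReal_symbolIncrement_le (α := α) (by linarith) k (k + 3)
  set ρ : ℝ := 2 ^ (1 - 2 * α) with hρ
  have hρ0 : 0 < ρ := by positivity
  have hρ1 : ρ < 1 := Real.rpow_lt_one_of_one_lt_of_neg one_lt_two (by linarith)
  have key : ∀ (J : ℕ) (w : Plane),
      ‖w‖ ^ (k + 3) * ‖iteratedFDeriv ℝ k (fourierReal (smoothSymbol α (2 ^ J))) w‖ ≤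
        C₀ + C₁ * ∑ j ∈ Finset.range J, ρ ^ j := by
    intro J w
    induction J with
    | zero => simpa using h₀ w
    | succ J ih =>
      set c : ℝ := 2 ^ J with hc
      have hc0 : 0 < c := by positivity
      have hc1 : 1 ≤ c := one_le_pow₀ one_le_two
      have e : smoothSymbol α (2 ^ (J + 1)) = fun ξ => smoothSymbol α c ξ +
          symbolIncrement α (c ^ (-(2 * α))) (c • ξ) := by
        funext ξ
        rw [pow_succ', ← hc, smoothSymbol_two_mul hc0]
      have hm1 : HasMoments (symbolIncrement α (c ^ (-(2 * α)))) :=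
        hasMoments_of_hasCompactSupport (contDiff_symbolIncrement _ _).continuous
          (hasCompactSupport_symbolIncrement _ _)
      have hm2 : HasMoments fun ξ => symbolIncrement α (c ^ (-(2 * α))) (c • ξ) :=
        hasMoments_of_hasCompactSupport
          (by have := (contDiff_symbolIncrement α (c ^ (-(2 * α)))).continuous
              fun_prop)
          ((hasCompactSupport_symbolIncrement _ _).comp_smul hc0.ne')
      rw [e, iteratedFDeriv_fourierReal_add (hasMoments_smoothSymbol hα J) hm2]
      have hb := h₁ (c ^ (-(2 * α))) (by positivity)
        (Real.rpow_le_one_of_one_le_of_nonpos hc1 (by linarith)) (c⁻¹ • w)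
      have hn : ‖w‖ = c * ‖c⁻¹ • w‖ := by
        rw [norm_smul, norm_inv, Real.norm_of_nonneg hc0.le, mul_inv_cancel_left₀ hc0.ne']
      have hρJ : ρ ^ J = c * c ^ (-(2 * α)) := by
        rw [hρ, ← Real.rpow_natCast, ← Real.rpow_mul zero_le_two, mul_comm,
          Real.rpow_mul zero_le_two, Real.rpow_natCast, ← hc, sub_eq_add_neg, Real.rpow_add hc0,
          Real.rpow_one]
      have hinc : ‖w‖ ^ (k + 3) * ‖iteratedFDeriv ℝ k
          (fourierReal fun ξ => symbolIncrement α (c ^ (-(2 * α))) (c • ξ)) w‖ ≤ C₁ * ρ ^ J := by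
        rw [norm_iteratedFDeriv_fourierReal_comp_smul hm1 hc0]
        -- Writing |w| = c|c⁻¹w| produces c^{k+3}, and the rescaling of the Fourier transform
        -- divides by c^{k+2}, so one power of c survives.
        calc _ = c * (‖c⁻¹ • w‖ ^ (k + 3) * ‖iteratedFDeriv ℝ k
              (fourierReal (symbolIncrement α (c ^ (-(2 * α))))) (c⁻¹ • w)‖) := by
              rw [hn, mul_pow]
              field_simp
              ring
          _ ≤ c * (C₁ * c ^ (-(2 * α))) := by gcongr
          _ = _ := by rw [hρJ]; ring
      rw [Finset.sum_range_succ, mul_add, ← add_assoc]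
      calc _ ≤ ‖w‖ ^ (k + 3) * (‖iteratedFDeriv ℝ k (fourierReal (smoothSymbol α c)) w‖ +
            ‖iteratedFDeriv ℝ k
              (fourierReal fun ξ => symbolIncrement α (c ^ (-(2 * α))) (c • ξ)) w‖) := by
            gcongr; exact norm_add_le _ _
        _ ≤ _ := by rw [mul_add]; exact add_le_add ih hinc
  refine ⟨C₀ + C₁ * (1 - ρ)⁻¹, fun J w => (key J w).trans ?_⟩
  gcongr
  rw [← tsum_geometric_of_lt_one hρ0.le hρ1]
  exact (summable_geometric_of_lt_one hρ0.le hρ1).sum_le_tsum _ fun i _ => by positivity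

/-- The remainder `r J` is bounded by 1 and supported where 2^J|ξ| ≤ 1/4, so its moments vanish in
the limit, and with them all derivatives of its Fourier transform. The uniform bound for the
smoothed symbols passes to the limit at each `w`. -/
theorem exists_fourierReal_heatSymbol_le {α : ℝ} (hα : 1 / 2 < α) (k : ℕ) :
    ∃ C : ℝ, ∀ w : Plane,
      ‖w‖ ^ (k + 3) * ‖iteratedFDeriv ℝ k (fourierReal (heatSymbol α)) w‖ ≤ C := by
  obtain ⟨C, hC⟩ := exists_fourierReal_smoothSymbol_le hα k
  refine ⟨C, fun w => ?_⟩
  set r : ℕ → Plane → ℝ := fun J ξ => heatSymbol α ξ - smoothSymbol α (2 ^ J) ξ with hr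
  have hrc : ∀ J, Continuous (r J) := fun J =>
    (continuous_heatSymbol (by linarith)).sub (continuous_smoothSymbol α _)
  have hrm : ∀ J, HasMoments (r J) := fun J =>
    hasMoments_of_hasCompactSupport (hrc J) (hasCompactSupport_heatSymbol_sub (by positivity))
  have hr0 : ∀ J : ℕ, ∀ ξ : Plane, 1 / 4 ≤ 2 ^ J * ‖ξ‖ → r J ξ = 0 := by
    intro J ξ h
    have h2 : (0:ℝ) < 2 ^ J := by positivity
    simp only [hr]
    rw [smoothSymbol_eq h2, sub_self]
    rwa [norm_smul, Real.norm_of_nonneg h2.le]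
  -- This is the Fourier bound with no power of |w| (n = 0), the only one available for a function
  -- that is merely continuous.
  set ε : ℕ → ℝ := fun J => (2 * Real.pi) ^ k * (2 * k + 2) ^ 0 *
      ∑ p ∈ Finset.range (k + 1) ×ˢ Finset.range (0 + 1),
        ∫ v, ‖v‖ ^ p.1 * ‖iteratedFDeriv ℝ p.2 (r J) v‖ with hε
  have hε0 : Tendsto ε atTop (𝓝 0) := by
    have : Tendsto ε atTop (𝓝 ((2 * Real.pi) ^ k * (2 * k + 2) ^ 0 *
      ∑ p ∈ Finset.range (k + 1) ×ˢ Finset.range (0 + 1), ∫ v : Plane, (0:ℝ))) := by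
      refine Tendsto.const_mul _ (tendsto_finsetSum _ fun p hp => ?_)
      have hp2 : p.2 = 0 := by
        have := (Finset.mem_product.1 hp).2
        simpa using this
      rw [hp2]
      simp_rw [norm_iteratedFDeriv_zero]
      refine tendsto_integral_of_dominated_convergence
        ((Metric.closedBall (0:Plane) 1).indicator fun _ => (1:ℝ)) (fun J => ?_) ?_
        (fun J => Eventually.of_forall fun v => ?_) (Eventually.of_forall fun v => ?_)
      · exact ((continuous_norm.pow _).mul (hrc J).norm).aestronglyMeasurable
      · exact (integrableOn_const measure_closedBall_lt_top.ne).integrable_indicator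
          Metric.isClosed_closedBall.measurableSet
      · by_cases hv : ‖v‖ ≤ 1
        · rw [Set.indicator_of_mem (by simpa using hv), Real.norm_of_nonneg (by positivity)]
          exact mul_le_one₀ (pow_le_one₀ (norm_nonneg v) hv) (norm_nonneg _)
            (abs_heatSymbol_sub_smoothSymbol_le (by positivity) v)
        · rw [Set.indicator_of_notMem (by simpa using hv), hr0 J v]
          · simp
          · have : (1:ℝ) ≤ 2 ^ J := one_le_pow₀ one_le_two
            nlinarith [not_le.1 hv]
      · refine tendsto_const_nhds.congr' ?_
        rcases eq_or_ne v 0 with rfl | hv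
        · refine Eventually.of_forall fun J => ?_
          have : r J 0 = 0 := by
            have h0 : (2 * α) ≠ 0 := by linarith
            simp [hr, heatSymbol, smoothSymbol, smoothPower, Real.zero_rpow h0]
          simp [this]
        · have hv' : 0 < ‖v‖ := norm_pos_iff.2 hv
          have := (tendsto_pow_atTop_atTop_of_one_lt (one_lt_two (α := ℝ))).eventually_ge_atTop
            (1 / 4 / ‖v‖)
          filter_upwards [this] with J hJ
          rw [hr0 J v ((div_le_iff₀ hv').1 hJ)]
          simp
    simpa using this
  have hrb : ∀ J, ‖iteratedFDeriv ℝ k (fourierReal (r J)) w‖ ≤ ε J := by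
    intro J
    have := pow_mul_norm_iteratedFDeriv_fourierReal_le (N := 0) (h := r J)
      (contDiff_zero.2 (hrc J)) (fun p q hq => by
        have hq : q = 0 := by exact_mod_cast nonpos_iff_eq_zero.1 hq
        subst hq
        simpa using (hrm J).2 p) k 0 le_rfl w
    rwa [pow_zero, one_mul] at this
  have hlim : Tendsto (fun J => C + ‖w‖ ^ (k + 3) * ε J) atTop (𝓝 (C + ‖w‖ ^ (k + 3) * 0)) :=
    tendsto_const_nhds.add (hε0.const_mul _)
  rw [mul_zero, add_zero] at hlim
  refine ge_of_tendsto' hlim fun J => ?_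
  have e : heatSymbol α = fun ξ => smoothSymbol α (2 ^ J) ξ + r J ξ := by
    funext ξ; simp [hr]
  rw [e, iteratedFDeriv_fourierReal_add (hasMoments_smoothSymbol hα J) (hrm J)]
  calc _ ≤ ‖w‖ ^ (k + 3) * (‖iteratedFDeriv ℝ k (fourierReal (smoothSymbol α (2 ^ J))) w‖ +
        ‖iteratedFDeriv ℝ k (fourierReal (r J)) w‖) := by
        gcongr; exact norm_add_le _ _
    _ ≤ _ := by
      rw [mul_add]
      gcongr
      · exact hC J w
      · exact hrb J

/-- The Fourier transform here has phase e^{-2πi⟨ξ,w⟩}, which becomes e^{i x·ξ} at w = -x/(2π). -/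
theorem heatKernel_eq (α : ℝ) : heatKernel α = fun x =>
    (4 * Real.pi ^ 2)⁻¹ * (fourierReal (heatSymbol α) (-(2 * Real.pi)⁻¹ • x)).re := by
  funext x
  have e : fourierReal (heatSymbol α) (-(2 * Real.pi)⁻¹ • x) =
      ∫ ξ : Plane, Complex.exp (Complex.I * (inner ℝ x ξ : ℝ)) *
        (Real.exp (-‖ξ‖ ^ (2 * α)) : ℂ) := by
    simp only [fourierReal, Real.fourier_eq', heatSymbol]
    congr 1
    funext ξ
    rw [smul_eq_mul, neg_smul, inner_neg_right, real_inner_smul_right, real_inner_comm]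
    congr 2
    rw [mul_comm]
    congr 2
    have := Real.pi_pos
    field_simp
  rw [heatKernel, heatKernelC, ← e]
  have : ((4 * (Real.pi : ℂ) ^ 2)⁻¹) = (((4 * Real.pi ^ 2)⁻¹ : ℝ) : ℂ) := by push_cast; rfl
  rw [this, Complex.re_ofReal_mul]

theorem contDiff_heatKernel {α : ℝ} (hα : 1 / 2 < α) : ContDiff ℝ ∞ (heatKernel α) := by
  rw [heatKernel_eq]
  have h := (hasMoments_heatSymbol hα).contDiff_fourierReal
  have h2 : ContDiff ℝ ∞ fun x : Plane =>
      Complex.reCLM (fourierReal (heatSymbol α) (-(2 * Real.pi)⁻¹ • x)) := by fun_prop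
  exact contDiff_const.mul h2

theorem exists_iteratedFDeriv_heatKernel_le {α : ℝ} (hα : 1 / 2 < α) (k : ℕ) :
    ∃ C : ℝ, 0 ≤ C ∧ ∀ x : Plane,
      ‖iteratedFDeriv ℝ k (heatKernel α) x‖ ≤ C * (1 + ‖x‖) ^ (-((k:ℝ) + 3)) := by
  obtain ⟨C, hC⟩ := exists_fourierReal_heatSymbol_le hα k
  have hF := (hasMoments_heatSymbol hα).contDiff_fourierReal
  set F := fourierReal (heatSymbol α) with hFdef
  obtain ⟨B, hB⟩ := (isCompact_closedBall (0 : Plane) 1).exists_bound_of_continuousOn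
    (hF.continuous_iteratedFDeriv (m := k) (by exact_mod_cast le_top)).continuousOn
  have hsum : ∀ w : Plane, (1 + ‖w‖) ^ (k + 3) * ‖iteratedFDeriv ℝ k F w‖ ≤
      2 ^ (k + 3) * (|B| + |C|) := by
    intro w
    rcases le_or_gt ‖w‖ 1 with hw | hw
    · gcongr
      · linarith
      · exact ((hB w (by simpa using hw)).trans (le_abs_self B)).trans
          (by linarith [abs_nonneg C])
    · calc _ ≤ (2 * ‖w‖) ^ (k + 3) * ‖iteratedFDeriv ℝ k F w‖ := by gcongr; linarith
        _ = 2 ^ (k + 3) * (‖w‖ ^ (k + 3) * ‖iteratedFDeriv ℝ k F w‖) := by rw [mul_pow]; ring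
        _ ≤ _ := by
          gcongr
          exact ((hC w).trans (le_abs_self C)).trans (by linarith [abs_nonneg B])
  set c : ℝ := -(2 * Real.pi)⁻¹ with hc
  have hpi := Real.pi_gt_three
  have hc0 : c ≠ 0 := neg_ne_zero.2 (by positivity)
  have hca : |c| ≤ 1 := by
    rw [hc, abs_neg, abs_of_pos (by positivity)]
    exact inv_le_one_of_one_le₀ (by linarith)
  have hcp : 0 < |c| := abs_pos.2 hc0
  set Lr : ℂ →L[ℝ] ℝ := (4 * Real.pi ^ 2)⁻¹ • Complex.reCLM with hLr
  have e : heatKernel α = Lr ∘ fun x => F (c • x) := by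
    rw [heatKernel_eq]; rfl
  have hFc : ContDiff ℝ ∞ fun x : Plane => F (c • x) := by fun_prop
  refine ⟨‖Lr‖ * (2 ^ (k + 3) * (|B| + |C|) * (|c| ^ (k + 3))⁻¹), by positivity, fun x => ?_⟩
  rw [e]
  refine (ContinuousLinearMap.norm_iteratedFDeriv_comp_left Lr (hFc.contDiffAt (x := x))
    (n := k) (by exact_mod_cast le_top)).trans ?_
  rw [norm_iteratedFDeriv_comp_smul hc0, mul_assoc ‖Lr‖]
  have hx0 : 0 < 1 + ‖x‖ := by positivity
  have h1 : |c| * (1 + ‖x‖) ≤ 1 + ‖c • x‖ := by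
    rw [norm_smul, Real.norm_eq_abs]; linarith
  have h2 : (1 + ‖x‖) ^ (-((k:ℝ) + 3)) = ((1 + ‖x‖) ^ (k + 3))⁻¹ := by
    rw [Real.rpow_neg hx0.le, ← Real.rpow_natCast]; push_cast; rfl
  rw [h2]
  refine mul_le_mul_of_nonneg_left ?_ (norm_nonneg _)
  have h3 := hsum (c • x)
  have h4 : (|c| * (1 + ‖x‖)) ^ (k + 3) ≤ (1 + ‖c • x‖) ^ (k + 3) := by gcongr
  calc |c| ^ k * ‖iteratedFDeriv ℝ k F (c • x)‖ ≤ 1 * ‖iteratedFDeriv ℝ k F (c • x)‖ := by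
        gcongr; exact pow_le_one₀ hcp.le hca
    _ ≤ 2 ^ (k + 3) * (|B| + |C|) * (|c| ^ (k + 3))⁻¹ * ((1 + ‖x‖) ^ (k + 3))⁻¹ := by
        rw [mul_assoc _ (|c| ^ (k + 3))⁻¹, ← mul_inv, ← mul_pow, ← div_eq_mul_inv, one_mul,
          le_div_iff₀ (by positivity), mul_comm]
        exact (mul_le_mul_of_nonneg_right h4 (norm_nonneg _)).trans h3

end KernelDecay

/-! ### Calculus of fields on the circle as functions of direction. -/

section Circle

theorem circlePoint_apply_zero (θ : ℝ) : (circlePoint θ : Plane) 0 = Real.cos θ := rfl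

theorem circlePoint_apply_one (θ : ℝ) : (circlePoint θ : Plane) 1 = Real.sin θ := rfl

theorem norm_sq_eq_coord (x : Plane) : ‖x‖ ^ 2 = x 0 ^ 2 + x 1 ^ 2 := by
  rw [EuclideanSpace.norm_eq, Real.sq_sqrt (by positivity)]
  simp [Fin.sum_univ_two]

theorem circlePoint_eq_iff {θ θ' : ℝ} :
    circlePoint θ = circlePoint θ' ↔ Real.cos θ = Real.cos θ' ∧ Real.sin θ = Real.sin θ' := by
  constructor
  · intro h
    exact ⟨by rw [← circlePoint_apply_zero, h, circlePoint_apply_zero],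
      by rw [← circlePoint_apply_one, h, circlePoint_apply_one]⟩
  · rintro ⟨h0, h1⟩
    ext i
    fin_cases i
    · exact h0
    · exact h1

theorem circlePoint_surjective : Function.Surjective circlePoint := by
  rintro ⟨p, hp⟩
  have h1 : p 0 ^ 2 + p 1 ^ 2 = 1 := by
    rw [← norm_sq_eq_coord, mem_sphere_zero_iff_norm.1 hp, one_pow]
  set z : ℂ := ⟨p 0, p 1⟩ with hz
  have hn : ‖z‖ = 1 := by
    rw [← sq_eq_sq₀ (norm_nonneg z) zero_le_one, Complex.sq_norm, Complex.normSq_apply]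
    linarith
  have hz0 : z ≠ 0 := fun h => by simp [h] at hn
  refine ⟨z.arg, ?_⟩
  ext i
  fin_cases i
  · change Real.cos z.arg = p 0
    rw [Complex.cos_arg hz0, hn, div_one]
  · change Real.sin z.arg = p 1
    rw [Complex.sin_arg, hn, div_one]

/-- The direction `x/|x|` of a point of the plane. -/
def direction (x : Plane) : UnitCircle :=
  if h : x = 0 then circlePoint 0
  else ⟨‖x‖⁻¹ • x, by
    have hx : ‖x‖ ≠ 0 := norm_ne_zero_iff.mpr h
    simp [norm_smul, hx]⟩

theorem coe_direction {x : Plane} (hx : x ≠ 0) : (direction x : Plane) = ‖x‖⁻¹ • x := by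
  simp [direction, hx]

theorem homogeneousField_eq (α : ℝ) (v : UnitCircle → Plane) {x : Plane} (hx : x ≠ 0) :
    homogeneousField α v x = ‖x‖ ^ (1 - 2 * α) • v (direction x) := by
  simp [homogeneousField, direction, hx]

theorem direction_smul {t : ℝ} (ht : 0 < t) (x : Plane) : direction (t • x) = direction x := by
  by_cases hx : x = 0
  · simp [hx]
  · apply Subtype.ext
    rw [coe_direction hx, coe_direction (smul_ne_zero ht.ne' hx), norm_smul,
      Real.norm_of_nonneg ht.le, smul_smul]
    congr 1
    field_simp

/-- The component of `x` along `circlePoint θ`. -/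
def radialCoord (θ : ℝ) (x : Plane) : ℝ := Real.cos θ * x 0 + Real.sin θ * x 1

/-- The component of `x` orthogonal to `circlePoint θ`. -/
def tangentCoord (θ : ℝ) (x : Plane) : ℝ := -Real.sin θ * x 0 + Real.cos θ * x 1

theorem radialCoord_sq_add_tangentCoord_sq (θ : ℝ) (x : Plane) :
    radialCoord θ x ^ 2 + tangentCoord θ x ^ 2 = ‖x‖ ^ 2 := by
  rw [norm_sq_eq_coord, radialCoord, tangentCoord]
  linear_combination (x 0 ^ 2 + x 1 ^ 2) * Real.sin_sq_add_cos_sq θ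

/-- In the frame rotated by θ, the point has coordinates (A, B) with A > 0, so its polar angle is
arctan(B/A). This gives a smooth angular chart on each open half-plane, with no branch cut of the
argument to avoid. -/
theorem direction_eq_circlePoint {θ : ℝ} {x : Plane} (h : 0 < radialCoord θ x) :
    direction x = circlePoint (θ + Real.arctan (tangentCoord θ x / radialCoord θ x)) := by
  set A := radialCoord θ x with hA
  set B := tangentCoord θ x with hB
  have hAB : A ^ 2 + B ^ 2 = ‖x‖ ^ 2 := radialCoord_sq_add_tangentCoord_sq θ x
  have hx : x ≠ 0 := by
    rintro rfl
    simp [radialCoord, hA] at h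
  have hn : 0 < ‖x‖ := norm_pos_iff.2 hx
  have hs : √(1 + (B / A) ^ 2) = ‖x‖ / A := by
    rw [Real.sqrt_eq_iff_mul_self_eq (by positivity) (by positivity)]
    field_simp
    linarith
  have hc : Real.cos (Real.arctan (B / A)) = A / ‖x‖ := by
    rw [Real.cos_arctan, hs, one_div_div]
  have hsn : Real.sin (Real.arctan (B / A)) = B / ‖x‖ := by
    rw [Real.sin_arctan, hs]; field_simp
  have e0 : A * Real.cos θ - B * Real.sin θ = x 0 := by
    rw [hA, hB, radialCoord, tangentCoord]
    linear_combination x 0 * Real.sin_sq_add_cos_sq θ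
  have e1 : A * Real.sin θ + B * Real.cos θ = x 1 := by
    rw [hA, hB, radialCoord, tangentCoord]
    linear_combination x 1 * Real.sin_sq_add_cos_sq θ
  apply Subtype.ext
  rw [coe_direction hx]
  ext i
  fin_cases i
  · change ‖x‖⁻¹ * x 0 = Real.cos _
    rw [Real.cos_add, hc, hsn, ← e0]
    field_simp
  · change ‖x‖⁻¹ * x 1 = Real.sin _
    rw [Real.sin_add, hc, hsn, ← e1]
    field_simp

theorem coord_of_direction_eq {θ : ℝ} {x : Plane} (hx : x ≠ 0) (h : direction x = circlePoint θ) :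
    x 0 = ‖x‖ * Real.cos θ ∧ x 1 = ‖x‖ * Real.sin θ := by
  have hn : ‖x‖ ≠ 0 := norm_ne_zero_iff.2 hx
  have h2 : x = ‖x‖ • (circlePoint θ : Plane) := by
    rw [← h, coe_direction hx, smul_smul, mul_inv_cancel₀ hn, one_smul]
  constructor
  · exact congrArg (fun y : Plane => y 0) h2
  · exact congrArg (fun y : Plane => y 1) h2

theorem radialCoord_of_direction_eq {θ : ℝ} {x : Plane} (hx : x ≠ 0)
    (h : direction x = circlePoint θ) : radialCoord θ x = ‖x‖ := by
  obtain ⟨h0, h1⟩ := coord_of_direction_eq hx h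
  rw [radialCoord, h0, h1]
  linear_combination ‖x‖ * Real.sin_sq_add_cos_sq θ

theorem tangentCoord_of_direction_eq {θ : ℝ} {x : Plane} (hx : x ≠ 0)
    (h : direction x = circlePoint θ) : tangentCoord θ x = 0 := by
  obtain ⟨h0, h1⟩ := coord_of_direction_eq hx h
  rw [tangentCoord, h0, h1]
  ring

/-- The angular one-form `dθ`. -/
def angularForm (x : Plane) : Plane →L[ℝ] ℝ :=
  (‖x‖ ^ 2)⁻¹ • (x 0 • (EuclideanSpace.proj 1 : Plane →L[ℝ] ℝ) -
    x 1 • (EuclideanSpace.proj 0 : Plane →L[ℝ] ℝ))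

theorem contDiffAt_angularForm {x : Plane} (hx : x ≠ 0) : ContDiffAt ℝ ∞ angularForm x := by
  have h : ‖x‖ ^ 2 ≠ 0 := pow_ne_zero 2 (norm_ne_zero_iff.2 hx)
  unfold angularForm
  refine ContDiffAt.smul (ContDiffAt.inv (contDiff_norm_sq ℝ).contDiffAt h) ?_
  fun_prop

/-- The chart is centred at the direction of `x` itself. There the tangential coordinate vanishes
and the radial one is |x|, so the derivative of arctan(B/A) reduces to dB/|x|, which is dθ. -/
theorem hasFDerivAt_comp_direction {v : UnitCircle → Plane} (hv : Differentiable ℝ (angular v))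
    {v' : UnitCircle → Plane} (hv' : ∀ θ, deriv (angular v) θ = v' (circlePoint θ)) {x : Plane}
    (hx : x ≠ 0) :
    HasFDerivAt (fun y => v (direction y)) ((angularForm x).smulRight (v' (direction x))) x := by
  obtain ⟨θ, hθ⟩ := circlePoint_surjective (direction x)
  have hn : 0 < ‖x‖ := norm_pos_iff.2 hx
  have hr := radialCoord_of_direction_eq hx hθ.symm
  have ht := tangentCoord_of_direction_eq hx hθ.symm
  obtain ⟨h0, h1⟩ := coord_of_direction_eq hx hθ.symm
  have dA : HasFDerivAt (radialCoord θ) (Real.cos θ • (EuclideanSpace.proj 0 : Plane →L[ℝ] ℝ) +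
      Real.sin θ • (EuclideanSpace.proj 1 : Plane →L[ℝ] ℝ)) x :=
    (Real.cos θ • (EuclideanSpace.proj 0 : Plane →L[ℝ] ℝ) +
      Real.sin θ • (EuclideanSpace.proj 1 : Plane →L[ℝ] ℝ)).hasFDerivAt
  have dB : HasFDerivAt (tangentCoord θ) (-Real.sin θ • (EuclideanSpace.proj 0 : Plane →L[ℝ] ℝ) +
      Real.cos θ • (EuclideanSpace.proj 1 : Plane →L[ℝ] ℝ)) x :=
    (-Real.sin θ • (EuclideanSpace.proj 0 : Plane →L[ℝ] ℝ) +
      Real.cos θ • (EuclideanSpace.proj 1 : Plane →L[ℝ] ℝ)).hasFDerivAt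
  have hev : (fun y => v (direction y)) =ᶠ[𝓝 x] fun y =>
      angular v (θ + Real.arctan (tangentCoord θ y / radialCoord θ y)) := by
    have : ∀ᶠ y in 𝓝 x, 0 < radialCoord θ y :=
      dA.continuousAt.eventually (lt_mem_nhds (by rw [hr]; exact hn))
    filter_upwards [this] with y hy
    rw [direction_eq_circlePoint hy]
    rfl
  refine HasFDerivAt.congr_of_eventuallyEq ?_ hev
  have dq := dB.mul ((hasDerivAt_inv (x := radialCoord θ x) (by rw [hr]; exact hn.ne')).hasFDerivAt.comp x dA)
  have darc := (dq.arctan).const_add θ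
  have hval : θ + Real.arctan (tangentCoord θ x / radialCoord θ x) = θ := by
    rw [ht, zero_div, Real.arctan_zero, add_zero]
  have dv : HasDerivAt (angular v) (v' (direction x))
      (θ + Real.arctan (tangentCoord θ x / radialCoord θ x)) := by
    rw [hval, ← hθ, ← hv' θ]
    exact (hv θ).hasDerivAt
  have := dv.hasFDerivAt.comp x darc
  refine this.congr_fderiv ?_
  ext h : 1
  simp only [ContinuousLinearMap.comp_apply, ContinuousLinearMap.smulRight_apply, angularForm,
    smul_apply, sub_apply, add_apply, Function.comp_apply, Pi.mul_apply,
    ContinuousLinearMap.toSpanSingleton_apply, EuclideanSpace.coe_proj, smul_eq_mul]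
  congr 1
  rw [ht, hr, h0, h1]
  field_simp
  ring

/-- The derivative of a field on the circle with respect to the angle. -/
def angularDeriv (v : UnitCircle → Plane) (p : UnitCircle) : Plane :=
  deriv (angular v) (Function.surjInv circlePoint_surjective p)

/-- `angularDeriv` picks an arbitrary angle over each point. The choice is harmless: `angular v` is
invariant under translation by the difference of two angles over the same point, and so is its
derivative. -/
theorem angular_angularDeriv (v : UnitCircle → Plane) :
    angular (angularDeriv v) = deriv (angular v) := by
  funext θ
  set θ' := Function.surjInv circlePoint_surjective (circlePoint θ) with hθ'
  have h : circlePoint θ' = circlePoint θ := Function.surjInv_eq circlePoint_surjective _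
  obtain ⟨hc, hs⟩ := circlePoint_eq_iff.1 h
  have hcd : Real.cos (θ' - θ) = 1 := by
    rw [Real.cos_sub, hc, hs]; linarith [Real.sin_sq_add_cos_sq θ]
  have hsd : Real.sin (θ' - θ) = 0 := by rw [Real.sin_sub, hc, hs]; ring
  have hper : (fun t => angular v (t + (θ' - θ))) = angular v := by
    funext t
    unfold angular
    congr 1
    rw [circlePoint_eq_iff, Real.cos_add, Real.sin_add, hcd, hsd]
    constructor <;> ring
  change deriv (angular v) θ' = deriv (angular v) θ
  have := deriv_comp_add_const (f := angular v) (θ' - θ) θ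
  rw [hper] at this
  rw [this]
  congr 1
  ring

theorem HolderBound.norm_iteratedDeriv_le {m : ℕ} {β : ℝ} {M : ℝ≥0} {v : UnitCircle → Plane}
    (h : HolderBound m β M v) {j : ℕ} (hj : j ≤ m) (θ : ℝ) :
    ‖iteratedDeriv j (angular v) θ‖ ≤ M := by
  have h1 : ‖iteratedDeriv j (angular v) θ‖ₑ ≤ M := by
    refine le_trans ?_ (le_self_add.trans h.2)
    refine le_trans (le_iSup (fun θ : ℝ => ‖iteratedDeriv j (angular v) θ‖ₑ) θ) ?_
    exact Finset.single_le_sum (f := fun j => ⨆ θ : ℝ, ‖iteratedDeriv j (angular v) θ‖ₑ)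
      (fun _ _ => zero_le) (Finset.mem_range.2 (Nat.lt_succ_of_le hj))
  rw [← ofReal_norm] at h1
  have := ENNReal.toReal_mono ENNReal.coe_ne_top h1
  rwa [ENNReal.toReal_ofReal (norm_nonneg _), ENNReal.coe_toReal] at this

theorem HolderBound.norm_le {m : ℕ} {β : ℝ} {M : ℝ≥0} {v : UnitCircle → Plane}
    (h : HolderBound m β M v) (p : UnitCircle) : ‖v p‖ ≤ M := by
  obtain ⟨θ, rfl⟩ := circlePoint_surjective p
  have h0 := h.norm_iteratedDeriv_le (Nat.zero_le m) θ
  rw [iteratedDeriv_zero] at h0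
  exact h0

theorem HolderBound.holder {m : ℕ} {β : ℝ} (hβ : 0 ≤ β) {M : ℝ≥0} {v : UnitCircle → Plane}
    (h : HolderBound m β M v) (θ θ' : ℝ) :
    ‖iteratedDeriv m (angular v) θ - iteratedDeriv m (angular v) θ'‖ ≤ M * |θ - θ'| ^ β := by
  have h1 : eHolderNorm β.toNNReal (iteratedDeriv m (angular v)) ≤ M :=
    le_trans le_add_self h.2
  have h2 : MemHolder β.toNNReal (iteratedDeriv m (angular v)) :=
    eHolderNorm_lt_top.1 (h1.trans_lt ENNReal.coe_lt_top)
  have h3 := h2.holderWith.dist_le θ θ'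
  rw [← h2.coe_nnHolderNorm_eq_eHolderNorm, ENNReal.coe_le_coe] at h1
  rw [dist_eq_norm, Real.dist_eq, Real.coe_toNNReal _ hβ] at h3
  refine h3.trans ?_
  gcongr

theorem HolderBound.angularDeriv {m : ℕ} {β : ℝ} {M : ℝ≥0} {v : UnitCircle → Plane}
    (h : HolderBound (m + 1) β M v) : HolderBound m β M (angularDeriv v) := by
  have hc : ContDiff ℝ m (deriv (angular v)) := by
    have := h.1
    push_cast at this
    exact (contDiff_succ_iff_deriv.1 this).2.2
  refine ⟨by rw [angular_angularDeriv]; exact hc, le_trans ?_ h.2⟩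
  unfold circleHolderNorm
  simp only [angular_angularDeriv, ← iteratedDeriv_succ']
  gcongr
  rw [Finset.sum_range_succ' _ (m + 1)]
  exact le_self_add

theorem HolderBound.differentiable {m : ℕ} {β : ℝ} {M : ℝ≥0} {v : UnitCircle → Plane}
    (h : HolderBound (m + 1) β M v) : Differentiable ℝ (angular v) :=
  h.1.differentiable (by simp)

/-- The constant 3 is 1 for the sup norms plus 2 for the Hölder seminorm. The derivative of order k
is M-Lipschitz, because the next one is bounded by M, and its oscillation is at most 2M; Lipschitz
is used at distance at most 1, oscillation beyond. -/
theorem HolderBound.of_lt {m k : ℕ} (hk : k < m) {β : ℝ} (hβ : 0 < β) (hβ' : β ≤ 1) {M : ℝ≥0}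
    {v : UnitCircle → Plane} (h : HolderBound m β M v) : HolderBound k β (3 * M) v := by
  refine ⟨h.1.of_le (by exact_mod_cast hk.le), ?_⟩
  have h1 : ∑ j ∈ Finset.range (k + 1), ⨆ θ : ℝ, ‖iteratedDeriv j (angular v) θ‖ₑ ≤ M := by
    refine le_trans (Finset.sum_le_sum_of_subset ?_) (le_self_add.trans h.2)
    exact Finset.range_mono (by omega)
  have hdiff : Differentiable ℝ (iteratedDeriv k (angular v)) :=
    h.1.differentiable_iteratedDeriv k (by exact_mod_cast hk)
  have hlip : ∀ a b, ‖iteratedDeriv k (angular v) a - iteratedDeriv k (angular v) b‖ ≤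
      M * |a - b| := by
    intro a b
    have := Convex.norm_image_sub_le_of_norm_deriv_le (𝕜 := ℝ)
      (f := iteratedDeriv k (angular v)) (s := Set.univ) (C := M) (x := b) (y := a)
      (fun x _ => hdiff x) (fun x _ => by
        rw [← iteratedDeriv_succ]; exact h.norm_iteratedDeriv_le hk x) convex_univ
      (Set.mem_univ _) (Set.mem_univ _)
    rwa [Real.norm_eq_abs] at this
  have h2 : HolderWith (2 * M) β.toNNReal (iteratedDeriv k (angular v)) := by
    intro a b
    have key : dist (iteratedDeriv k (angular v) a) (iteratedDeriv k (angular v) b) ≤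
        2 * M * dist a b ^ β := by
      rw [dist_eq_norm, Real.dist_eq]
      rcases le_or_gt |a - b| 1 with hab | hab
      · have : |a - b| ≤ |a - b| ^ β := by
          rcases eq_or_lt_of_le (abs_nonneg (a - b)) with h0 | h0
          · rw [← h0, Real.zero_rpow hβ.ne']
          · calc |a - b| = |a - b| ^ (1:ℝ) := (Real.rpow_one _).symm
              _ ≤ _ := Real.rpow_le_rpow_of_exponent_ge h0 hab hβ'
        calc _ ≤ (M:ℝ) * |a - b| := hlip a b
          _ ≤ 2 * M * |a - b| ^ β := by
            have : (M:ℝ) ≤ 2 * M := by linarith [M.2]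
            gcongr
      · have : (1:ℝ) ≤ |a - b| ^ β := Real.one_le_rpow hab.le hβ.le
        have h3 := h.norm_iteratedDeriv_le hk.le a
        have h4 := h.norm_iteratedDeriv_le hk.le b
        calc _ ≤ ‖iteratedDeriv k (angular v) a‖ + ‖iteratedDeriv k (angular v) b‖ :=
              norm_sub_le _ _
          _ ≤ 2 * M * 1 := by linarith
          _ ≤ _ := by gcongr
    rw [edist_dist, edist_dist, Real.coe_toNNReal _ hβ.le]
    rw [ENNReal.ofReal_rpow_of_nonneg dist_nonneg hβ.le]
    refine (ENNReal.ofReal_le_ofReal key).trans_eq ?_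
    rw [ENNReal.ofReal_mul (by positivity), ENNReal.ofReal_mul (by positivity)]
    simp
  unfold circleHolderNorm
  calc _ ≤ (M : ℝ≥0∞) + (2 * M : ℝ≥0) := add_le_add h1 h2.eHolderNorm_le
    _ = _ := by push_cast; ring

/-- Hölder continuity of a field on the circle, as a function of a point of the plane. -/
theorem HolderBound.norm_sub_direction_le {β : ℝ} (hβ : 0 < β) (hβ' : β ≤ 1) {M : ℝ≥0}
    {v : UnitCircle → Plane} (h : HolderBound 0 β M v) {x y : Plane} (hx : 1 / 8 ≤ ‖x‖) :
    ‖v (direction x) - v (direction y)‖ ≤ 32 * M * ‖x - y‖ ^ β := by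
  have h16 : (16:ℝ) ^ β ≤ 16 := by
    calc (16:ℝ) ^ β ≤ 16 ^ (1:ℝ) := Real.rpow_le_rpow_of_exponent_le (by norm_num) hβ'
      _ = 16 := Real.rpow_one _
  have hx0 : x ≠ 0 := norm_pos_iff.1 (by linarith)
  have hd0 : 0 ≤ ‖x - y‖ ^ β := by positivity
  -- For y close to x, the radial coordinate of y is at least |x|/2 ≥ 1/16, so the angle changes by
  -- at most 16|x-y|. Otherwise |x-y| > 1/16, and the bound 2M on the difference is already enough.
  rcases le_or_gt ‖x - y‖ (‖x‖ / 2) with hd | hd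
  · obtain ⟨θ, hθ⟩ := circlePoint_surjective (direction x)
    have hr := radialCoord_of_direction_eq hx0 hθ.symm
    have ht := tangentCoord_of_direction_eq hx0 hθ.symm
    have hsq := radialCoord_sq_add_tangentCoord_sq θ (x - y)
    have hA' : radialCoord θ (x - y) = ‖x‖ - radialCoord θ y := by
      rw [← hr]; simp only [radialCoord, PiLp.sub_apply]; ring
    have hB' : tangentCoord θ (x - y) = - tangentCoord θ y := by
      rw [← zero_sub, ← ht]; simp only [tangentCoord, PiLp.sub_apply]; ring
    have hA2 : |radialCoord θ (x - y)| ≤ ‖x - y‖ :=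
      abs_le_of_sq_le_sq (by nlinarith [sq_nonneg (tangentCoord θ (x - y))]) (norm_nonneg _)
    have hB2 : |tangentCoord θ (x - y)| ≤ ‖x - y‖ :=
      abs_le_of_sq_le_sq (by nlinarith [sq_nonneg (radialCoord θ (x - y))]) (norm_nonneg _)
    rw [hB', abs_neg] at hB2
    rw [hA'] at hA2
    have hA3 : ‖x‖ / 2 ≤ radialCoord θ y := by linarith [(abs_le.1 hA2).2]
    have hA4 : 0 < radialCoord θ y := by linarith
    rw [direction_eq_circlePoint hA4, ← hθ]
    have := h.holder hβ.le θ (θ + Real.arctan (tangentCoord θ y / radialCoord θ y))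
    simp only [iteratedDeriv_zero] at this
    refine (this : ‖v _ - v _‖ ≤ _).trans ?_
    have hdelta : |θ - (θ + Real.arctan (tangentCoord θ y / radialCoord θ y))| ≤ 16 * ‖x - y‖ := by
      rw [sub_add_cancel_left, abs_neg]
      have h2 : |tangentCoord θ y / radialCoord θ y| ≤ 16 * ‖x - y‖ := by
        rw [abs_div, abs_of_pos hA4, div_le_iff₀ hA4]
        nlinarith [norm_nonneg (x - y)]
      have h3 : |Real.arctan (tangentCoord θ y / radialCoord θ y)| ≤
          |tangentCoord θ y / radialCoord θ y| := by
        have hl : LipschitzWith 1 Real.arctan :=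
          lipschitzWith_of_nnnorm_deriv_le Real.differentiable_arctan fun t => by
            rw [Real.deriv_arctan, ← NNReal.coe_le_coe, coe_nnnorm, NNReal.coe_one,
              Real.norm_of_nonneg (by positivity)]
            exact (div_le_one (by positivity)).2 (by nlinarith [sq_nonneg t])
        have := hl.dist_le_mul (tangentCoord θ y / radialCoord θ y) 0
        simpa [abs_div] using this
      exact h3.trans h2
    calc _ ≤ (M:ℝ) * (16 * ‖x - y‖) ^ β := by gcongr
      _ = M * (16 ^ β * ‖x - y‖ ^ β) := by rw [Real.mul_rpow (by norm_num) (norm_nonneg _)]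
      _ ≤ M * (32 * ‖x - y‖ ^ β) := by gcongr; linarith
      _ = _ := by ring
  · have h1 : 1 ≤ (16 * ‖x - y‖) ^ β := Real.one_le_rpow (by linarith) hβ.le
    rw [Real.mul_rpow (by norm_num) (norm_nonneg _)] at h1
    calc _ ≤ ‖v (direction x)‖ + ‖v (direction y)‖ := norm_sub_le _ _
      _ ≤ 2 * M * 1 := by linarith [h.norm_le (direction x), h.norm_le (direction y)]
      _ ≤ 2 * M * (16 ^ β * ‖x - y‖ ^ β) := by gcongr
      _ ≤ 2 * M * (16 * ‖x - y‖ ^ β) := by gcongr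
      _ = _ := by ring

end Circle

/-! ### Hölder regularity of a direction field localized away from the origin. -/

section LocalizedField

theorem le_rpow_of_bounded {β d L B : ℝ} (hβ : 0 < β) (hβ' : β ≤ 1) (hd : 0 ≤ d)
    (hL : 0 ≤ L) (hB : 0 ≤ B) {a : ℝ} (h1 : a ≤ L * d) (h2 : a ≤ B) : a ≤ (L + B) * d ^ β := by
  rcases le_or_gt d 1 with h | h
  · have : d ≤ d ^ β := by
      rcases eq_or_lt_of_le hd with h0 | h0
      · rw [← h0, Real.zero_rpow hβ.ne']
      · calc d = d ^ (1:ℝ) := (Real.rpow_one _).symm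
          _ ≤ _ := Real.rpow_le_rpow_of_exponent_ge h0 h hβ'
    calc a ≤ L * d := h1
      _ ≤ (L + B) * d ^ β := by gcongr; linarith
  · have : (1:ℝ) ≤ d ^ β := Real.one_le_rpow h.le hβ.le
    calc a ≤ B * 1 := by linarith
      _ ≤ (L + B) * d ^ β := by gcongr; linarith

/-- Such a function is both bounded and Lipschitz, and these interpolate to β-Hölder at every scale.
-/
theorem exists_holder_of_contDiff_hasCompactSupport {G : Type*} [NormedAddCommGroup G]
    [NormedSpace ℝ G] {φ : Plane → G} (hφ : ContDiff ℝ ∞ φ) (hs : HasCompactSupport φ) {β : ℝ}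
    (hβ : 0 < β) (hβ' : β ≤ 1) :
    ∃ C : ℝ, 0 ≤ C ∧ (∀ x, ‖φ x‖ ≤ C) ∧ ∀ x y, ‖φ x - φ y‖ ≤ C * ‖x - y‖ ^ β := by
  obtain ⟨B, hB⟩ := hs.exists_bound_of_continuous hφ.continuous
  obtain ⟨L, hL⟩ := hs.fderiv (𝕜 := ℝ) |>.exists_bound_of_continuous
    (hφ.continuous_fderiv (by simp))
  have hB0 : 0 ≤ B := (norm_nonneg _).trans (hB 0)
  have hL0 : 0 ≤ L := (norm_nonneg _).trans (hL 0)
  refine ⟨L + 2 * B, by positivity, fun x => (hB x).trans (by linarith), fun x y => ?_⟩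
  refine le_rpow_of_bounded hβ hβ' (norm_nonneg _) hL0 (by positivity) ?_ ?_
  · exact Convex.norm_image_sub_le_of_norm_fderiv_le (𝕜 := ℝ) (s := Set.univ)
      (fun z _ => hφ.differentiable (by simp) z) (fun z _ => hL z) convex_univ (Set.mem_univ _)
      (Set.mem_univ _)
  · exact (norm_sub_le _ _).trans (by linarith [hB x, hB y])

theorem continuous_of_holder {G : Type*} [NormedAddCommGroup G] {w : Plane → G} {C β : ℝ}
    (hβ : 0 < β) (h : ∀ x y, ‖w x - w y‖ ≤ C * ‖x - y‖ ^ β) : Continuous w := by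
  rw [continuous_iff_continuousAt]
  intro x
  rw [ContinuousAt, tendsto_iff_norm_sub_tendsto_zero]
  have h1 : Tendsto (fun y => C * ‖y - x‖ ^ β) (𝓝 x) (𝓝 (C * ‖x - x‖ ^ β)) := by
    have : Continuous fun y => C * ‖y - x‖ ^ β :=
      continuous_const.mul ((continuous_id.sub continuous_const).norm.rpow_const
        fun _ => Or.inr hβ.le)
    exact this.tendsto x
  rw [sub_self, norm_zero, Real.zero_rpow hβ.ne', mul_zero] at h1
  exact squeeze_zero (fun y => norm_nonneg _) (fun y => h y x) h1

theorem norm_iteratedFDeriv_succ_sub {G : Type*} [NormedAddCommGroup G] [NormedSpace ℝ G]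
    (w : Plane → G) (m : ℕ) (x y : Plane) :
    ‖iteratedFDeriv ℝ (m + 1) w x - iteratedFDeriv ℝ (m + 1) w y‖ =
      ‖iteratedFDeriv ℝ m (fderiv ℝ w) x - iteratedFDeriv ℝ m (fderiv ℝ w) y‖ := by
  have e : ∀ x, iteratedFDeriv ℝ (m + 1) w x = (continuousMultilinearCurryRightEquiv' ℝ m Plane G).symm
      (iteratedFDeriv ℝ m (fderiv ℝ w) x) := fun x => by
    rw [iteratedFDeriv_succ_eq_comp_right, Function.comp_apply]
  rw [← dist_eq_norm, e, e, LinearIsometryEquiv.dist_map, dist_eq_norm]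

theorem contDiff_flip {E F G H : Type*} [NormedAddCommGroup E] [NormedSpace ℝ E]
    [NormedAddCommGroup F] [NormedSpace ℝ F] [NormedAddCommGroup G] [NormedSpace ℝ G]
    [NormedAddCommGroup H] [NormedSpace ℝ H] {f : H → E →L[ℝ] F →L[ℝ] G} {n : ℕ∞ω}
    (hf : ContDiff ℝ n f) : ContDiff ℝ n fun x => (f x).flip :=
  ContDiff.comp (IsBoundedLinearMap.contDiff (f := fun g : E →L[ℝ] F →L[ℝ] G => g.flip)
    ⟨⟨fun _ _ => rfl, fun _ _ => rfl⟩, 1, one_pos, fun g => by simp⟩) hf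

/-- A field on the circle, multiplied with a cutoff that is supported off the origin, has the
regularity of the field. -/
theorem exists_holder_clm_direction {β : ℝ} (hβ : 0 < β) (hβ' : β ≤ 1) (m : ℕ) :
    ∀ (M : ℝ≥0) {F : Type} [NormedAddCommGroup F] [NormedSpace ℝ F] (φ : Plane → Plane →L[ℝ] F),
      ContDiff ℝ ∞ φ → HasCompactSupport φ → (∀ x, ‖x‖ < 1 / 8 → φ x = 0) →
      ∃ C : ℝ, 0 ≤ C ∧ ∀ v : UnitCircle → Plane, HolderBound m β M v →
        ContDiff ℝ m (fun x => φ x (v (direction x))) ∧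
        (∀ x, ‖iteratedFDeriv ℝ m (fun x => φ x (v (direction x))) x‖ ≤ C) ∧
        ∀ x y, ‖iteratedFDeriv ℝ m (fun x => φ x (v (direction x))) x -
          iteratedFDeriv ℝ m (fun x => φ x (v (direction x))) y‖ ≤ C * ‖x - y‖ ^ β := by
  induction m with
  | zero =>
    intro M F _ _ φ hφ hs h0
    obtain ⟨B, hB0, hB, hBh⟩ := exists_holder_of_contDiff_hasCompactSupport hφ hs hβ hβ'
    refine ⟨B * M + B * (32 * M), by positivity, fun v hv => ?_⟩
    have hbd : ∀ x, ‖φ x (v (direction x))‖ ≤ B * M := fun x =>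
      ((φ x).le_opNorm _).trans (mul_le_mul (hB x) (hv.norm_le _) (norm_nonneg _) hB0)
    have key : ∀ x y, 1 / 8 ≤ ‖x‖ → ‖φ x (v (direction x)) - φ y (v (direction y))‖ ≤
        (B * M + B * (32 * M)) * ‖x - y‖ ^ β := by
      intro x y hx
      have e : φ x (v (direction x)) - φ y (v (direction y)) = (φ x - φ y) (v (direction y)) +
          φ x (v (direction x) - v (direction y)) := by
        rw [sub_apply, map_sub]; abel
      rw [e]
      calc _ ≤ ‖(φ x - φ y) (v (direction y))‖ + ‖φ x (v (direction x) - v (direction y))‖ :=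
            norm_add_le _ _
        _ ≤ (B * ‖x - y‖ ^ β) * M + B * (32 * M * ‖x - y‖ ^ β) := by
          gcongr
          · exact ((φ x - φ y).le_opNorm _).trans (mul_le_mul (hBh x y) (hv.norm_le _)
              (norm_nonneg _) (by positivity))
          · exact ((φ x).le_opNorm _).trans (mul_le_mul (hB x)
              (hv.norm_sub_direction_le hβ hβ' hx) (norm_nonneg _) hB0)
        _ = _ := by ring
    have hh : ∀ x y, ‖φ x (v (direction x)) - φ y (v (direction y))‖ ≤
        (B * M + B * (32 * M)) * ‖x - y‖ ^ β := by
      intro x y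
      rcases le_or_gt (1 / 8) ‖x‖ with hx | hx
      · exact key x y hx
      · rcases le_or_gt (1 / 8) ‖y‖ with hy | hy
        · rw [norm_sub_rev, norm_sub_rev x y]
          exact key y x hy
        · rw [h0 x hx, h0 y hy]
          simp only [zero_apply, sub_self, norm_zero]
          positivity
    refine ⟨contDiff_zero.2 (continuous_of_holder hβ hh), fun x => ?_, fun x y => ?_⟩
    · rw [norm_iteratedFDeriv_zero]
      exact (hbd x).trans (le_add_of_nonneg_right (by positivity))
    · rw [iteratedFDeriv_zero_eq_comp, Function.comp_apply, Function.comp_apply, ← map_sub,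
        LinearIsometryEquiv.norm_map]
      exact hh x y
  | succ m ih =>
    intro M F _ _ φ hφ hs h0
    have h0' : ∀ x, ‖x‖ < 1 / 8 → φ =ᶠ[𝓝 x] fun _ => 0 := fun x hx => by
      filter_upwards [(isOpen_lt continuous_norm continuous_const).mem_nhds hx] with y hy
      exact h0 y hy
    -- The product rule splits the derivative of φ(v) into a term φ₁(v), where φ is differentiated,
    -- and a term φ₂(v'), where the direction field is. Both have the original shape with values in
    -- a new space, which is why the multiplier is operator-valued and `F` is quantified inside the
    -- induction.
    set φ₁ : Plane → Plane →L[ℝ] (Plane →L[ℝ] F) := fun x => (fderiv ℝ φ x).flip with hφ₁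
    set φ₂ : Plane → Plane →L[ℝ] (Plane →L[ℝ] F) := fun x =>
      (ContinuousLinearMap.smulRightL ℝ Plane F (angularForm x)).comp (φ x) with hφ₂
    have c1 : ContDiff ℝ ∞ φ₁ :=
      contDiff_flip (hφ.fderiv_right (m := ∞) (by simp))
    have c2 : ContDiff ℝ ∞ φ₂ := by
      rw [contDiff_iff_contDiffAt]
      intro x
      rcases lt_or_ge ‖x‖ (1 / 8) with hx | hx
      · refine (contDiffAt_const (c := (0 : Plane →L[ℝ] Plane →L[ℝ] F))).congr_of_eventuallyEq ?_
        filter_upwards [h0' x hx] with y hy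
        simp [hφ₂, hy]
      · have hx0 : x ≠ 0 := norm_pos_iff.1 (by linarith)
        exact ((ContinuousLinearMap.smulRightL ℝ Plane F).contDiff.contDiffAt.comp x
          (contDiffAt_angularForm hx0)).clm_comp hφ.contDiffAt
    have s1 : HasCompactSupport φ₁ := by
      refine (hs.fderiv (𝕜 := ℝ)).mono fun x hx => ?_
      contrapose! hx
      simp only [Function.mem_support, not_not] at hx ⊢
      simp [hφ₁, hx]
    have s2 : HasCompactSupport φ₂ := by
      refine hs.mono fun x hx => ?_
      contrapose! hx
      simp only [Function.mem_support, not_not] at hx ⊢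
      simp [hφ₂, hx]
    have z1 : ∀ x, ‖x‖ < 1 / 8 → φ₁ x = 0 := fun x hx => by
      have : fderiv ℝ φ x = 0 := by
        rw [(h0' x hx).fderiv_eq]; simp
      simp [hφ₁, this]
    have z2 : ∀ x, ‖x‖ < 1 / 8 → φ₂ x = 0 := fun x hx => by simp [hφ₂, h0 x hx]
    -- The undifferentiated field is used with one order of regularity less, at the cost of the
    -- factor 3; the angular derivative keeps the bound M.
    obtain ⟨C₁, hC₁0, hC₁⟩ := ih (3 * M) φ₁ c1 s1 z1
    obtain ⟨C₂, hC₂0, hC₂⟩ := ih M φ₂ c2 s2 z2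
    refine ⟨C₁ + C₂, by positivity, fun v hv => ?_⟩
    obtain ⟨a1, a2, a3⟩ := hC₁ v (hv.of_lt (Nat.lt_succ_self m) hβ hβ')
    obtain ⟨b1, b2, b3⟩ := hC₂ _ hv.angularDeriv
    have hd : ∀ x, HasFDerivAt (fun x => φ x (v (direction x)))
        (φ₁ x (v (direction x)) + φ₂ x (angularDeriv v (direction x))) x := by
      intro x
      rcases lt_or_ge ‖x‖ (1 / 8) with hx | hx
      · rw [z1 x hx, z2 x hx]
        simp only [zero_apply, add_zero]
        refine (hasFDerivAt_const (0 : F) x).congr_of_eventuallyEq ?_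
        filter_upwards [h0' x hx] with y hy
        simp [hy]
      · have hx0 : x ≠ 0 := norm_pos_iff.1 (by linarith)
        have d1 : HasFDerivAt φ (fderiv ℝ φ x) x := (hφ.differentiable (by simp) x).hasFDerivAt
        have d2 := hasFDerivAt_comp_direction hv.differentiable
          (v' := angularDeriv v) (fun θ => (congrFun (angular_angularDeriv v) θ).symm) hx0
        refine (d1.clm_apply d2).congr_fderiv ?_
        ext h
        simp [hφ₁, hφ₂, add_comm]
    have hfd : fderiv ℝ (fun x => φ x (v (direction x))) =
        (fun x => φ₁ x (v (direction x))) + fun x => φ₂ x (angularDeriv v (direction x)) :=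
      funext fun x => (hd x).fderiv
    have hadd : ∀ x, iteratedFDeriv ℝ m (fderiv ℝ (fun x => φ x (v (direction x)))) x =
        iteratedFDeriv ℝ m (fun x => φ₁ x (v (direction x))) x +
        iteratedFDeriv ℝ m (fun x => φ₂ x (angularDeriv v (direction x))) x := fun x => by
      rw [hfd]
      exact iteratedFDeriv_add_apply a1.contDiffAt b1.contDiffAt
    refine ⟨?_, fun x => ?_, fun x y => ?_⟩
    · rw [Nat.cast_add, Nat.cast_one, contDiff_succ_iff_fderiv]
      refine ⟨fun x => (hd x).differentiableAt, by simp, ?_⟩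
      rw [hfd]
      exact a1.add b1
    · rw [← norm_iteratedFDeriv_fderiv, hadd]
      exact (norm_add_le _ _).trans (add_le_add (a2 x) (b2 x))
    · rw [norm_iteratedFDeriv_succ_sub, hadd, hadd, add_sub_add_comm, add_mul]
      exact (norm_add_le _ _).trans (add_le_add (a3 x y) (b3 x y))

end LocalizedField

/-! ### Decaying kernels against Hölder functions. -/

section HolderConvolution

/-- A smooth kernel whose derivatives of order `k` decay like `|x|^{-3-k}`. -/
def DecayingKernel (K : Plane → ℝ) : Prop :=
  ContDiff ℝ ∞ K ∧ ∀ k : ℕ, ∃ C : ℝ, 0 ≤ C ∧ ∀ x : Plane,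
    ‖iteratedFDeriv ℝ k K x‖ ≤ C * (1 + ‖x‖) ^ (-((k:ℝ) + 3))

variable {K : Plane → ℝ}

theorem DecayingKernel.bound (hK : DecayingKernel K) (k : ℕ) : ∃ C : ℝ, ∀ x : Plane,
    ‖iteratedFDeriv ℝ k K x‖ ≤ C * (1 + ‖x‖) ^ (-(3:ℝ)) := by
  obtain ⟨C, hC0, hC⟩ := hK.2 k
  refine ⟨C, fun x => (hC x).trans ?_⟩
  gcongr
  · linarith [norm_nonneg x]
  · linarith [(Nat.cast_nonneg k : (0:ℝ) ≤ k)]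

theorem integrable_one_add_norm_three (x : Plane) :
    Integrable fun y : Plane => (1 + ‖x - y‖) ^ (-(3:ℝ)) :=
  integrable_one_add_norm_sub (by norm_num) x

theorem DecayingKernel.integrable (hK : DecayingKernel K) : Integrable K := by
  obtain ⟨C, hC⟩ := hK.bound 0
  refine ((integrable_one_add_norm (E := Plane) (μ := volume) (r := 3)
    (by rw [finrank_euclideanSpace]; norm_num)).const_mul C).mono'
    hK.1.continuous.aestronglyMeasurable (Eventually.of_forall fun x => ?_)
  simpa only [norm_iteratedFDeriv_zero] using hC x

section

variable {F : Type*} [NormedAddCommGroup F] [NormedSpace ℝ F]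

theorem integrable_weight_mul_of_bounded {F : Type*} [NormedAddCommGroup F]
    {w : Plane → F} (hw : Continuous w) {B : ℝ}
    (hB : ∀ x, ‖w x‖ ≤ B) (x : Plane) :
    Integrable fun y : Plane => (1 + ‖x - y‖) ^ (-(3:ℝ)) * ‖w y‖ := by
  refine ((integrable_one_add_norm_three x).mul_const B).mono' ?_ (Eventually.of_forall fun y => ?_)
  · exact ((integrable_one_add_norm_three x).1).mul hw.norm.aestronglyMeasurable
  · rw [Real.norm_of_nonneg (by positivity)]
    gcongr
    exact hB y

theorem DecayingKernel.integrable_smul (hK : DecayingKernel K) {w : Plane → F}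
    (hw : AEStronglyMeasurable w) (x : Plane)
    (hi : Integrable fun y : Plane => (1 + ‖x - y‖) ^ (-(3:ℝ)) * ‖w y‖) :
    Integrable fun y => K (x - y) • w y := by
  obtain ⟨C, hC⟩ := hK.bound 0
  refine (hi.const_mul C).mono' ?_ (Eventually.of_forall fun y => ?_)
  · exact (hK.1.continuous.comp (continuous_const.sub continuous_id)).aestronglyMeasurable.smul hw
  · rw [norm_smul, ← mul_assoc]
    gcongr
    simpa only [norm_iteratedFDeriv_zero] using hC (x - y)

theorem integral_sub_smul_comm (K : Plane → ℝ) (w : Plane → F) (x : Plane) :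
    ∫ y, K (x - y) • w y = ∫ z, K z • w (x - z) := by
  have := integral_sub_left_eq_self (fun z => K z • w (x - z)) volume x
  rw [← this]
  simp only [sub_sub_cancel]

theorem DecayingKernel.hasFDerivAt_convolution [CompleteSpace F] (hK : DecayingKernel K)
    {w : Plane → F} (hw : ContDiff ℝ 1 w) (hs : HasCompactSupport w) (x : Plane) :
    HasFDerivAt (fun x => ∫ y, K (x - y) • w y) (∫ y, K (x - y) • fderiv ℝ w y) x := by
  have hwc := hw.continuous
  have hdc : Continuous (fderiv ℝ w) := hw.continuous_fderiv (by simp)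
  obtain ⟨B, hB⟩ := hs.exists_bound_of_continuous hwc
  obtain ⟨B', hB'⟩ := (hs.fderiv (𝕜 := ℝ)).exists_bound_of_continuous hdc
  simp_rw [integral_sub_smul_comm]
  refine hasFDerivAt_integral_of_dominated_of_fderiv_le (𝕜 := ℝ)
    (F := fun x z => K z • w (x - z)) (F' := fun x z => K z • fderiv ℝ w (x - z))
    (bound := fun z => ‖K z‖ * B') (Filter.univ_mem) (Eventually.of_forall fun x => ?_) ?_ ?_
    (Eventually.of_forall fun z x _ => ?_) (hK.integrable.norm.mul_const B')
    (Eventually.of_forall fun z x _ => ?_)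
  · exact (hK.1.continuous.smul (hwc.comp (continuous_const.sub continuous_id))).aestronglyMeasurable
  · refine (hK.integrable.norm.mul_const B).mono' ?_ (Eventually.of_forall fun z => ?_)
    · exact (hK.1.continuous.smul (hwc.comp (continuous_const.sub continuous_id))).aestronglyMeasurable
    · rw [norm_smul]
      gcongr
      exact hB _
  · exact (hK.1.continuous.smul (hdc.comp (continuous_const.sub continuous_id))).aestronglyMeasurable
  · rw [norm_smul]
    gcongr
    exact hB' _
  · have h1 : HasFDerivAt w (fderiv ℝ w (x - z)) (x - z) :=
      (hw.differentiable (by simp) (x - z)).hasFDerivAt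
    have h2 := h1.comp x ((hasFDerivAt_id x).sub_const z)
    rw [ContinuousLinearMap.comp_id] at h2
    exact h2.const_smul (K z)

end

theorem DecayingKernel.exists_convolution_le (hK : DecayingKernel K) :
    ∃ C : ℝ, 0 ≤ C ∧ ∀ {F : Type} [NormedAddCommGroup F] [NormedSpace ℝ F] (w : Plane → F) (A : ℝ),
      (∀ x, ‖w x‖ ≤ A) → ∀ x, ‖∫ y, K (x - y) • w y‖ ≤ C * A := by
  refine ⟨∫ z, ‖K z‖, integral_nonneg fun _ => norm_nonneg _, fun w A hA x => ?_⟩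
  rw [integral_sub_smul_comm, ← integral_mul_const]
  refine norm_integral_le_of_norm_le (hK.integrable.norm.mul_const A)
    (Eventually.of_forall fun z => ?_)
  rw [norm_smul]
  gcongr
  exact hA _

theorem DecayingKernel.exists_convolution_sub_le (hK : DecayingKernel K) (β : ℝ) :
    ∃ C : ℝ, 0 ≤ C ∧ ∀ {F : Type} [NormedAddCommGroup F] [NormedSpace ℝ F] (w : Plane → F) (A : ℝ),
      Continuous w → HasCompactSupport w → (∀ x y, ‖w x - w y‖ ≤ A * ‖x - y‖ ^ β) →
      ∀ x x', ‖(∫ y, K (x - y) • w y) - ∫ y, K (x' - y) • w y‖ ≤ C * A * ‖x - x'‖ ^ β := by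
  refine ⟨∫ z, ‖K z‖, integral_nonneg fun _ => norm_nonneg _, fun w A hwc hs hA x x' => ?_⟩
  obtain ⟨B, hB⟩ := hs.exists_bound_of_continuous hwc
  have hi : ∀ x, Integrable fun z => K z • w (x - z) := fun x => by
    refine (hK.integrable.norm.mul_const B).mono' ?_ (Eventually.of_forall fun z => ?_)
    · exact (hK.1.continuous.smul (hwc.comp (continuous_const.sub continuous_id))).aestronglyMeasurable
    · rw [norm_smul]
      gcongr
      exact hB _
  rw [integral_sub_smul_comm, integral_sub_smul_comm, ← integral_sub (hi x) (hi x'), mul_assoc,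
    ← integral_mul_const]
  refine norm_integral_le_of_norm_le (hK.integrable.norm.mul_const _)
    (Eventually.of_forall fun z => ?_)
  rw [← smul_sub, norm_smul]
  gcongr
  have := hA (x - z) (x' - z)
  rwa [sub_sub_sub_cancel_right] at this

/-- Convolution with a constant is constant, so for j ≥ 1 the value of `w` at the base point may be
subtracted first. The difference grows like |x₀-y|^β ≤ 1+|x₀-y|, and the derivative of the kernel,
of decay j+3 ≥ 4, absorbs this and stays integrable. The bound thus involves the Hölder seminorm
alone. -/
theorem DecayingKernel.exists_iteratedFDeriv_convolution_le (hK : DecayingKernel K) {β : ℝ}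
    (hβ : 0 < β) (hβ' : β ≤ 1) {j : ℕ} (hj : 1 ≤ j) :
    ∃ C : ℝ, 0 ≤ C ∧ ∀ {F : Type} [NormedAddCommGroup F] [NormedSpace ℝ F] [CompleteSpace F]
      (w : Plane → F) (A : ℝ),
      Continuous w → HasCompactSupport w → (∀ x y, ‖w x - w y‖ ≤ A * ‖x - y‖ ^ β) →
      ∀ x, ‖iteratedFDeriv ℝ j (fun x => ∫ y, K (x - y) • w y) x‖ ≤ C * A := by
  obtain ⟨C, hC0, hC⟩ := hK.2 j
  refine ⟨C * ∫ z : Plane, (1 + ‖z‖) ^ (-(3:ℝ)), mul_nonneg hC0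
    (integral_nonneg fun z => by positivity), fun {F} _ _ _ w A hwc hs hA x₀ => ?_⟩
  obtain ⟨B, hB⟩ := hs.exists_bound_of_continuous hwc
  have hA0 : 0 ≤ A := by
    have := (norm_nonneg _).trans (hA (EuclideanSpace.single 0 1) 0)
    simpa using this
  set w' : Plane → F := fun y => w y - w x₀ with hw'
  have hw'c : Continuous w' := hwc.sub continuous_const
  have hw'B : ∀ y, ‖w' y‖ ≤ B + B := fun y => (norm_sub_le _ _).trans (add_le_add (hB y) (hB x₀))
  have hwi' := integrable_weight_mul_of_bounded hw'c hw'B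
  have e : (fun x => ∫ y, K (x - y) • w y) =
      (fun x => ∫ y, K (x - y) • w' y) + fun _ => (∫ z, K z) • w x₀ := by
    funext x
    have h1 : Integrable fun y => K (x - y) • w' y :=
      hK.integrable_smul hw'c.aestronglyMeasurable x (hwi' x)
    have h2 : Integrable fun y => K (x - y) • w x₀ := (hK.integrable.comp_sub_left x).smul_const _
    rw [Pi.add_apply, ← integral_sub_left_eq_self K volume x, ← integral_smul_const,
      ← integral_add h1 h2]
    simp only [hw', smul_sub, sub_add_cancel]
  obtain ⟨c1, -, -, c4⟩ := contDiff_kernel_convolution hK.1 (s := 3) (by norm_num) hK.bound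
    hw'c.aestronglyMeasurable hwi'
  rw [e, iteratedFDeriv_add_apply (c1.contDiffAt.of_le (by exact_mod_cast le_top))
    contDiffAt_const, iteratedFDeriv_const_of_ne (by omega), Pi.zero_apply, add_zero]
  refine (c4 j x₀).trans ?_
  rw [mul_assoc, mul_comm (∫ z : Plane, (1 + ‖z‖) ^ (-(3:ℝ))), ← mul_assoc,
    ← integral_sub_left_eq_self (fun z : Plane => (1 + ‖z‖) ^ (-(3:ℝ))) volume x₀,
    ← integral_const_mul]
  refine integral_mono_of_nonneg (Eventually.of_forall fun y => by positivity)
    ((integrable_one_add_norm_three x₀).const_mul _) (Eventually.of_forall fun y => ?_)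
  have h0 : 0 < 1 + ‖x₀ - y‖ := by positivity
  have h1 : ‖x₀ - y‖ ^ β ≤ 1 + ‖x₀ - y‖ := by
    calc ‖x₀ - y‖ ^ β ≤ (1 + ‖x₀ - y‖) ^ β := by gcongr; linarith
      _ ≤ (1 + ‖x₀ - y‖) ^ (1:ℝ) := Real.rpow_le_rpow_of_exponent_le
          (by linarith [norm_nonneg (x₀ - y)]) hβ'
      _ = _ := Real.rpow_one _
  have hj' : (1:ℝ) ≤ j := by exact_mod_cast hj
  calc ‖iteratedFDeriv ℝ j K (x₀ - y)‖ * ‖w' y‖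
      ≤ (C * (1 + ‖x₀ - y‖) ^ (-((j:ℝ) + 3))) * (A * (1 + ‖x₀ - y‖)) := by
        gcongr
        · exact hC _
        · have := hA y x₀
          rw [norm_sub_rev y x₀] at this
          exact this.trans (by gcongr)
    _ = C * A * ((1 + ‖x₀ - y‖) ^ (-((j:ℝ) + 3)) * (1 + ‖x₀ - y‖) ^ (1:ℝ)) := by
        rw [Real.rpow_one]; ring
    _ ≤ C * A * (1 + ‖x₀ - y‖) ^ (-(3:ℝ)) := by
        rw [← Real.rpow_add h0]
        gcongr
        · linarith [norm_nonneg (x₀ - y)]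
        · linarith

/-- Derivatives of the convolution of a decaying kernel with a function of class `C^{m,β}`. -/
theorem DecayingKernel.exists_holder_convolution_le (hK : DecayingKernel K) {β : ℝ}
    (hβ : 0 < β) (hβ' : β ≤ 1) (j : ℕ) :
    ∃ C : ℝ, 0 ≤ C ∧ ∀ (m : ℕ) {F : Type} [NormedAddCommGroup F] [NormedSpace ℝ F]
      [CompleteSpace F] (w : Plane → F) (A₀ A₁ : ℝ),
      ContDiff ℝ m w → HasCompactSupport w → (∀ x, ‖iteratedFDeriv ℝ m w x‖ ≤ A₀) →
      (∀ x y, ‖iteratedFDeriv ℝ m w x - iteratedFDeriv ℝ m w y‖ ≤ A₁ * ‖x - y‖ ^ β) →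
      (∀ x, ‖iteratedFDeriv ℝ m (fun x => ∫ y, K (x - y) • w y) x‖ ≤ C * A₀) ∧
      (∀ x x', ‖iteratedFDeriv ℝ m (fun x => ∫ y, K (x - y) • w y) x -
        iteratedFDeriv ℝ m (fun x => ∫ y, K (x - y) • w y) x'‖ ≤ C * A₁ * ‖x - x'‖ ^ β) ∧
      (1 ≤ j → ∀ x, ‖iteratedFDeriv ℝ (m + j) (fun x => ∫ y, K (x - y) • w y) x‖ ≤ C * A₁) := by
  obtain ⟨C₁, hC₁0, hC₁⟩ := hK.exists_convolution_le
  obtain ⟨C₂, hC₂0, hC₂⟩ := hK.exists_convolution_sub_le β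
  obtain ⟨C₃, hC₃0, hC₃⟩ : ∃ C : ℝ, 0 ≤ C ∧ ∀ {F : Type} [NormedAddCommGroup F] [NormedSpace ℝ F]
      [CompleteSpace F] (w : Plane → F) (A : ℝ),
      Continuous w → HasCompactSupport w → (∀ x y, ‖w x - w y‖ ≤ A * ‖x - y‖ ^ β) → 1 ≤ j →
      ∀ x, ‖iteratedFDeriv ℝ j (fun x => ∫ y, K (x - y) • w y) x‖ ≤ C * A := by
    by_cases hj : 1 ≤ j
    · obtain ⟨C, hC0, hC⟩ := hK.exists_iteratedFDeriv_convolution_le hβ hβ' hj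
      exact ⟨C, hC0, fun w A h1 h2 h3 _ => hC w A h1 h2 h3⟩
    · exact ⟨0, le_rfl, fun w A _ _ _ h => absurd h hj⟩
  -- The constant is fixed before the induction on m: each step only replaces `w` by its derivative,
  -- with values in another space, and changes neither the kernel nor the bounds.
  refine ⟨C₁ + C₂ + C₃, by positivity, fun m => ?_⟩
  induction m with
  | zero =>
    intro F _ _ _ w A₀ A₁ hw hs h0 h1
    have hz : ∀ (f : Plane → F) x y, ‖iteratedFDeriv ℝ 0 f x - iteratedFDeriv ℝ 0 f y‖ =
        ‖f x - f y‖ := fun f x y => by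
      rw [iteratedFDeriv_zero_eq_comp, Function.comp_apply, Function.comp_apply, ← map_sub,
        LinearIsometryEquiv.norm_map]
    simp only [norm_iteratedFDeriv_zero, hz] at h0 h1 ⊢
    have hA0 : 0 ≤ A₀ := (norm_nonneg _).trans (h0 0)
    have hA1 : 0 ≤ A₁ := by
      have := (norm_nonneg _).trans (h1 (EuclideanSpace.single 0 1) 0)
      simpa using this
    refine ⟨fun x => (hC₁ w A₀ h0 x).trans ?_,
      fun x x' => (hC₂ w A₁ hw.continuous hs h1 x x').trans ?_, fun hj x => ?_⟩
    · gcongr; linarith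
    · gcongr; linarith
    · rw [zero_add]
      refine (hC₃ w A₁ hw.continuous hs h1 hj x).trans ?_
      gcongr; linarith
  | succ m ih =>
    intro F _ _ _ w A₀ A₁ hw hs h0 h1
    rw [Nat.cast_add, Nat.cast_one] at hw
    have hd : fderiv ℝ (fun x => ∫ y, K (x - y) • w y) = fun x => ∫ y, K (x - y) • fderiv ℝ w y :=
      funext fun x => (hK.hasFDerivAt_convolution (hw.of_le le_add_self) hs x).fderiv
    obtain ⟨a1, a2, a3⟩ := ih (fderiv ℝ w) A₀ A₁ (hw.fderiv_right le_rfl) (hs.fderiv (𝕜 := ℝ))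
      (fun x => by rw [norm_iteratedFDeriv_fderiv]; exact h0 x)
      (fun x y => by rw [← norm_iteratedFDeriv_succ_sub]; exact h1 x y)
    refine ⟨fun x => ?_, fun x x' => ?_, fun hj x => ?_⟩
    · rw [← norm_iteratedFDeriv_fderiv, hd]; exact a1 x
    · rw [norm_iteratedFDeriv_succ_sub, hd]; exact a2 x x'
    · rw [Nat.add_right_comm, ← norm_iteratedFDeriv_fderiv, hd]; exact a3 hj x

end HolderConvolution

/-! ### Measurability and size of the homogeneous field. -/

section HomogeneousField

theorem HolderBound.zero {m : ℕ} {β : ℝ} (hβ : 0 < β) (hβ' : β ≤ 1) {M : ℝ≥0}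
    {v : UnitCircle → Plane} (h : HolderBound m β M v) : HolderBound 0 β (3 * M) v := by
  rcases Nat.eq_zero_or_pos m with rfl | hm
  · refine ⟨h.1, h.2.trans ?_⟩
    exact_mod_cast le_mul_of_one_le_left zero_le (by norm_num : (1:ℝ≥0) ≤ 3)
  · exact h.of_lt hm hβ hβ'

theorem HolderBound.continuousAt_direction {m : ℕ} {β : ℝ} (hβ : 0 < β) (hβ' : β ≤ 1) {M : ℝ≥0}
    {v : UnitCircle → Plane} (h : HolderBound m β M v) {x : Plane} (hx : x ≠ 0) :
    ContinuousAt (fun y => v (direction y)) x := by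
  have hr : 0 < ‖x‖ := norm_pos_iff.2 hx
  have ht : 0 < ‖x‖⁻¹ := inv_pos.2 hr
  have h0 := h.zero hβ hβ'
  have key : ∀ y, ‖v (direction y) - v (direction x)‖ ≤
      32 * ((3 * M : ℝ≥0) : ℝ) * ‖‖x‖⁻¹ • x - ‖x‖⁻¹ • y‖ ^ β := fun y => by
    rw [norm_sub_rev, ← direction_smul ht x, ← direction_smul ht y]
    refine h0.norm_sub_direction_le hβ hβ' ?_
    rw [norm_smul, norm_inv, norm_norm, inv_mul_cancel₀ hr.ne']
    norm_num
  rw [ContinuousAt, tendsto_iff_norm_sub_tendsto_zero]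
  refine squeeze_zero (fun y => norm_nonneg _) key ?_
  have : Continuous fun y : Plane =>
      32 * ((3 * M : ℝ≥0) : ℝ) * ‖‖x‖⁻¹ • x - ‖x‖⁻¹ • y‖ ^ β := by
    have h2 : Continuous fun y : Plane => ‖‖x‖⁻¹ • x - ‖x‖⁻¹ • y‖ := by fun_prop
    exact continuous_const.mul (h2.rpow_const fun _ => Or.inr hβ.le)
  have h3 := this.tendsto x
  simpa [Real.zero_rpow hβ.ne'] using h3

theorem HolderBound.aestronglyMeasurable_homogeneousField {m : ℕ} {β : ℝ} (hβ : 0 < β)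
    (hβ' : β ≤ 1) {M : ℝ≥0} {v : UnitCircle → Plane} (h : HolderBound m β M v) (α : ℝ) :
    AEStronglyMeasurable (homogeneousField α v) := by
  have hc : ContinuousOn (homogeneousField α v) {0}ᶜ := by
    have : ContinuousOn (fun x : Plane => ‖x‖ ^ (1 - 2 * α) • v (direction x)) {0}ᶜ :=
      fun x hx => (((continuous_norm.continuousAt).rpow_const
        (Or.inl (norm_ne_zero_iff.2 hx))).smul
        (h.continuousAt_direction hβ hβ' hx)).continuousWithinAt
    exact this.congr fun x hx => homogeneousField_eq α v hx
  have := hc.aestronglyMeasurable (μ := volume) (measurableSet_singleton 0).compl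
  rwa [restrict_compl_singleton] at this

theorem HolderBound.norm_homogeneousField_le {m : ℕ} {β : ℝ} {M : ℝ≥0}
    {v : UnitCircle → Plane} (h : HolderBound m β M v) (α : ℝ) (y : Plane) :
    ‖homogeneousField α v y‖ ≤ M * ‖y‖ ^ (-(2 * α - 1)) := by
  by_cases hy : y = 0
  · rw [homogeneousField, dif_pos hy, norm_zero]; positivity
  · rw [homogeneousField_eq α v hy, norm_smul, Real.norm_of_nonneg (by positivity), mul_comm,
      neg_sub]
    gcongr
    exact h.norm_le _

end HomogeneousField

/-! ### Convolutions of decaying kernels with fields bounded by a negative power. -/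

section Decay

variable {K : Plane → ℝ} {F : Type*} [NormedAddCommGroup F] [NormedSpace ℝ F]

theorem integrable_weight_mul_of_le {F : Type*} [NormedAddCommGroup F]
    {w : Plane → F} (hw : AEStronglyMeasurable w) {a A : ℝ}
    (ha : 0 ≤ a) (ha' : a < 2) (hwb : ∀ y, ‖w y‖ ≤ A * ‖y‖ ^ (-a)) (x : Plane) :
    Integrable fun y : Plane => (1 + ‖x - y‖) ^ (-(3:ℝ)) * ‖w y‖ := by
  refine ((integrable_one_add_norm_mul_norm_rpow (s := 3) (by norm_num) ha ha' x).const_mul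
    A).mono' ((integrable_one_add_norm_three x).1.mul hw.norm) (Eventually.of_forall fun y => ?_)
  rw [Real.norm_of_nonneg (by positivity)]
  calc _ ≤ (1 + ‖x - y‖) ^ (-(3:ℝ)) * (A * ‖y‖ ^ (-a)) := by gcongr; exact hwb y
    _ = _ := by ring

theorem DecayingKernel.contDiff_convolution [CompleteSpace F] (hK : DecayingKernel K)
    {w : Plane → F} (hw : AEStronglyMeasurable w) {a A : ℝ}
    (ha : 0 ≤ a) (ha' : a < 2) (hwb : ∀ y, ‖w y‖ ≤ A * ‖y‖ ^ (-a)) :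
    ContDiff ℝ ∞ (fun x => ∫ y, K (x - y) • w y) :=
  (contDiff_kernel_convolution hK.1 (s := 3) (by norm_num) hK.bound hw
    (integrable_weight_mul_of_le hw ha ha' hwb)).1

theorem DecayingKernel.exists_iteratedFDeriv_le (hK : DecayingKernel K) {a : ℝ}
    (ha : 0 ≤ a) (ha' : a < 2) (k : ℕ) :
    ∃ C : ℝ, 0 ≤ C ∧ ∀ {F : Type} [NormedAddCommGroup F] [NormedSpace ℝ F] [CompleteSpace F]
      (w : Plane → F) (A : ℝ), 0 ≤ A → AEStronglyMeasurable w → (∀ y, ‖w y‖ ≤ A * ‖y‖ ^ (-a)) →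
      ∀ x, ‖iteratedFDeriv ℝ k (fun x => ∫ y, K (x - y) • w y) x‖ ≤ C * A := by
  obtain ⟨C, hC⟩ := hK.bound k
  obtain ⟨D, hD0, hD⟩ := exists_integral_one_add_norm_mul_norm_rpow_le (s := 3) (by norm_num) ha ha'
  refine ⟨|C| * D, by positivity, fun {F} _ _ _ w A hA hw hwb x => ?_⟩
  refine ((contDiff_kernel_convolution hK.1 (s := 3) (by norm_num) hK.bound hw
    (integrable_weight_mul_of_le hw ha ha' hwb)).2.2.2 k x).trans ?_
  have hi := (integrable_one_add_norm_mul_norm_rpow (s := 3) (by norm_num) ha ha' x).const_mul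
    (|C| * A)
  calc _ ≤ ∫ y : Plane, |C| * A * ((1 + ‖x - y‖) ^ (-(3:ℝ)) * ‖y‖ ^ (-a)) := by
        refine integral_mono_of_nonneg (Eventually.of_forall fun y => by positivity) hi
          (Eventually.of_forall fun y => ?_)
        calc _ ≤ (|C| * (1 + ‖x - y‖) ^ (-(3:ℝ))) * (A * ‖y‖ ^ (-a)) := by
              refine mul_le_mul ((hC _).trans (mul_le_mul_of_nonneg_right (le_abs_self C)
                (by positivity))) (hwb y) (norm_nonneg _) (by positivity)
          _ = _ := by ring
    _ = |C| * A * ∫ y : Plane, (1 + ‖x - y‖) ^ (-(3:ℝ)) * ‖y‖ ^ (-a) := integral_const_mul _ _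
    _ ≤ |C| * A * D := by gcongr; exact hD x
    _ = _ := by ring

/-- When the field vanishes within R/4 of x, only |x-y| ≥ R/4 contributes, and there 1+|x-y| is
comparable to R+|x-y|. The scaled integral then yields R^{2-(k+3)-a}: one power of R better than
homogeneity alone predicts. -/
theorem DecayingKernel.exists_iteratedFDeriv_far_le (hK : DecayingKernel K) {a : ℝ}
    (ha : 0 ≤ a) (ha' : a < 2) (k : ℕ) :
    ∃ C : ℝ, 0 ≤ C ∧ ∀ {F : Type} [NormedAddCommGroup F] [NormedSpace ℝ F] [CompleteSpace F]
      (w : Plane → F) (A : ℝ), 0 ≤ A → AEStronglyMeasurable w → (∀ y, ‖w y‖ ≤ A * ‖y‖ ^ (-a)) →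
      ∀ (R : ℝ), 0 < R → ∀ x, (∀ y, ‖x - y‖ < R / 4 → w y = 0) →
      ‖iteratedFDeriv ℝ k (fun x => ∫ y, K (x - y) • w y) x‖ ≤ C * A * R ^ (-(a + k + 1)) := by
  obtain ⟨C, hC0, hC⟩ := hK.2 k
  have hs : 2 < (k:ℝ) + 3 := by have : (0:ℝ) ≤ k := k.cast_nonneg; linarith
  obtain ⟨D, hD0, hD⟩ := exists_integral_add_norm_mul_norm_rpow_le hs ha ha'
  refine ⟨C * 5 ^ ((k:ℝ) + 3) * D, by positivity, fun {F} _ _ _ w A hA hw hwb R hR x hx => ?_⟩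
  refine ((contDiff_kernel_convolution hK.1 (s := 3) (by norm_num) hK.bound hw
    (integrable_weight_mul_of_le hw ha ha' hwb)).2.2.2 k x).trans ?_
  have hi := (integrable_add_norm_mul_norm_rpow hs ha ha' hR x).const_mul
    (C * 5 ^ ((k:ℝ) + 3) * A)
  calc _ ≤ ∫ y : Plane, C * 5 ^ ((k:ℝ) + 3) * A *
          ((R + ‖x - y‖) ^ (-((k:ℝ) + 3)) * ‖y‖ ^ (-a)) := by
        refine integral_mono_of_nonneg (Eventually.of_forall fun y => by positivity) hi
          (Eventually.of_forall fun y => ?_)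
        rcases lt_or_ge ‖x - y‖ (R / 4) with h | h
        · simp only [hx y h, norm_zero, mul_zero]; positivity
        -- The 5 comes from R ≤ 4|x-y|, so that R+|x-y| ≤ 5|x-y|.
        have h1 : (1 + ‖x - y‖) ^ (-((k:ℝ) + 3)) ≤
            5 ^ ((k:ℝ) + 3) * (R + ‖x - y‖) ^ (-((k:ℝ) + 3)) := by
          have : ((R + ‖x - y‖) / 5) ^ (-((k:ℝ) + 3)) =
              5 ^ ((k:ℝ) + 3) * (R + ‖x - y‖) ^ (-((k:ℝ) + 3)) := by
            rw [Real.div_rpow (by positivity) (by norm_num), Real.rpow_neg (by norm_num : (0:ℝ) ≤ 5),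
              div_inv_eq_mul, mul_comm]
          rw [← this]
          exact Real.rpow_le_rpow_of_nonpos (by positivity) (by linarith) (by linarith)
        calc _ ≤ (C * (5 ^ ((k:ℝ) + 3) * (R + ‖x - y‖) ^ (-((k:ℝ) + 3)))) * (A * ‖y‖ ^ (-a)) := by
              refine mul_le_mul ((hC _).trans (mul_le_mul_of_nonneg_left h1 hC0)) (hwb y)
                (norm_nonneg _) (by positivity)
          _ = _ := by ring
    _ = C * 5 ^ ((k:ℝ) + 3) * A * ∫ y : Plane, (R + ‖x - y‖) ^ (-((k:ℝ) + 3)) * ‖y‖ ^ (-a) :=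
        integral_const_mul _ _
    _ ≤ C * 5 ^ ((k:ℝ) + 3) * A * (D * R ^ (2 - ((k:ℝ) + 3) - a)) := by gcongr; exact hD R hR x
    _ = _ := by
        rw [show 2 - ((k:ℝ) + 3) - a = -(a + k + 1) by ring]; ring

end Decay

/-! ### The homogeneous field cut off to a dyadic annulus. -/

section Annulus

/-- A smooth cutoff to an annulus: `1` for `1/4 ≤ |x| ≤ 2`, `0` for `|x| ≤ 1/8` and `|x| ≥ 4`. -/
def annulusCutoff (x : Plane) : ℝ := originBump ((16:ℝ)⁻¹ • x) * (1 - originBump x)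

theorem norm_smul_pos {t : ℝ} (ht : 0 < t) (x : Plane) : ‖t • x‖ = t * ‖x‖ := by
  rw [norm_smul, Real.norm_of_nonneg ht.le]

theorem annulusCutoff_nonneg (x : Plane) : 0 ≤ annulusCutoff x :=
  mul_nonneg originBump.nonneg (sub_nonneg.2 originBump.le_one)

theorem annulusCutoff_le_one (x : Plane) : annulusCutoff x ≤ 1 :=
  mul_le_one₀ originBump.le_one (sub_nonneg.2 originBump.le_one)
    (by linarith [originBump.nonneg (x := x)])

theorem annulusCutoff_eq_one {x : Plane} (h : 1 / 4 ≤ ‖x‖) (h' : ‖x‖ ≤ 2) :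
    annulusCutoff x = 1 := by
  rw [annulusCutoff, originBump_eq_zero h, originBump_eq_one]
  · norm_num
  · rw [norm_smul_pos (by norm_num)]; linarith

theorem annulusCutoff_eq_zero_of_le {x : Plane} (h : ‖x‖ ≤ 1 / 8) : annulusCutoff x = 0 := by
  rw [annulusCutoff, originBump_eq_one h]; ring

theorem annulusCutoff_eq_zero_of_ge {x : Plane} (h : 4 ≤ ‖x‖) : annulusCutoff x = 0 := by
  rw [annulusCutoff, originBump_eq_zero, zero_mul]
  rw [norm_smul_pos (by norm_num)]; linarith

theorem contDiff_annulusCutoff_mul_norm_rpow (p : ℝ) :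
    ContDiff ℝ ∞ fun x => annulusCutoff x * ‖x‖ ^ p := by
  have h := contDiff_one_sub_originBump_smul (contDiffOn_norm_rpow p)
  have h2 : ContDiff ℝ ∞ fun x : Plane => originBump ((16:ℝ)⁻¹ • x) :=
    originBump.contDiff.comp (by fun_prop)
  simpa only [annulusCutoff, smul_eq_mul, mul_assoc] using h2.mul h

/-- The homogeneous field cut off to an annulus of radius `R`. -/
def annulusField (α R : ℝ) (v : UnitCircle → Plane) (x : Plane) : Plane :=
  annulusCutoff (R⁻¹ • x) • homogeneousField α v x

theorem norm_annulusField_le (α R : ℝ) (v : UnitCircle → Plane) (x : Plane) :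
    ‖annulusField α R v x‖ ≤ ‖homogeneousField α v x‖ := by
  rw [annulusField, norm_smul, Real.norm_of_nonneg (annulusCutoff_nonneg _)]
  exact mul_le_of_le_one_left (norm_nonneg _) (annulusCutoff_le_one _)

theorem norm_homogeneousField_sub_annulusField_le (α R : ℝ) (v : UnitCircle → Plane) (x : Plane) :
    ‖homogeneousField α v x - annulusField α R v x‖ ≤ ‖homogeneousField α v x‖ := by
  have : homogeneousField α v x - annulusField α R v x =
      (1 - annulusCutoff (R⁻¹ • x)) • homogeneousField α v x := by
    rw [annulusField, sub_smul, one_smul]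
  rw [this, norm_smul, Real.norm_of_nonneg (sub_nonneg.2 (annulusCutoff_le_one _))]
  exact mul_le_of_le_one_left (norm_nonneg _) (by linarith [annulusCutoff_nonneg (R⁻¹ • x)])

theorem annulusField_eq {R : ℝ} (hR : 0 < R) (α : ℝ) (v : UnitCircle → Plane) (x : Plane) :
    annulusField α R v x = R ^ (1 - 2 * α) • ((annulusCutoff (R⁻¹ • x) *
      ‖R⁻¹ • x‖ ^ (1 - 2 * α)) • v (direction (R⁻¹ • x))) := by
  by_cases hx : x = 0
  · rw [annulusField, hx, annulusCutoff_eq_zero_of_le (by simp)]; simp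
  · rw [annulusField, homogeneousField_eq α v hx, direction_smul (inv_pos.2 hR),
      norm_smul_rpow (inv_pos.2 hR), smul_smul, smul_smul, Real.inv_rpow hR.le]
    congr 1
    have : R ^ (1 - 2 * α) ≠ 0 := (Real.rpow_pos_of_pos hR _).ne'
    field_simp

theorem hasCompactSupport_annulusField {R : ℝ} (hR : 0 < R) (α : ℝ) (v : UnitCircle → Plane) :
    HasCompactSupport (annulusField α R v) := by
  refine HasCompactSupport.intro (isCompact_closedBall (0 : Plane) (4 * R)) fun x hx => ?_
  rw [annulusField, annulusCutoff_eq_zero_of_ge, zero_smul]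
  rw [mem_closedBall_zero_iff, not_le] at hx
  rw [norm_smul_pos (inv_pos.2 hR), ← div_eq_inv_mul, le_div_iff₀ hR]
  exact hx.le

/-- By homogeneity the piece at radius R is R^{1-2α} times the dilate of the piece at radius 1. Each
derivative costs R⁻¹ and the Hölder seminorm costs R^{-β}. -/
theorem exists_annulusField_le {β : ℝ} (hβ : 0 < β) (hβ' : β ≤ 1) (m : ℕ) (M : ℝ≥0) (α : ℝ) :
    ∃ C : ℝ, 0 ≤ C ∧ ∀ v : UnitCircle → Plane, HolderBound m β M v → ∀ R : ℝ, 0 < R →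
      ContDiff ℝ m (annulusField α R v) ∧
      (∀ x, ‖iteratedFDeriv ℝ m (annulusField α R v) x‖ ≤ C * R ^ (-(2 * α - 1 + m))) ∧
      ∀ x y, ‖iteratedFDeriv ℝ m (annulusField α R v) x -
        iteratedFDeriv ℝ m (annulusField α R v) y‖ ≤
          C * R ^ (-(2 * α - 1 + m + β)) * ‖x - y‖ ^ β := by
  have hφ := contDiff_annulusCutoff_mul_norm_rpow (1 - 2 * α)
  obtain ⟨C, hC0, hC⟩ := exists_holder_clm_direction hβ hβ' m M
    (fun x => (annulusCutoff x * ‖x‖ ^ (1 - 2 * α)) • ContinuousLinearMap.id ℝ Plane)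
    (hφ.smul contDiff_const)
    (HasCompactSupport.intro (isCompact_closedBall (0 : Plane) 4) fun x hx => by
      rw [mem_closedBall_zero_iff, not_le] at hx
      rw [annulusCutoff_eq_zero_of_ge hx.le, zero_mul]; exact zero_smul ℝ _)
    (fun x hx => by rw [annulusCutoff_eq_zero_of_le hx.le, zero_mul]; exact zero_smul ℝ _)
  refine ⟨C, hC0, fun v hv R hR => ?_⟩
  obtain ⟨h1, h2, h3⟩ := hC v hv
  set w : Plane → Plane := fun x => ((annulusCutoff x * ‖x‖ ^ (1 - 2 * α)) •
    ContinuousLinearMap.id ℝ Plane) (v (direction x)) with hw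
  have heq : annulusField α R v = fun x => R ^ (1 - 2 * α) • w (R⁻¹ • x) := by
    funext x
    rw [annulusField_eq hR]
    rfl
  have hcd : ContDiff ℝ m fun x => w (R⁻¹ • x) := h1.comp (by fun_prop)
  have hD : ∀ x, iteratedFDeriv ℝ m (annulusField α R v) x =
      (R ^ (1 - 2 * α) * R⁻¹ ^ m) • iteratedFDeriv ℝ m w (R⁻¹ • x) := fun x => by
    rw [heq, iteratedFDeriv_const_smul_apply' hcd.contDiffAt,
      iteratedFDeriv_comp_smul_of_ne_zero (inv_ne_zero hR.ne'), smul_smul]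
  have hpow : R ^ (1 - 2 * α) * R⁻¹ ^ m = R ^ (-(2 * α - 1 + m)) := by
    rw [inv_pow, ← Real.rpow_natCast, ← Real.rpow_neg hR.le, ← Real.rpow_add hR]
    congr 1; ring
  refine ⟨heq ▸ hcd.const_smul _, fun x => ?_, fun x y => ?_⟩
  · rw [hD, hpow, norm_smul, Real.norm_of_nonneg (by positivity), mul_comm]
    gcongr
    exact h2 _
  · rw [hD, hD, hpow, ← smul_sub, norm_smul, Real.norm_of_nonneg (by positivity)]
    calc _ ≤ R ^ (-(2 * α - 1 + m)) * (C * ‖R⁻¹ • x - R⁻¹ • y‖ ^ β) := by gcongr; exact h3 _ _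
      _ = C * (R ^ (-(2 * α - 1 + m)) * R ^ (-β)) * ‖x - y‖ ^ β := by
        rw [← smul_sub, norm_smul_rpow (inv_pos.2 hR), Real.inv_rpow hR.le, Real.rpow_neg hR.le β]
        ring
      _ = _ := by
        rw [← Real.rpow_add hR]
        congr 3; ring

end Annulus

/-! ### Decay of the derivatives of the flow. -/

section HeatFlowDecay

variable {α β : ℝ}

theorem decayingKernel_heatKernel (hα : 1 / 2 < α) : DecayingKernel (heatKernel α) :=
  ⟨contDiff_heatKernel hα, exists_iteratedFDeriv_heatKernel_le hα⟩

theorem HolderBound.integrable_heatKernel_smul (hα : 1 / 2 < α) (hα' : α < 1) (hβ : 0 < β)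
    (hβ' : β ≤ 1) {m : ℕ} {M : ℝ≥0} {v : UnitCircle → Plane} (hv : HolderBound m β M v)
    (x : Plane) : Integrable fun y => heatKernel α (x - y) • homogeneousField α v y := by
  have hu := hv.aestronglyMeasurable_homogeneousField hβ hβ' α
  exact (decayingKernel_heatKernel hα).integrable_smul hu x
    (integrable_weight_mul_of_le hu (by linarith) (by linarith) (hv.norm_homogeneousField_le α) x)

theorem HolderBound.contDiff_heatFlow (hα : 1 / 2 < α) (hα' : α < 1) (hβ : 0 < β)
    (hβ' : β ≤ 1) {m : ℕ} {M : ℝ≥0} {v : UnitCircle → Plane} (hv : HolderBound m β M v) :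
    ContDiff ℝ ∞ (heatFlow α (homogeneousField α v)) :=
  (decayingKernel_heatKernel hα).contDiff_convolution
    (hv.aestronglyMeasurable_homogeneousField hβ hβ' α) (by linarith) (by linarith)
    (hv.norm_homogeneousField_le α)

theorem exists_iteratedFDeriv_heatFlow_le (hα : 1 / 2 < α) (hα' : α < 1) (hβ : 0 < β)
    (hβ' : β ≤ 1) (M : ℝ≥0) (k : ℕ) :
    ∃ C : ℝ, 0 ≤ C ∧ ∀ (m : ℕ) (v : UnitCircle → Plane), HolderBound m β M v → ∀ x,
      ‖iteratedFDeriv ℝ k (heatFlow α (homogeneousField α v)) x‖ ≤ C := by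
  obtain ⟨C, hC0, hC⟩ := (decayingKernel_heatKernel hα).exists_iteratedFDeriv_le
    (a := 2 * α - 1) (by linarith) (by linarith) k
  exact ⟨C * M, by positivity, fun m v hv => hC _ M M.2
    (hv.aestronglyMeasurable_homogeneousField hβ hβ' α) (hv.norm_homogeneousField_le α)⟩

/-- The part of the flow that comes from outside the annulus of radius `R`. -/
def farFlow (α R : ℝ) (v : UnitCircle → Plane) (x : Plane) : Plane :=
  ∫ y, heatKernel α (x - y) • (homogeneousField α v y - annulusField α R v y)

theorem HolderBound.continuous_annulusField (hβ : 0 < β) (hβ' : β ≤ 1) {m : ℕ} {M : ℝ≥0}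
    {v : UnitCircle → Plane} (hv : HolderBound m β M v) (α : ℝ) {R : ℝ} (hR : 0 < R) :
    Continuous (annulusField α R v) := by
  obtain ⟨C, hC0, hC⟩ := exists_annulusField_le hβ hβ' m M α
  exact (hC v hv R hR).1.continuous

theorem HolderBound.contDiff_farFlow (hα : 1 / 2 < α) (hα' : α < 1) (hβ : 0 < β)
    (hβ' : β ≤ 1) {m : ℕ} {M : ℝ≥0} {v : UnitCircle → Plane} (hv : HolderBound m β M v)
    {R : ℝ} (hR : 0 < R) : ContDiff ℝ ∞ (farFlow α R v) :=
  (decayingKernel_heatKernel hα).contDiff_convolution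
    ((hv.aestronglyMeasurable_homogeneousField hβ hβ' α).sub
      (hv.continuous_annulusField hβ hβ' α hR).aestronglyMeasurable)
    (a := 2 * α - 1) (by linarith) (by linarith) fun y =>
      (norm_homogeneousField_sub_annulusField_le α R v y).trans (hv.norm_homogeneousField_le α y)

theorem HolderBound.iteratedFDeriv_heatFlow_eq (hα : 1 / 2 < α) (hα' : α < 1) (hβ : 0 < β)
    (hβ' : β ≤ 1) {m : ℕ} {M : ℝ≥0} {v : UnitCircle → Plane} (hv : HolderBound m β M v)
    {R : ℝ} (hR : 0 < R) (k : ℕ) (x : Plane) :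
    iteratedFDeriv ℝ k (heatFlow α (homogeneousField α v)) x =
      iteratedFDeriv ℝ k (heatFlow α (annulusField α R v)) x +
        iteratedFDeriv ℝ k (farFlow α R v) x := by
  have hK := decayingKernel_heatKernel hα
  have ha : 0 ≤ 2 * α - 1 := by linarith
  have ha' : 2 * α - 1 < 2 := by linarith
  have hw := (hv.continuous_annulusField hβ hβ' α hR).aestronglyMeasurable (μ := volume)
  have hwb : ∀ y, ‖annulusField α R v y‖ ≤ M * ‖y‖ ^ (-(2 * α - 1)) := fun y =>
    (norm_annulusField_le α R v y).trans (hv.norm_homogeneousField_le α y)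
  have hr := (hv.aestronglyMeasurable_homogeneousField hβ hβ' α).sub hw
  have hrb : ∀ y, ‖homogeneousField α v y - annulusField α R v y‖ ≤
      M * ‖y‖ ^ (-(2 * α - 1)) := fun y =>
    (norm_homogeneousField_sub_annulusField_le α R v y).trans (hv.norm_homogeneousField_le α y)
  have hsum : heatFlow α (homogeneousField α v) =
      heatFlow α (annulusField α R v) + farFlow α R v := by
    funext x
    have h1 := hK.integrable_smul hw x (integrable_weight_mul_of_le hw ha ha' hwb x)
    have h2 : Integrable fun y =>
        heatKernel α (x - y) • (homogeneousField α v y - annulusField α R v y) :=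
      hK.integrable_smul hr x (integrable_weight_mul_of_le hr ha ha' hrb x)
    rw [Pi.add_apply, heatFlow, heatFlow, farFlow, ← integral_add h1 h2]
    congr 1
    funext y
    simp [smul_sub]
  have hd1 : ContDiff ℝ ∞ (heatFlow α (annulusField α R v)) :=
    hK.contDiff_convolution hw ha ha' hwb
  have hd2 := hv.contDiff_farFlow hα hα' hβ hβ' hR
  rw [hsum, iteratedFDeriv_add_apply]
  · exact (hd1.of_le (by exact_mod_cast le_top)).contDiffAt
  · exact (hd2.of_le (by exact_mod_cast le_top)).contDiffAt

/-- The cutoff is 1 for R/4 ≤ |y| ≤ 2R. The ball of radius R/4 about any x with 3R/4 ≤ |x| ≤ 5R/4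
lies in that range, so the field vanishes there. The range of |x|, rather than |x| = R, leaves room
for mean value arguments around a point of norm R. -/
theorem exists_iteratedFDeriv_farFlow_le (hα : 1 / 2 < α) (hα' : α < 1) (hβ : 0 < β)
    (hβ' : β ≤ 1) (M : ℝ≥0) (k : ℕ) :
    ∃ C : ℝ, 0 ≤ C ∧ ∀ (m : ℕ) (v : UnitCircle → Plane), HolderBound m β M v → ∀ R : ℝ, 0 < R →
      ∀ x, 3 / 4 * R ≤ ‖x‖ → ‖x‖ ≤ 5 / 4 * R →
      ‖iteratedFDeriv ℝ k (farFlow α R v) x‖ ≤ C * R ^ (-(2 * α - 1 + k + 1)) := by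
  obtain ⟨C, hC0, hC⟩ := (decayingKernel_heatKernel hα).exists_iteratedFDeriv_far_le
    (a := 2 * α - 1) (by linarith) (by linarith) k
  refine ⟨C * M, by positivity, fun m v hv R hR x hx hx' => hC _ M M.2
    ((hv.aestronglyMeasurable_homogeneousField hβ hβ' α).sub
      (hv.continuous_annulusField hβ hβ' α hR).aestronglyMeasurable)
    (fun y => (norm_homogeneousField_sub_annulusField_le α R v y).trans
      (hv.norm_homogeneousField_le α y)) R hR x fun y hy => ?_⟩
  have h1 := norm_sub_norm_le x y
  have h2 := norm_sub_norm_le y x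
  rw [norm_sub_rev] at h2
  simp only [Pi.sub_apply]
  rw [annulusField, annulusCutoff_eq_one, one_smul, sub_self]
  · rw [norm_smul_pos (inv_pos.2 hR), ← div_eq_inv_mul, le_div_iff₀ hR]; linarith
  · rw [norm_smul_pos (inv_pos.2 hR), ← div_eq_inv_mul, div_le_iff₀ hR]; linarith

theorem exists_iteratedFDeriv_heatFlow_le_of_norm (hα : 1 / 2 < α) (hα' : α < 1) (hβ : 0 < β)
    (hβ' : β ≤ 1) (m : ℕ) (M : ℝ≥0) :
    ∃ C : ℝ, 0 ≤ C ∧ ∀ v : UnitCircle → Plane, HolderBound m β M v → ∀ R : ℝ, 1 ≤ R →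
      ∀ x, 3 / 4 * R ≤ ‖x‖ → ‖x‖ ≤ 5 / 4 * R →
      ‖iteratedFDeriv ℝ m (heatFlow α (homogeneousField α v)) x‖ ≤
        C * R ^ (-(2 * α - 1 + m)) := by
  obtain ⟨A, hA0, hA⟩ := exists_annulusField_le hβ hβ' m M α
  obtain ⟨B, hB0, hB⟩ := (decayingKernel_heatKernel hα).exists_holder_convolution_le hβ hβ' 0
  obtain ⟨D, hD0, hD⟩ := exists_iteratedFDeriv_farFlow_le hα hα' hβ hβ' M m
  refine ⟨B * A + D, by positivity, fun v hv R hR x hx hx' => ?_⟩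
  have hR0 : 0 < R := by linarith
  obtain ⟨a1, a2, a3⟩ := hA v hv R hR0
  have h1 := (hB m _ _ _ a1 (hasCompactSupport_annulusField hR0 α v) a2 a3).1 x
  rw [hv.iteratedFDeriv_heatFlow_eq hα hα' hβ hβ' hR0]
  calc _ ≤ B * (A * R ^ (-(2 * α - 1 + m))) + D * R ^ (-(2 * α - 1 + m + 1)) :=
        (norm_add_le _ _).trans (add_le_add h1 (hD m v hv R hR0 x hx hx'))
    _ ≤ B * (A * R ^ (-(2 * α - 1 + m))) + D * R ^ (-(2 * α - 1 + m)) := by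
        have := Real.rpow_le_rpow_of_exponent_le hR
          (show -(2 * α - 1 + (m:ℝ) + 1) ≤ -(2 * α - 1 + m) by linarith)
        gcongr
    _ = _ := by ring

/-- Beyond order m all excess derivatives fall on the kernel at no gain in R, so the annular part
stops improving at m+β. The far part decays with exponent k+1 ≥ m+β, hence is harmless. -/
theorem exists_iteratedFDeriv_heatFlow_le_of_lt (hα : 1 / 2 < α) (hα' : α < 1) (hβ : 0 < β)
    (hβ' : β ≤ 1) {m k : ℕ} (hk : m < k) (M : ℝ≥0) :
    ∃ C : ℝ, 0 ≤ C ∧ ∀ v : UnitCircle → Plane, HolderBound m β M v → ∀ R : ℝ, 1 ≤ R →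
      ∀ x, 3 / 4 * R ≤ ‖x‖ → ‖x‖ ≤ 5 / 4 * R →
      ‖iteratedFDeriv ℝ k (heatFlow α (homogeneousField α v)) x‖ ≤
        C * R ^ (-(2 * α - 1 + m + β)) := by
  obtain ⟨j, rfl⟩ := Nat.exists_eq_add_of_lt hk
  obtain ⟨A, hA0, hA⟩ := exists_annulusField_le hβ hβ' m M α
  obtain ⟨B, hB0, hB⟩ :=
    (decayingKernel_heatKernel hα).exists_holder_convolution_le hβ hβ' (j + 1)
  obtain ⟨D, hD0, hD⟩ := exists_iteratedFDeriv_farFlow_le hα hα' hβ hβ' M (m + j + 1)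
  refine ⟨B * A + D, by positivity, fun v hv R hR x hx hx' => ?_⟩
  have hR0 : 0 < R := by linarith
  obtain ⟨a1, a2, a3⟩ := hA v hv R hR0
  have h1 := (hB m _ _ _ a1 (hasCompactSupport_annulusField hR0 α v) a2 a3).2.2 (by omega) x
  rw [hv.iteratedFDeriv_heatFlow_eq hα hα' hβ hβ' hR0]
  calc _ ≤ B * (A * R ^ (-(2 * α - 1 + m + β))) +
          D * R ^ (-(2 * α - 1 + ((m + j + 1 : ℕ) : ℝ) + 1)) :=
        (norm_add_le _ _).trans (add_le_add h1 (hD m v hv R hR0 x hx hx'))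
    _ ≤ B * (A * R ^ (-(2 * α - 1 + m + β))) + D * R ^ (-(2 * α - 1 + m + β)) := by
        have := Real.rpow_le_rpow_of_exponent_le hR
          (show -(2 * α - 1 + ((m + j + 1 : ℕ) : ℝ) + 1) ≤ -(2 * α - 1 + m + β) by
            push_cast
            have : (0:ℝ) ≤ j := j.cast_nonneg
            linarith)
        gcongr
    _ = _ := by ring

/-- The annular part inherits the Hölder seminorm of the field. The far part is Lipschitz on the
ball of radius |x|/4, and there |x-x'| ≤ |x|^{1-β}|x-x'|^β turns Lipschitz into Hölder. -/
theorem exists_iteratedFDeriv_heatFlow_sub_le (hα : 1 / 2 < α) (hα' : α < 1) (hβ : 0 < β)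
    (hβ' : β ≤ 1) (m : ℕ) (M : ℝ≥0) :
    ∃ C : ℝ, 0 ≤ C ∧ ∀ v : UnitCircle → Plane, HolderBound m β M v → ∀ x, 1 ≤ ‖x‖ →
      ∀ x', ‖x - x'‖ ≤ ‖x‖ / 4 →
      ‖iteratedFDeriv ℝ m (heatFlow α (homogeneousField α v)) x -
        iteratedFDeriv ℝ m (heatFlow α (homogeneousField α v)) x'‖ ≤
        C * ‖x‖ ^ (-(2 * α - 1 + m + β)) * ‖x - x'‖ ^ β := by
  obtain ⟨A, hA0, hA⟩ := exists_annulusField_le hβ hβ' m M α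
  obtain ⟨B, hB0, hB⟩ := (decayingKernel_heatKernel hα).exists_holder_convolution_le hβ hβ' 0
  obtain ⟨D, hD0, hD⟩ := exists_iteratedFDeriv_farFlow_le hα hα' hβ hβ' M (m + 1)
  refine ⟨B * A + D, by positivity, fun v hv x hR x' hx' => ?_⟩
  set R := ‖x‖ with hRdef
  have hR0 : 0 < R := by linarith
  obtain ⟨a1, a2, a3⟩ := hA v hv R hR0
  have h1 := (hB m _ _ _ a1 (hasCompactSupport_annulusField hR0 α v) a2 a3).2.1 x x'
  have h2 : ‖iteratedFDeriv ℝ m (farFlow α R v) x - iteratedFDeriv ℝ m (farFlow α R v) x'‖ ≤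
      D * R ^ (-(2 * α - 1 + ((m + 1 : ℕ) : ℝ) + 1)) * ‖x - x'‖ := by
    have hcd := hv.contDiff_farFlow hα hα' hβ hβ' hR0
    refine (convex_closedBall x (R / 4)).norm_image_sub_le_of_norm_fderiv_le (𝕜 := ℝ)
      (fun z _ => (hcd.differentiable_iteratedFDeriv (m := m)
        (by exact_mod_cast ENat.natCast_lt_top m)).differentiableAt) (fun z hz => ?_)
      (by rwa [mem_closedBall_iff_norm']) (Metric.mem_closedBall_self (by positivity))
    rw [norm_fderiv_iteratedFDeriv]
    rw [mem_closedBall_iff_norm'] at hz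
    have h1 := norm_sub_norm_le x z
    have h2 := norm_sub_norm_le z x
    rw [norm_sub_rev] at h2
    exact hD m v hv R hR0 z (by linarith) (by linarith)
  have h3 : ‖x - x'‖ ≤ R ^ (1 - β) * ‖x - x'‖ ^ β := by
    rcases (norm_nonneg (x - x')).eq_or_lt with h | h
    · rw [← h]; positivity
    calc ‖x - x'‖ = ‖x - x'‖ ^ (1 - β) * ‖x - x'‖ ^ β := by
          rw [← Real.rpow_add h]; simp
      _ ≤ _ := by
        gcongr
        · linarith
  rw [hv.iteratedFDeriv_heatFlow_eq hα hα' hβ hβ' hR0,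
    hv.iteratedFDeriv_heatFlow_eq hα hα' hβ hβ' hR0, add_sub_add_comm]
  calc _ ≤ B * (A * R ^ (-(2 * α - 1 + m + β))) * ‖x - x'‖ ^ β +
          D * R ^ (-(2 * α - 1 + ((m + 1 : ℕ) : ℝ) + 1)) * ‖x - x'‖ :=
        (norm_add_le _ _).trans (add_le_add h1 h2)
    _ ≤ B * (A * R ^ (-(2 * α - 1 + m + β))) * ‖x - x'‖ ^ β +
          D * R ^ (-(2 * α - 1 + ((m + 1 : ℕ) : ℝ) + 1)) * (R ^ (1 - β) * ‖x - x'‖ ^ β) := by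
        gcongr
    _ = B * (A * R ^ (-(2 * α - 1 + m + β))) * ‖x - x'‖ ^ β +
          D * R ^ (-(2 * α - 1 + m + β + 1)) * ‖x - x'‖ ^ β := by
        rw [mul_assoc D, ← mul_assoc (R ^ _) (R ^ _), ← Real.rpow_add hR0, mul_assoc D]
        congr 4; push_cast; ring
    _ ≤ B * (A * R ^ (-(2 * α - 1 + m + β))) * ‖x - x'‖ ^ β +
          D * R ^ (-(2 * α - 1 + m + β)) * ‖x - x'‖ ^ β := by
        have := Real.rpow_le_rpow_of_exponent_le hR
          (show -(2 * α - 1 + (m:ℝ) + β + 1) ≤ -(2 * α - 1 + m + β) by linarith)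
        gcongr
    _ = _ := by ring

theorem rpow_neg_norm_le {s : ℝ} (hs : 0 ≤ s) {t : ℝ} (ht : 1 ≤ t) :
    t ^ (-s) ≤ 2 ^ s / (1 + t) ^ s := by
  rw [le_div_iff₀ (by positivity), Real.rpow_neg (by linarith), ← div_eq_inv_mul,
    div_le_iff₀ (by positivity), ← Real.mul_rpow (by norm_num) (by linarith)]
  exact Real.rpow_le_rpow (by linarith) (by linarith) hs

/-- A bounded quantity that decays at infinity satisfies a global weighted bound. -/
theorem le_div_one_add_norm_rpow {s : ℝ} (hs : 0 ≤ s) {C D b : ℝ} (hC : 0 ≤ C) (hD : 0 ≤ D)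
    {x : Plane} (h : b ≤ C) (h' : 1 ≤ ‖x‖ → b ≤ D * ‖x‖ ^ (-s)) :
    b ≤ (C + D) * 2 ^ s / (1 + ‖x‖) ^ s := by
  rcases le_or_gt ‖x‖ 1 with hx | hx
  · rw [le_div_iff₀ (by positivity)]
    calc b * (1 + ‖x‖) ^ s ≤ (C + D) * (1 + ‖x‖) ^ s := by gcongr; linarith
      _ ≤ (C + D) * 2 ^ s := by gcongr; linarith
  · calc b ≤ D * ‖x‖ ^ (-s) := h' hx.le
      _ ≤ (C + D) * (2 ^ s / (1 + ‖x‖) ^ s) := by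
        gcongr
        · linarith
        · exact rpow_neg_norm_le hs hx.le
      _ = _ := by ring

/-- The constants must not depend on m. The cases m ≤ k are finitely many, and each m > k follows
from the case m = k with 3M, because the decay rate no longer changes once m reaches k. -/
theorem exists_bound_of_forall_le {P : ℕ → ℝ≥0 → (UnitCircle → Plane) → ℝ → Prop} {β : ℝ}
    (hβ : 0 < β) (hβ' : β ≤ 1) (M : ℝ≥0) (k : ℕ)
    (hmono : ∀ m N v C C', C ≤ C' → P m N v C → P m N v C')
    (hlt : ∀ m v C, k < m → P k (3 * M) v C → P m M v C)
    (h : ∀ m, m ≤ k → ∀ N : ℝ≥0, ∃ C : ℝ, ∀ v, HolderBound m β N v → P m N v C) :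
    ∃ C : ℝ, ∀ m v, HolderBound m β M v → P m M v C := by
  choose! c hc using h
  refine ⟨∑ m ∈ Finset.range (k + 1), |c m M| + |c k (3 * M)|, fun m v hv => ?_⟩
  rcases le_or_gt m k with hm | hm
  · refine hmono _ _ _ _ _ ?_ (hc m hm M v hv)
    have := Finset.single_le_sum (f := fun m => |c m M|) (fun i _ => abs_nonneg _)
      (Finset.mem_range.2 (Nat.lt_succ_of_le hm))
    linarith [le_abs_self (c m M), abs_nonneg (c k (3 * M))]
  · refine hlt m v _ hm (hmono _ _ _ _ _ ?_ (hc k le_rfl (3 * M) v (hv.of_lt hm hβ hβ')))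
    have := Finset.sum_nonneg (s := Finset.range (k + 1)) (f := fun m => |c m M|)
      fun i _ => abs_nonneg _
    linarith [le_abs_self (c k (3 * M))]

theorem exists_iteratedFDeriv_heatFlow_decay (hα : 1 / 2 < α) (hα' : α < 1) (hβ : 0 < β)
    (hβ' : β ≤ 1) (M : ℝ≥0) (k : ℕ) :
    ∃ C : ℝ, ∀ (m : ℕ) (v : UnitCircle → Plane), HolderBound m β M v → ∀ x,
      ‖iteratedFDeriv ℝ k (heatFlow α (homogeneousField α v)) x‖ ≤
        C / (1 + ‖x‖) ^ (2 * α - 1 + min (k : ℝ) (m + β)) := by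
  refine exists_bound_of_forall_le (P := fun m N v C => ∀ x,
    ‖iteratedFDeriv ℝ k (heatFlow α (homogeneousField α v)) x‖ ≤
      C / (1 + ‖x‖) ^ (2 * α - 1 + min (k : ℝ) (m + β))) hβ hβ' M k ?_ ?_ ?_
  · intro m N v C C' hC h x
    exact (h x).trans (by gcongr)
  · intro m v C hm h x
    have : (k:ℝ) < m := by exact_mod_cast hm
    rw [min_eq_left (by linarith)]
    simpa only [min_eq_left (show (k:ℝ) ≤ k + β by linarith)] using h x
  · intro m hm N
    obtain ⟨C, hC0, hC⟩ := exists_iteratedFDeriv_heatFlow_le hα hα' hβ hβ' N k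
    have hs : 0 ≤ 2 * α - 1 + min (k : ℝ) (m + β) := by
      have : 0 ≤ min (k : ℝ) (m + β) := by positivity
      linarith
    -- Only |x| ≥ 1 remains; the uniform bound covers the unit ball, where the weight is comparable
    -- to 1.
    suffices h : ∃ D : ℝ, 0 ≤ D ∧ ∀ v, HolderBound m β N v → ∀ x, 1 ≤ ‖x‖ →
        ‖iteratedFDeriv ℝ k (heatFlow α (homogeneousField α v)) x‖ ≤
          D * ‖x‖ ^ (-(2 * α - 1 + min (k : ℝ) (m + β))) by
      obtain ⟨D, hD0, hD⟩ := h
      exact ⟨_, fun v hv x => le_div_one_add_norm_rpow hs hC0 hD0 (hC m v hv x) (hD v hv x)⟩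
    rcases hm.eq_or_lt with rfl | hm
    · obtain ⟨D, hD0, hD⟩ := exists_iteratedFDeriv_heatFlow_le_of_norm hα hα' hβ hβ' m N
      refine ⟨D, hD0, fun v hv x hx => ?_⟩
      rw [min_eq_left (by linarith)]
      exact hD v hv _ hx x (by linarith) (by linarith)
    · obtain ⟨D, hD0, hD⟩ := exists_iteratedFDeriv_heatFlow_le_of_lt hα hα' hβ hβ' hm N
      refine ⟨D, hD0, fun v hv x hx => ?_⟩
      have : (m:ℝ) + 1 ≤ k := by exact_mod_cast hm
      rw [min_eq_right (by linarith), ← add_assoc]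
      exact hD v hv _ hx x (by linarith) (by linarith)

end HeatFlowDecay

/-! ### The flow is divergence free. -/

section Divergence

variable {α β : ℝ}

/-- A cutoff away from the origin and from infinity; it tends to `1` off the origin. -/
def originCutoff (n : ℕ) (y : Plane) : ℝ :=
  (1 - originBump (((n:ℝ) + 1) • y)) * originBump (((n:ℝ) + 1)⁻¹ • y)

theorem contDiff_originBump_comp_smul (c : ℝ) : ContDiff ℝ ∞ fun y : Plane => originBump (c • y) :=
  originBump.contDiff.comp (by fun_prop)

theorem contDiff_originCutoff (n : ℕ) : ContDiff ℝ ∞ (originCutoff n) :=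
  (contDiff_const.sub (contDiff_originBump_comp_smul _)).mul (contDiff_originBump_comp_smul _)

theorem originCutoff_nonneg (n : ℕ) (y : Plane) : 0 ≤ originCutoff n y :=
  mul_nonneg (sub_nonneg.2 originBump.le_one) originBump.nonneg

theorem originCutoff_le_one (n : ℕ) (y : Plane) : originCutoff n y ≤ 1 :=
  mul_le_one₀ (by linarith [originBump.nonneg (x := ((n:ℝ) + 1) • y)]) originBump.nonneg
    originBump.le_one

theorem originCutoff_eq_zero_of_le {n : ℕ} {y : Plane} (h : ‖y‖ ≤ ((n:ℝ) + 1)⁻¹ / 8) :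
    originCutoff n y = 0 := by
  have hn : 0 < (n:ℝ) + 1 := by positivity
  rw [originCutoff, originBump_eq_one, sub_self, zero_mul]
  rw [norm_smul_pos hn]
  calc _ ≤ ((n:ℝ) + 1) * (((n:ℝ) + 1)⁻¹ / 8) := by gcongr
    _ = _ := by field_simp

theorem originCutoff_eq_zero_of_ge {n : ℕ} {y : Plane} (h : (n:ℝ) + 1 ≤ ‖y‖) :
    originCutoff n y = 0 := by
  have hn : 0 < (n:ℝ) + 1 := by positivity
  rw [originCutoff, originBump_eq_zero (x := ((n:ℝ) + 1)⁻¹ • y), mul_zero]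
  rw [norm_smul_pos (inv_pos.2 hn), ← div_eq_inv_mul, le_div_iff₀ hn]
  linarith

theorem eventually_originCutoff_eq_one {y : Plane} (hy : y ≠ 0) :
    ∀ᶠ n : ℕ in atTop, originCutoff n =ᶠ[𝓝 y] fun _ => 1 := by
  have hy0 : 0 < ‖y‖ := norm_pos_iff.2 hy
  have h1 : ∀ᶠ n : ℕ in atTop, 16 * ‖y‖ ≤ (n:ℝ) ∧ ‖y‖⁻¹ ≤ (n:ℝ) :=
    (tendsto_natCast_atTop_atTop.eventually_ge_atTop _).and
      (tendsto_natCast_atTop_atTop.eventually_ge_atTop _)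
  filter_upwards [h1] with n hn
  have hp : 0 < (n:ℝ) + 1 := by positivity
  filter_upwards [Metric.ball_mem_nhds y (half_pos hy0)] with z hz
  rw [mem_ball_iff_norm] at hz
  have hz1 := norm_sub_norm_le z y
  have hz2 := norm_sub_norm_le y z
  rw [norm_sub_rev] at hz2
  rw [originCutoff, originBump_eq_zero, originBump_eq_one]
  · norm_num
  · rw [norm_smul_pos (inv_pos.2 hp), ← div_eq_inv_mul, div_le_iff₀ hp]; linarith
  · rw [norm_smul_pos hp]
    have : ((n:ℝ) + 1) * (‖y‖ / 2) ≤ ((n:ℝ) + 1) * ‖z‖ := by gcongr; linarith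
    have h3 : 1 ≤ ((n:ℝ) + 1) * ‖y‖ := by
      calc 1 = ‖y‖⁻¹ * ‖y‖ := by field_simp
        _ ≤ _ := by gcongr; linarith [hn.2]
    linarith

/-- The quantity |y| |∇φ(y)| is invariant under dilation of φ, so one bound serves all scales `c`.
-/
theorem exists_norm_mul_fderiv_originBump_le :
    ∃ B : ℝ, 0 ≤ B ∧ ∀ (c : ℝ) (y : Plane),
      ‖y‖ * ‖fderiv ℝ (fun y : Plane => originBump (c • y)) y‖ ≤ B := by
  have hc : Continuous fun z : Plane => ‖z‖ * ‖fderiv ℝ originBump z‖ :=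
    continuous_norm.mul ((originBump.contDiff (n := 1)).continuous_fderiv (by norm_num)).norm
  have hs : HasCompactSupport fun z : Plane => ‖z‖ * ‖fderiv ℝ originBump z‖ :=
    (originBump.hasCompactSupport.fderiv ℝ).norm.mul_left
  obtain ⟨B, hB⟩ := hs.exists_bound_of_continuous hc
  refine ⟨|B|, abs_nonneg B, fun c y => ?_⟩
  have hd : fderiv ℝ (fun y : Plane => originBump (c • y)) y =
      c • fderiv ℝ originBump (c • y) := fderiv_comp_smul c
  have := (hB (c • y)).trans (le_abs_self B)
  rw [Real.norm_of_nonneg (by positivity)] at this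
  rw [hd, norm_smul]
  rw [norm_smul] at this
  linarith

theorem exists_norm_mul_fderiv_originCutoff_le :
    ∃ B : ℝ, 0 ≤ B ∧ ∀ (n : ℕ) (y : Plane), ‖y‖ * ‖fderiv ℝ (originCutoff n) y‖ ≤ B := by
  obtain ⟨B, hB0, hB⟩ := exists_norm_mul_fderiv_originBump_le
  refine ⟨2 * B, by positivity, fun n y => ?_⟩
  have hd : ∀ c : ℝ, DifferentiableAt ℝ (fun y : Plane => originBump (c • y)) y := fun c =>
    ((contDiff_originBump_comp_smul c).differentiable (by simp)).differentiableAt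
  have h : fderiv ℝ (originCutoff n) y =
      (1 - originBump (((n:ℝ) + 1) • y)) •
        fderiv ℝ (fun y : Plane => originBump (((n:ℝ) + 1)⁻¹ • y)) y +
      originBump (((n:ℝ) + 1)⁻¹ • y) •
        (-fderiv ℝ (fun y : Plane => originBump (((n:ℝ) + 1) • y)) y) := by
    have h1 := ((hd ((n:ℝ) + 1)).hasFDerivAt.const_sub 1).mul (hd ((n:ℝ) + 1)⁻¹).hasFDerivAt
    exact h1.fderiv
  have ha := originBump.le_one (x := ((n:ℝ) + 1) • y)
  have ha' := originBump.nonneg (x := ((n:ℝ) + 1) • y)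
  have hb := originBump.le_one (x := ((n:ℝ) + 1)⁻¹ • y)
  have hb' := originBump.nonneg (x := ((n:ℝ) + 1)⁻¹ • y)
  rw [h]
  calc _ ≤ ‖y‖ * (1 * ‖fderiv ℝ (fun y : Plane => originBump (((n:ℝ) + 1)⁻¹ • y)) y‖ +
        1 * ‖fderiv ℝ (fun y : Plane => originBump (((n:ℝ) + 1) • y)) y‖) := by
        gcongr
        refine (norm_add_le _ _).trans ?_
        rw [norm_smul, norm_smul, norm_neg, Real.norm_of_nonneg (sub_nonneg.2 ha),
          Real.norm_of_nonneg hb']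
        gcongr
        linarith
    _ ≤ _ := by linarith [hB ((n:ℝ) + 1)⁻¹ y, hB ((n:ℝ) + 1) y]

/-- H(x-·) times `originCutoff n` is an admissible test function. As n grows, the cutoff is
eventually 1 near each y ≠ 0, so the terms with its gradient disappear and the rest tends to the
desired integral up to sign. -/
theorem HolderBound.integral_fderiv_heatKernel_eq_zero (hα : 1 / 2 < α) (hα' : α < 1)
    (hβ : 0 < β) (hβ' : β ≤ 1) {m : ℕ} {M : ℝ≥0} {v : UnitCircle → Plane}
    (hv : HolderBound m β M v) (hdiv : DivFreeOffOrigin (homogeneousField α v)) (x : Plane) :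
    ∫ y, fderiv ℝ (heatKernel α) (x - y) (homogeneousField α v y) = 0 := by
  set u := homogeneousField α v with hu
  have hum := hv.aestronglyMeasurable_homogeneousField hβ hβ' α
  have hub := hv.norm_homogeneousField_le α
  have hK := decayingKernel_heatKernel hα
  have hHs : ContDiff ℝ ∞ fun y => heatKernel α (x - y) := hK.1.comp (by fun_prop)
  obtain ⟨B, hB0, hB⟩ := exists_norm_mul_fderiv_originCutoff_le
  obtain ⟨C₀, hC₀⟩ := hK.bound 0
  obtain ⟨C₁, hC₁⟩ := hK.bound 1
  simp only [norm_iteratedFDeriv_zero] at hC₀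
  simp only [norm_iteratedFDeriv_one] at hC₁
  have hφs : ∀ n, ContDiff ℝ ∞ fun y => heatKernel α (x - y) * originCutoff n y := fun n =>
    hHs.mul (contDiff_originCutoff n)
  have hHd : ∀ y, HasFDerivAt (fun y => heatKernel α (x - y))
      (-fderiv ℝ (heatKernel α) (x - y)) y := fun y => by
    have h1 := ((hK.1.differentiable (by simp)) (x - y)).hasFDerivAt.comp y
      ((hasFDerivAt_id (𝕜 := ℝ) y).const_sub x)
    have h2 : -fderiv ℝ (heatKernel α) (x - y) =
        fderiv ℝ (heatKernel α) (x - y) ∘L (-ContinuousLinearMap.id ℝ Plane) := by ext; simp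
    rw [h2]
    exact h1
  have hφd : ∀ n y, fderiv ℝ (fun y => heatKernel α (x - y) * originCutoff n y) y =
      heatKernel α (x - y) • fderiv ℝ (originCutoff n) y +
        originCutoff n y • (-fderiv ℝ (heatKernel α) (x - y)) := fun n y =>
    ((hHd y).mul ((contDiff_originCutoff n).differentiable (by simp) y).hasFDerivAt).fderiv
  have h0 : ∀ n, ∫ y, fderiv ℝ (fun y => heatKernel α (x - y) * originCutoff n y) y (u y) = 0 := by
    intro n
    have hp : 0 < (n:ℝ) + 1 := by positivity
    refine hdiv _ (hφs n) ?_ ?_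
    · refine HasCompactSupport.intro (isCompact_closedBall (0 : Plane) ((n:ℝ) + 1)) fun y hy => ?_
      rw [mem_closedBall_zero_iff, not_le] at hy
      rw [originCutoff_eq_zero_of_ge hy.le, mul_zero]
    · rw [notMem_tsupport_iff_eventuallyEq]
      filter_upwards [Metric.ball_mem_nhds (0:Plane)
        (show 0 < ((n:ℝ) + 1)⁻¹ / 8 by positivity)] with y hy
      rw [mem_ball_zero_iff] at hy
      rw [originCutoff_eq_zero_of_le hy.le, mul_zero, Pi.zero_apply]
  have ht : Tendsto (fun n : ℕ => ∫ y, fderiv ℝ (fun y => heatKernel α (x - y) *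
      originCutoff n y) y (u y)) atTop (𝓝 (∫ y, (-fderiv ℝ (heatKernel α) (x - y)) (u y))) := by
    -- The first majorant controls the gradient of the cutoff: its bound B/|y| times |u| ≤
    -- M|y|^{-(2α-1)} is |y|^{-2α}, integrable near 0 exactly because α < 1. The second controls the
    -- gradient of the kernel.
    refine tendsto_integral_of_dominated_convergence
      (fun y => |C₀| * B * M * ((1 + ‖x - y‖) ^ (-(3:ℝ)) * ‖y‖ ^ (-(2 * α))) +
        |C₁| * M * ((1 + ‖x - y‖) ^ (-(3:ℝ)) * ‖y‖ ^ (-(2 * α - 1)))) ?_ ?_ ?_ ?_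
    · intro n
      have hc : Continuous (fderiv ℝ fun y => heatKernel α (x - y) * originCutoff n y) :=
        (hφs n).continuous_fderiv (by simp)
      exact (ContinuousLinearMap.apply ℝ ℝ (E := Plane)).aestronglyMeasurable_comp₂ hum
        hc.aestronglyMeasurable
    · exact ((integrable_one_add_norm_mul_norm_rpow (by norm_num) (by linarith) (by linarith)
        x).const_mul _).add ((integrable_one_add_norm_mul_norm_rpow (by norm_num) (by linarith)
        (by linarith) x).const_mul _)
    · intro n
      filter_upwards [compl_mem_ae_iff.2 (measure_singleton (0:Plane))] with y hy
      have hy0 : 0 < ‖y‖ := norm_pos_iff.2 hy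
      rw [hφd]
      have e1 : ‖fderiv ℝ (originCutoff n) y‖ * ‖u y‖ ≤ B * M * ‖y‖ ^ (-(2 * α)) := by
        have h1 : ‖fderiv ℝ (originCutoff n) y‖ ≤ B * ‖y‖⁻¹ := by
          rw [← div_eq_mul_inv, le_div_iff₀ hy0, mul_comm]; exact hB n y
        calc _ ≤ (B * ‖y‖⁻¹) * (M * ‖y‖ ^ (-(2 * α - 1))) := by gcongr; exact hub y
          _ = B * M * (‖y‖ ^ (-1:ℝ) * ‖y‖ ^ (-(2 * α - 1))) := by rw [Real.rpow_neg_one]; ring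
          _ = _ := by rw [← Real.rpow_add hy0]; congr 2; ring
      have e2 : ‖heatKernel α (x - y)‖ ≤ |C₀| * (1 + ‖x - y‖) ^ (-(3:ℝ)) :=
        (hC₀ _).trans (mul_le_mul_of_nonneg_right (le_abs_self _) (by positivity))
      have e3 : ‖fderiv ℝ (heatKernel α) (x - y)‖ ≤ |C₁| * (1 + ‖x - y‖) ^ (-(3:ℝ)) :=
        (hC₁ _).trans (mul_le_mul_of_nonneg_right (le_abs_self _) (by positivity))
      rw [add_apply, smul_apply, smul_apply]
      refine (norm_add_le _ _).trans (add_le_add ?_ ?_)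
      · rw [norm_smul]
        calc _ ≤ (|C₀| * (1 + ‖x - y‖) ^ (-(3:ℝ))) *
              (‖fderiv ℝ (originCutoff n) y‖ * ‖u y‖) := by
              gcongr; exact ContinuousLinearMap.le_opNorm _ _
          _ ≤ (|C₀| * (1 + ‖x - y‖) ^ (-(3:ℝ))) * (B * M * ‖y‖ ^ (-(2 * α))) := by gcongr
          _ = _ := by ring
      · rw [norm_smul, Real.norm_of_nonneg (originCutoff_nonneg n y)]
        calc _ ≤ 1 * (‖-fderiv ℝ (heatKernel α) (x - y)‖ * ‖u y‖) := by
              gcongr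
              · exact originCutoff_le_one n y
              · exact ContinuousLinearMap.le_opNorm _ _
          _ ≤ (|C₁| * (1 + ‖x - y‖) ^ (-(3:ℝ))) * (M * ‖y‖ ^ (-(2 * α - 1))) := by
              rw [one_mul, norm_neg]
              exact mul_le_mul e3 (hub y) (norm_nonneg _) (by positivity)
          _ = _ := by ring
    · filter_upwards [compl_mem_ae_iff.2 (measure_singleton (0:Plane))] with y hy
      refine tendsto_const_nhds.congr' ?_
      filter_upwards [eventually_originCutoff_eq_one hy] with n hn
      rw [hφd, hn.fderiv_eq, hn.eq_of_nhds]
      simp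
  have h2 : ∫ y, (-fderiv ℝ (heatKernel α) (x - y)) (u y) = 0 :=
    tendsto_nhds_unique ht (by simp only [h0]; exact tendsto_const_nhds)
  simpa only [neg_apply, integral_neg, neg_eq_zero] using h2

/-- Differentiating under the integral, the trace of ∇H(x-y) ⊗ u(y) is ∇H(x-y) applied to u(y),
whose integral vanishes. -/
theorem HolderBound.divergence_heatFlow (hα : 1 / 2 < α) (hα' : α < 1)
    (hβ : 0 < β) (hβ' : β ≤ 1) {m : ℕ} {M : ℝ≥0} {v : UnitCircle → Plane}
    (hv : HolderBound m β M v) (hdiv : DivFreeOffOrigin (homogeneousField α v)) (x : Plane) :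
    divergence (heatFlow α (homogeneousField α v)) x = 0 := by
  have hK := decayingKernel_heatKernel hα
  have hu := hv.aestronglyMeasurable_homogeneousField hβ hβ' α
  obtain ⟨-, hi, hD, -⟩ := contDiff_kernel_convolution hK.1 (s := 3) (by norm_num) hK.bound hu
    (integrable_weight_mul_of_le hu (by linarith) (by linarith) (hv.norm_homogeneousField_le α))
  have happ : ∀ y e, iteratedFDeriv ℝ 1 (fun x => heatKernel α (x - y) • homogeneousField α v y) x
      (fun _ => e) = fderiv ℝ (heatKernel α) (x - y) e • homogeneousField α v y := fun y e => by
    rw [iteratedFDeriv_sub_smul_const hK.1]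
    simp [iteratedFDeriv_one_apply]
  have hie : ∀ e, Integrable fun y =>
      fderiv ℝ (heatKernel α) (x - y) e • homogeneousField α v y := fun e => by
    have := (ContinuousMultilinearMap.apply ℝ (fun _ : Fin 1 => Plane) Plane
      (fun _ => e)).integrable_comp (hi 1 x)
    simpa only [ContinuousMultilinearMap.apply_apply, happ] using this
  have hfd : ∀ e, fderiv ℝ (heatFlow α (homogeneousField α v)) x e =
      ∫ y, fderiv ℝ (heatKernel α) (x - y) e • homogeneousField α v y := fun e => by
    have h1 : fderiv ℝ (heatFlow α (homogeneousField α v)) x e =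
        iteratedFDeriv ℝ 1 (heatFlow α (homogeneousField α v)) x (fun _ => e) := by
      rw [iteratedFDeriv_one_apply]
    have h2 := hD 1 x
    rw [h1]
    unfold heatFlow
    rw [h2]
    have := (ContinuousMultilinearMap.apply ℝ (fun _ : Fin 1 => Plane) Plane
      (fun _ => e)).integral_comp_comm (hi 1 x)
    simpa only [ContinuousMultilinearMap.apply_apply, happ] using this.symm
  unfold divergence
  simp only [hfd]
  have hcoord : ∀ i : Fin 2, (∫ y, fderiv ℝ (heatKernel α) (x - y) (EuclideanSpace.single i 1) •
      homogeneousField α v y) i = ∫ y, fderiv ℝ (heatKernel α) (x - y)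
        (EuclideanSpace.single i 1) * homogeneousField α v y i := fun i => by
    have := (EuclideanSpace.proj i : Plane →L[ℝ] ℝ).integral_comp_comm
      (hie (EuclideanSpace.single i 1))
    simpa using this.symm
  simp only [hcoord]
  rw [← integral_finsetSum]
  · rw [← hv.integral_fderiv_heatKernel_eq_zero hα hα' hβ hβ' hdiv x]
    congr 1
    funext y
    have hsum : homogeneousField α v y =
        ∑ i : Fin 2, homogeneousField α v y i • EuclideanSpace.single i (1:ℝ) := by
      ext j; fin_cases j <;> simp [Fin.sum_univ_two]
    conv_rhs => rw [hsum, map_sum]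
    simp only [map_smul, smul_eq_mul, mul_comm]
  · intro i _
    have := (EuclideanSpace.proj i : Plane →L[ℝ] ℝ).integrable_comp
      (hie (EuclideanSpace.single i 1))
    simpa using this

end Divergence

/-! ### The fractional Laplacian of a function with bounded derivatives. -/

section FractionalLaplacian

/-- A smooth function all of whose derivatives are bounded. -/
def BoundedDerivatives (f : Plane → Plane) : Prop :=
  ContDiff ℝ ∞ f ∧ ∀ k : ℕ, ∃ C : ℝ, 0 ≤ C ∧ ∀ x, ‖iteratedFDeriv ℝ k f x‖ ≤ C

variable {f : Plane → Plane} {γ : ℝ}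

theorem le_mul_min_one {b C D d : ℝ} (hC : 0 ≤ C) (hD : 0 ≤ D) (hd : 0 ≤ d)
    (h1 : b ≤ C) (h2 : b ≤ D * d) : b ≤ (C + D) * min 1 d := by
  rcases le_total 1 d with h | h
  · rw [min_eq_left h]; linarith
  · rw [min_eq_right h]
    have : 0 ≤ C * d := by positivity
    linarith

/-- Near 0 the factor |z| improves the singularity to |z|^{-1-γ}, integrable for γ < 1; at infinity
|z|^{-2-γ} is integrable for γ > 0. This is why no cancellation is needed in the principal value. -/
theorem integrable_norm_rpow_mul_min (hγ : 0 < γ) (hγ' : γ < 1) :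
    Integrable fun z : Plane => ‖z‖ ^ (-(2 + γ)) * min 1 ‖z‖ := by
  have h1 : Integrable ((Metric.ball (0 : Plane) 1).indicator fun z : Plane =>
      ‖z‖ ^ (-(1 + γ))) :=
    (integrable_indicator_iff measurableSet_ball).2 (integrableOn_norm_rpow_ball (by linarith))
  have h2 := (integrable_one_add_norm (E := Plane) (μ := volume) (r := 2 + γ)
    (by rw [finrank_euclideanSpace]; norm_num; exact hγ)).const_mul (2 ^ (2 + γ))
  refine (h1.add h2).mono' ?_ (Eventually.of_forall fun z => ?_)
  · exact ((measurable_norm.pow_const _).mul (measurable_const.min measurable_norm)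
      ).aestronglyMeasurable
  · rw [Real.norm_of_nonneg (by positivity), Pi.add_apply]
    rcases lt_or_ge ‖z‖ 1 with h | h
    · rw [Set.indicator_of_mem (by simpa using h), min_eq_right h.le]
      have : ‖z‖ ^ (-(2 + γ)) * ‖z‖ ≤ ‖z‖ ^ (-(1 + γ)) := by
        rcases (norm_nonneg z).eq_or_lt with h0 | h0
        · rw [← h0, mul_zero]; positivity
        · rw [← Real.rpow_add_one h0.ne']
          exact le_of_eq (by congr 1; ring)
      have h3 : 0 ≤ (2:ℝ) ^ (2 + γ) * (1 + ‖z‖) ^ (-(2 + γ)) := by positivity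
      linarith
    · rw [Set.indicator_of_notMem (by simpa using h), min_eq_left h, mul_one, zero_add]
      have := rpow_neg_norm_le (s := 2 + γ) (by linarith) h
      rwa [div_eq_mul_inv, ← Real.rpow_neg (by positivity)] at this

theorem BoundedDerivatives.exists_sub_le (hf : BoundedDerivatives f) (k : ℕ) :
    ∃ C : ℝ, 0 ≤ C ∧ ∀ x z, ‖iteratedFDeriv ℝ k f x - iteratedFDeriv ℝ k f (x - z)‖ ≤
      C * min 1 ‖z‖ := by
  obtain ⟨C, hC0, hC⟩ := hf.2 k
  obtain ⟨D, hD0, hD⟩ := hf.2 (k + 1)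
  refine ⟨2 * C + D, by positivity, fun x z => le_mul_min_one (by positivity) hD0
    (norm_nonneg z) ?_ ?_⟩
  · calc _ ≤ C + C := (norm_sub_le _ _).trans (add_le_add (hC _) (hC _))
      _ = 2 * C := by ring
  · have := convex_univ.norm_image_sub_le_of_norm_fderiv_le (𝕜 := ℝ) (f := iteratedFDeriv ℝ k f)
      (C := D) (fun y _ => (hf.1.differentiable_iteratedFDeriv (m := k)
        (by exact_mod_cast ENat.natCast_lt_top k)).differentiableAt)
      (fun y _ => by rw [norm_fderiv_iteratedFDeriv]; exact hD y)
      (Set.mem_univ (x - z)) (Set.mem_univ x)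
    simpa using this

theorem BoundedDerivatives.continuous_iteratedFDeriv (hf : BoundedDerivatives f) (k : ℕ) :
    Continuous (iteratedFDeriv ℝ k f) :=
  hf.1.continuous_iteratedFDeriv (m := k) (by exact_mod_cast le_top)

theorem BoundedDerivatives.aestronglyMeasurable_smul_sub (hf : BoundedDerivatives f) (k : ℕ)
    {w : Plane → ℝ} (hw : AEStronglyMeasurable w) (x : Plane) :
    AEStronglyMeasurable fun z : Plane =>
      w z • (iteratedFDeriv ℝ k f x - iteratedFDeriv ℝ k f (x - z)) :=
  hw.smul (continuous_const.sub
    ((hf.continuous_iteratedFDeriv k).comp (continuous_const.sub continuous_id))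
    ).aestronglyMeasurable

theorem aestronglyMeasurable_norm_rpow (p : ℝ) : AEStronglyMeasurable fun z : Plane => ‖z‖ ^ p :=
  (measurable_norm.pow_const p).aestronglyMeasurable

theorem BoundedDerivatives.integrable_smul_sub (hf : BoundedDerivatives f) (hγ : 0 < γ)
    (hγ' : γ < 1) (k : ℕ) (x : Plane) :
    Integrable fun z : Plane =>
      ‖z‖ ^ (-(2 + γ)) • (iteratedFDeriv ℝ k f x - iteratedFDeriv ℝ k f (x - z)) := by
  obtain ⟨C, hC0, hC⟩ := hf.exists_sub_le k
  refine ((integrable_norm_rpow_mul_min hγ hγ').const_mul C).mono'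
    (hf.aestronglyMeasurable_smul_sub k (aestronglyMeasurable_norm_rpow _) x)
    (Eventually.of_forall fun z => ?_)
  rw [norm_smul, Real.norm_of_nonneg (by positivity)]
  calc _ ≤ ‖z‖ ^ (-(2 + γ)) * (C * min 1 ‖z‖) := by gcongr; exact hC x z
    _ = _ := by ring

/-- The singular integral, as an absolutely convergent integral. -/
def differenceIntegral (γ : ℝ) (f : Plane → Plane) (x : Plane) : Plane :=
  ∫ z : Plane, ‖z‖ ^ (-(2 + γ)) • (f x - f (x - z))

theorem BoundedDerivatives.iteratedFDeriv_smul_sub (hf : BoundedDerivatives f) (c : ℝ) (k : ℕ)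
    (x z : Plane) : iteratedFDeriv ℝ k (fun x => c • (f x - f (x - z))) x =
      c • (iteratedFDeriv ℝ k f x - iteratedFDeriv ℝ k f (x - z)) := by
  have h1 : ContDiff ℝ k f := hf.1.of_le (by exact_mod_cast le_top)
  have h2 : ContDiff ℝ k fun x => f (x - z) := h1.comp (contDiff_id.sub contDiff_const)
  rw [iteratedFDeriv_const_smul_apply' (h1.sub h2).contDiffAt]
  congr 1
  have := iteratedFDeriv_sub_apply (x := x) h1.contDiffAt h2.contDiffAt
  rw [iteratedFDeriv_comp_sub] at this
  exact this

theorem BoundedDerivatives.contDiff_differenceIntegral (hf : BoundedDerivatives f) (hγ : 0 < γ)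
    (hγ' : γ < 1) : ContDiff ℝ ∞ (differenceIntegral γ f) ∧ ∀ k x,
      iteratedFDeriv ℝ k (differenceIntegral γ f) x =
        ∫ z : Plane, ‖z‖ ^ (-(2 + γ)) •
          (iteratedFDeriv ℝ k f x - iteratedFDeriv ℝ k f (x - z)) := by
  have h := contDiff_integral_of_dominated (μ := volume) (E := Plane) (F := Plane)
    (Φ := fun x z : Plane => ‖z‖ ^ (-(2 + γ)) • (f x - f (x - z))) (fun z =>
      (hf.1.sub (hf.1.comp (contDiff_id.sub contDiff_const))).const_smul _)
    (fun k x => by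
      simp only [hf.iteratedFDeriv_smul_sub]
      exact hf.aestronglyMeasurable_smul_sub k (aestronglyMeasurable_norm_rpow _) x)
    (fun k x₀ => by
      obtain ⟨C, hC0, hC⟩ := hf.exists_sub_le k
      refine ⟨_, (integrable_norm_rpow_mul_min hγ hγ').const_mul C, fun z x _ => ?_⟩
      rw [hf.iteratedFDeriv_smul_sub, norm_smul, Real.norm_of_nonneg (by positivity)]
      calc _ ≤ ‖z‖ ^ (-(2 + γ)) * (C * min 1 ‖z‖) := by gcongr; exact hC x z
        _ = _ := by ring)
  simp only [hf.iteratedFDeriv_smul_sub] at h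
  exact h

theorem fracIntegrand_eq (f : Plane → Plane) (x y : Plane) :
    fracIntegrand (γ / 2) f x y = ‖x - y‖ ^ (-(2 + γ)) • (f x - f (x - (x - y))) := by
  rw [fracIntegrand, sub_sub_cancel, Real.rpow_neg (norm_nonneg _)]
  congr 4; ring

theorem BoundedDerivatives.integrable_fracIntegrand (hf : BoundedDerivatives f) (hγ : 0 < γ)
    (hγ' : γ < 1) (x : Plane) : Integrable (fracIntegrand (γ / 2) f x) := by
  have h : Integrable fun z : Plane => ‖z‖ ^ (-(2 + γ)) • (f x - f (x - z)) := by
    refine (hf.integrable_smul_sub hγ hγ' 0 x).congr' ?_ (Eventually.of_forall fun z => ?_)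
    · exact (aestronglyMeasurable_norm_rpow _).smul (continuous_const.sub
        (hf.1.continuous.comp (continuous_const.sub continuous_id))).aestronglyMeasurable
    · rw [norm_smul, norm_smul]
      congr 1
      simp only [iteratedFDeriv_zero_eq_comp, Function.comp_apply]
      rw [← map_sub, LinearIsometryEquiv.norm_map]
  have h2 := h.comp_sub_left x
  exact h2.congr (Eventually.of_forall fun y => (fracIntegrand_eq f x y).symm)

theorem BoundedDerivatives.tendsto_fracLaplacianTrunc (hf : BoundedDerivatives f) (hγ : 0 < γ)
    (hγ' : γ < 1) (x : Plane) :
    Tendsto (fun ε => fracLaplacianTrunc (γ / 2) ε f x) (𝓝[>] (0 : ℝ))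
      (𝓝 (fracConst (γ / 2) • differenceIntegral γ f x)) := by
  have hi := hf.integrable_fracIntegrand hγ hγ' x
  have hS : ∀ ε : ℝ, MeasurableSet {y : Plane | ε < ‖x - y‖} := fun ε =>
    measurableSet_lt measurable_const (measurable_const.sub measurable_id).norm
  have heq : differenceIntegral γ f x = ∫ y, fracIntegrand (γ / 2) f x y := by
    simp only [fracIntegrand_eq]
    exact (integral_sub_left_eq_self (fun z : Plane => ‖z‖ ^ (-(2 + γ)) • (f x - f (x - z)))
      volume x).symm
  rw [heq]
  refine Tendsto.const_smul ?_ _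
  simp only [← integral_indicator (hS _)]
  refine tendsto_integral_filter_of_dominated_convergence (fun y => ‖fracIntegrand (γ / 2) f x y‖)
    (Eventually.of_forall fun ε => hi.1.indicator (hS ε))
    (Eventually.of_forall fun ε => Eventually.of_forall fun y => norm_indicator_le_norm_self _ _)
    hi.norm (Eventually.of_forall fun y => ?_)
  refine tendsto_const_nhds.congr' ?_
  by_cases hy : x = y
  · refine Eventually.of_forall fun ε => ?_
    have : fracIntegrand (γ / 2) f x y = 0 := by rw [fracIntegrand, hy, sub_self (f y), smul_zero]
    simp only [Set.indicator_apply, this, ite_self]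
  · have : 0 < ‖x - y‖ := norm_pos_iff.2 (sub_ne_zero.2 hy)
    filter_upwards [mem_nhdsWithin_of_mem_nhds (Iio_mem_nhds this)] with ε hε
    rw [Set.indicator_of_mem (show y ∈ {y : Plane | ε < ‖x - y‖} from hε)]

theorem BoundedDerivatives.fracLaplacianExists (hf : BoundedDerivatives f) (hγ : 0 < γ)
    (hγ' : γ < 1) (x : Plane) : FracLaplacianExists (γ / 2) f x :=
  ⟨fun _ _ => (hf.integrable_fracIntegrand hγ hγ' x).integrableOn,
    _, hf.tendsto_fracLaplacianTrunc hγ hγ' x⟩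

theorem BoundedDerivatives.fracLaplacian_eq (hf : BoundedDerivatives f) (hγ : 0 < γ)
    (hγ' : γ < 1) :
    fracLaplacian (γ / 2) f = fun x => fracConst (γ / 2) • differenceIntegral γ f x :=
  funext fun x => (hf.tendsto_fracLaplacianTrunc hγ hγ' x).limUnder_eq

theorem BoundedDerivatives.contDiff_fracLaplacian (hf : BoundedDerivatives f) (hγ : 0 < γ)
    (hγ' : γ < 1) : ContDiff ℝ ∞ (fracLaplacian (γ / 2) f) := by
  rw [hf.fracLaplacian_eq hγ hγ']
  exact (hf.contDiff_differenceIntegral hγ hγ').1.const_smul _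

theorem BoundedDerivatives.norm_iteratedFDeriv_fracLaplacian (hf : BoundedDerivatives f)
    (hγ : 0 < γ) (hγ' : γ < 1) (k : ℕ) (x : Plane) :
    ‖iteratedFDeriv ℝ k (fracLaplacian (γ / 2) f) x‖ = |fracConst (γ / 2)| *
      ‖∫ z : Plane, ‖z‖ ^ (-(2 + γ)) •
        (iteratedFDeriv ℝ k f x - iteratedFDeriv ℝ k f (x - z))‖ := by
  obtain ⟨h1, h2⟩ := hf.contDiff_differenceIntegral hγ hγ'
  rw [hf.fracLaplacian_eq hγ hγ', iteratedFDeriv_const_smul_apply'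
    (h1.of_le (by exact_mod_cast le_top)).contDiffAt, norm_smul, h2, Real.norm_eq_abs]

end FractionalLaplacian

/-! ### Splitting the singular kernel at scale R; the far part. -/

section FarKernel

variable {f : Plane → Plane} {γ : ℝ}

/-- The kernel of the fractional Laplacian, cut off from the ball of radius `R / 8`. -/
def farKernel (γ R : ℝ) (z : Plane) : ℝ := (1 - originBump (R⁻¹ • z)) * ‖z‖ ^ (-(2 + γ))

/-- The kernel of the fractional Laplacian, cut off to the ball of radius `R / 4`. -/
def nearKernel (γ R : ℝ) (z : Plane) : ℝ := originBump (R⁻¹ • z) * ‖z‖ ^ (-(2 + γ))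

theorem nearKernel_add_farKernel (γ R : ℝ) (z : Plane) :
    nearKernel γ R z + farKernel γ R z = ‖z‖ ^ (-(2 + γ)) := by
  rw [nearKernel, farKernel]; ring

theorem nearKernel_nonneg (γ R : ℝ) (z : Plane) : 0 ≤ nearKernel γ R z :=
  mul_nonneg originBump.nonneg (by positivity)

theorem nearKernel_le (γ R : ℝ) (z : Plane) : nearKernel γ R z ≤ ‖z‖ ^ (-(2 + γ)) :=
  mul_le_of_le_one_left (by positivity) originBump.le_one

theorem nearKernel_eq_zero {R : ℝ} (hR : 0 < R) {z : Plane} (hz : R / 4 ≤ ‖z‖) :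
    nearKernel γ R z = 0 := by
  rw [nearKernel, originBump_eq_zero, zero_mul]
  rw [norm_smul_pos (inv_pos.2 hR), ← div_eq_inv_mul, le_div_iff₀ hR]
  linarith

/-- The kernel at scale R is R^{-(2+γ)} times the dilate of the one at scale 1, which is smooth and
agrees with a homogeneous function away from the origin. -/
theorem exists_iteratedFDeriv_farKernel_le (hγ : 0 < γ) (k : ℕ) :
    ∃ C : ℝ, 0 ≤ C ∧ ∀ R : ℝ, 0 < R → ContDiff ℝ ∞ (farKernel γ R) ∧ ∀ z,
      ‖iteratedFDeriv ℝ k (farKernel γ R) z‖ ≤ C * (R + ‖z‖) ^ (-(2 + γ + k)) := by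
  have hs := contDiff_one_sub_originBump_smul (contDiffOn_norm_rpow (-(2 + γ)))
  obtain ⟨C, hC0, hC⟩ := exists_norm_iteratedFDeriv_one_sub_originBump_le (d := -(2 + γ))
    (by linarith) (contDiffOn_norm_rpow (-(2 + γ)))
    (fun t ht x _ => norm_smul_rpow ht _ x) k
  refine ⟨C, hC0, fun R hR => ?_⟩
  have hcd : ContDiff ℝ ∞ fun z : Plane => (1 - originBump (R⁻¹ • z)) •
      ‖R⁻¹ • z‖ ^ (-(2 + γ)) := hs.comp (g := fun x => (1 - originBump x) • ‖x‖ ^ (-(2 + γ)))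
        (f := fun z : Plane => R⁻¹ • z) (by fun_prop)
  have heq : farKernel γ R = fun z : Plane => R ^ (-(2 + γ)) • ((1 - originBump (R⁻¹ • z)) •
      ‖R⁻¹ • z‖ ^ (-(2 + γ))) := by
    funext z
    rw [farKernel, norm_smul_rpow (inv_pos.2 hR), Real.inv_rpow hR.le, smul_eq_mul, smul_eq_mul]
    have : R ^ (-(2 + γ)) ≠ 0 := (Real.rpow_pos_of_pos hR _).ne'
    field_simp
  refine ⟨heq ▸ hcd.const_smul _, fun z => ?_⟩
  rw [heq, iteratedFDeriv_const_smul_apply' (hcd.of_le (by exact_mod_cast le_top)).contDiffAt,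
    norm_smul, Real.norm_of_nonneg (by positivity),
    norm_iteratedFDeriv_comp_smul (inv_ne_zero hR.ne')
      (fun x => (1 - originBump x) • ‖x‖ ^ (-(2 + γ))), abs_of_pos (inv_pos.2 hR)]
  have h1 : (R + ‖z‖) ^ (-(2 + γ + k)) =
      R ^ (-(2 + γ)) * R⁻¹ ^ k * (1 + ‖R⁻¹ • z‖) ^ (-(2 + γ + k)) := by
    have := add_norm_rpow_smul hR (2 + γ + k) (R⁻¹ • z)
    rw [smul_inv_smul₀ hR.ne'] at this
    rw [this, neg_add, Real.rpow_add hR, Real.rpow_neg hR.le (k:ℝ), Real.rpow_natCast, inv_pow]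
  have h2 : -(2 + γ) - (k:ℝ) = -(2 + γ + k) := by ring
  have h3 := hC (R⁻¹ • z)
  rw [h2] at h3
  rw [h1]
  calc _ ≤ R ^ (-(2 + γ)) * (R⁻¹ ^ k * (C * (1 + ‖R⁻¹ • z‖) ^ (-(2 + γ + k)))) := by gcongr
    _ = _ := by ring

theorem contDiff_farKernel (hγ : 0 < γ) {R : ℝ} (hR : 0 < R) : ContDiff ℝ ∞ (farKernel γ R) := by
  obtain ⟨C, hC0, hC⟩ := exists_iteratedFDeriv_farKernel_le hγ 0
  exact (hC R hR).1

theorem farKernel_nonneg (γ R : ℝ) (z : Plane) : 0 ≤ farKernel γ R z :=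
  mul_nonneg (sub_nonneg.2 originBump.le_one) (by positivity)

theorem exists_integral_farKernel_le (hγ : 0 < γ) : ∃ C : ℝ, 0 ≤ C ∧ ∀ R : ℝ, 0 < R →
    Integrable (farKernel γ R) ∧ ∫ z, farKernel γ R z ≤ C * R ^ (-γ) := by
  obtain ⟨C, hC0, hC⟩ := exists_iteratedFDeriv_farKernel_le hγ 0
  obtain ⟨D, hD0, hD⟩ := exists_integral_add_norm_mul_norm_rpow_le (s := 2 + γ) (a := 0)
    (by linarith) le_rfl (by norm_num)
  refine ⟨C * D, by positivity, fun R hR => ?_⟩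
  have hi := (integrable_add_norm_mul_norm_rpow (s := 2 + γ) (a := 0) (by linarith) le_rfl
    (by norm_num) hR 0).const_mul C
  have hb : ∀ z, farKernel γ R z ≤ C * ((R + ‖0 - z‖) ^ (-(2 + γ)) * ‖z‖ ^ (-(0:ℝ))) := fun z => by
    have := (hC R hR).2 z
    rw [norm_iteratedFDeriv_zero, Real.norm_of_nonneg (farKernel_nonneg γ R z)] at this
    simpa using this
  have hint : Integrable (farKernel γ R) :=
    hi.mono' (contDiff_farKernel hγ hR).continuous.aestronglyMeasurable
      (Eventually.of_forall fun z => by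
        rw [Real.norm_of_nonneg (farKernel_nonneg γ R z)]; exact hb z)
  refine ⟨hint, ?_⟩
  calc _ ≤ ∫ z, C * ((R + ‖0 - z‖) ^ (-(2 + γ)) * ‖z‖ ^ (-(0:ℝ))) := integral_mono hint hi hb
    _ = C * ∫ z : Plane, (R + ‖0 - z‖) ^ (-(2 + γ)) * ‖z‖ ^ (-(0:ℝ)) := integral_const_mul _ _
    _ ≤ C * (D * R ^ (2 - (2 + γ) - 0)) := by gcongr; exact hD R hR 0
    _ = _ := by rw [show 2 - (2 + γ) - 0 = -γ by ring]; ring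

theorem BoundedDerivatives.integrable_farKernel_smul (hf : BoundedDerivatives f) (hγ : 0 < γ)
    {R : ℝ} (hR : 0 < R) (k : ℕ) (x : Plane) :
    Integrable fun z => farKernel γ R z • iteratedFDeriv ℝ k f (x - z) := by
  obtain ⟨C, hC0, hC⟩ := hf.2 k
  obtain ⟨D, hD0, hD⟩ := exists_integral_farKernel_le hγ
  refine ((hD R hR).1.mul_const C).mono' ((hD R hR).1.1.smul
    ((hf.continuous_iteratedFDeriv k).comp
      (continuous_const.sub continuous_id)).aestronglyMeasurable)
    (Eventually.of_forall fun z => ?_)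
  rw [norm_smul, Real.norm_of_nonneg (farKernel_nonneg γ R z)]
  exact mul_le_mul_of_nonneg_left (hC _) (farKernel_nonneg γ R z)

/-- Integration by parts without boundary terms: the convolution is differentiated once with the
derivatives on `f` and once, after the substitution y = x-z, with the derivatives on the kernel. -/
theorem BoundedDerivatives.norm_integral_farKernel_smul_le (hf : BoundedDerivatives f)
    (hγ : 0 < γ) {R : ℝ} (hR : 0 < R) (k : ℕ) (x : Plane) :
    ‖∫ z, farKernel γ R z • iteratedFDeriv ℝ k f (x - z)‖ ≤
      ∫ y, ‖iteratedFDeriv ℝ k (farKernel γ R) (x - y)‖ * ‖f y‖ := by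
  obtain ⟨D, hD0, hD⟩ := exists_integral_farKernel_le hγ
  have hcd := contDiff_farKernel hγ hR
  have hit : ∀ (k : ℕ) (x z : Plane), iteratedFDeriv ℝ k (fun x => farKernel γ R z • f (x - z)) x =
      farKernel γ R z • iteratedFDeriv ℝ k f (x - z) := fun k x z => by
    have h1 : ContDiff ℝ k f := hf.1.of_le (by exact_mod_cast le_top)
    have h2 : ContDiff ℝ k fun x => f (x - z) := h1.comp (contDiff_id.sub contDiff_const)
    rw [iteratedFDeriv_const_smul_apply' h2.contDiffAt, iteratedFDeriv_comp_sub]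
  have h := (contDiff_integral_of_dominated (μ := volume) (E := Plane) (F := Plane)
    (Φ := fun x z : Plane => farKernel γ R z • f (x - z)) (fun z =>
      (hf.1.comp (contDiff_id.sub contDiff_const)).const_smul _)
    (fun k x => by
      simp only [hit]
      exact (hf.integrable_farKernel_smul hγ hR k x).1)
    (fun k x₀ => by
      obtain ⟨C, hC0, hC⟩ := hf.2 k
      refine ⟨_, (hD R hR).1.mul_const C, fun z x _ => ?_⟩
      rw [hit, norm_smul, Real.norm_of_nonneg (farKernel_nonneg γ R z)]
      exact mul_le_mul_of_nonneg_left (hC _) (farKernel_nonneg γ R z))).2 k x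
  simp only [hit] at h
  have e : (fun x => ∫ z, farKernel γ R z • f (x - z)) =
      fun x => ∫ y, farKernel γ R (x - y) • f y :=
    funext fun x => (integral_sub_smul_comm _ f x).symm
  rw [← h, e]
  obtain ⟨B, hB0, hB⟩ := hf.2 0
  simp only [norm_iteratedFDeriv_zero] at hB
  refine (contDiff_kernel_convolution hcd (s := 2 + γ) (by linarith) (fun j => ?_)
    hf.1.continuous.aestronglyMeasurable (fun x => ?_)).2.2.2 k x
  · obtain ⟨C, hC0, hC⟩ := exists_iteratedFDeriv_farKernel_le hγ j
    -- This R-dependent constant only justifies differentiation under the integral; it does not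
    -- enter the final bound.
    refine ⟨C * (R ^ (-(j:ℝ)) * (min R 1) ^ (-(2 + γ))), fun z => ((hC R hR).2 z).trans ?_⟩
    have hm : 0 < min R 1 := lt_min hR one_pos
    have hj : (0:ℝ) ≤ j := j.cast_nonneg
    have e1 : (R + ‖z‖) ^ (-(2 + γ + j)) = (R + ‖z‖) ^ (-(j:ℝ)) * (R + ‖z‖) ^ (-(2 + γ)) := by
      rw [← Real.rpow_add (by positivity)]; congr 1; ring
    have e2 : (R + ‖z‖) ^ (-(j:ℝ)) ≤ R ^ (-(j:ℝ)) :=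
      Real.rpow_le_rpow_of_nonpos hR (by linarith [norm_nonneg z]) (by linarith)
    have e3 : (R + ‖z‖) ^ (-(2 + γ)) ≤ (min R 1 * (1 + ‖z‖)) ^ (-(2 + γ)) := by
      refine Real.rpow_le_rpow_of_nonpos (by positivity) ?_ (by linarith)
      have h1 : min R 1 * ‖z‖ ≤ 1 * ‖z‖ := by gcongr; exact min_le_right _ _
      linarith [min_le_left R 1]
    rw [Real.mul_rpow hm.le (by positivity)] at e3
    rw [e1]
    calc _ ≤ C * (R ^ (-(j:ℝ)) * ((min R 1) ^ (-(2 + γ)) * (1 + ‖z‖) ^ (-(2 + γ)))) := by gcongr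
      _ = _ := by ring
  · refine ((integrable_one_add_norm_sub (s := 2 + γ) (by linarith) x).mul_const B).mono'
      ((integrable_one_add_norm_sub (s := 2 + γ) (by linarith) x).1.mul
        hf.1.continuous.norm.aestronglyMeasurable) (Eventually.of_forall fun y => ?_)
    rw [Real.norm_of_nonneg (by positivity)]
    gcongr
    exact hB y

/-- The contribution of the far part of the kernel to the derivatives of the fractional
Laplacian of a decaying function. -/
theorem exists_integral_farKernel_smul_le (hγ : 0 < γ) {a : ℝ} (ha : 0 ≤ a) (ha' : a < 2)
    (k : ℕ) : ∃ C : ℝ, 0 ≤ C ∧ ∀ (f : Plane → Plane) (A : ℝ), BoundedDerivatives f → 0 ≤ A →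
      (∀ y, y ≠ 0 → ‖f y‖ ≤ A * ‖y‖ ^ (-a)) → ∀ R : ℝ, 0 < R → ∀ x,
      ‖∫ z, farKernel γ R z • iteratedFDeriv ℝ k f (x - z)‖ ≤ C * A * R ^ (-(a + γ + k)) := by
  obtain ⟨C, hC0, hC⟩ := exists_iteratedFDeriv_farKernel_le hγ k
  have hs : 2 < 2 + γ + k := by have : (0:ℝ) ≤ k := k.cast_nonneg; linarith
  obtain ⟨D, hD0, hD⟩ := exists_integral_add_norm_mul_norm_rpow_le hs ha ha'
  refine ⟨C * D, by positivity, fun f A hf hA hfb R hR x => ?_⟩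
  have hi := (integrable_add_norm_mul_norm_rpow hs ha ha' hR x).const_mul (C * A)
  calc _ ≤ ∫ y, ‖iteratedFDeriv ℝ k (farKernel γ R) (x - y)‖ * ‖f y‖ :=
        hf.norm_integral_farKernel_smul_le hγ hR k x
    _ ≤ ∫ y : Plane, C * A * ((R + ‖x - y‖) ^ (-(2 + γ + k)) * ‖y‖ ^ (-a)) := by
        refine integral_mono_of_nonneg (Eventually.of_forall fun y => by positivity) hi ?_
        filter_upwards [compl_mem_ae_iff.2 (measure_singleton (0:Plane))] with y hy
        calc _ ≤ (C * (R + ‖x - y‖) ^ (-(2 + γ + k))) * (A * ‖y‖ ^ (-a)) :=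
              mul_le_mul ((hC R hR).2 _) (hfb y hy) (norm_nonneg _) (by positivity)
          _ = _ := by ring
    _ = C * A * ∫ y : Plane, (R + ‖x - y‖) ^ (-(2 + γ + k)) * ‖y‖ ^ (-a) :=
        integral_const_mul _ _
    _ ≤ C * A * (D * R ^ (2 - (2 + γ + k) - a)) := by gcongr; exact hD R hR x
    _ = _ := by rw [show 2 - (2 + γ + k) - a = -(a + γ + k) by ring]; ring

end FarKernel

/-! ### Decay of the fractional Laplacian of the flow. -/

section FractionalDecay

variable {f : Plane → Plane} {α β γ : ℝ}

theorem BoundedDerivatives.integrable_nearKernel_smul (hf : BoundedDerivatives f) (hγ : 0 < γ)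
    (hγ' : γ < 1) (R : ℝ) (k : ℕ) (x : Plane) :
    Integrable fun z => nearKernel γ R z •
      (iteratedFDeriv ℝ k f x - iteratedFDeriv ℝ k f (x - z)) := by
  refine (hf.integrable_smul_sub hγ hγ' k x).mono (hf.aestronglyMeasurable_smul_sub k
    ((contDiff_originBump_comp_smul R⁻¹).continuous.aestronglyMeasurable.mul
      (aestronglyMeasurable_norm_rpow _)) x) (Eventually.of_forall fun z => ?_)
  rw [norm_smul, norm_smul, Real.norm_of_nonneg (nearKernel_nonneg γ R z),
    Real.norm_of_nonneg (by positivity)]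
  gcongr
  exact nearKernel_le γ R z

theorem BoundedDerivatives.norm_integral_smul_sub_le (hf : BoundedDerivatives f) (hγ : 0 < γ)
    (hγ' : γ < 1) {R : ℝ} (hR : 0 < R) (k : ℕ) (x : Plane) :
    ‖∫ z : Plane, ‖z‖ ^ (-(2 + γ)) •
        (iteratedFDeriv ℝ k f x - iteratedFDeriv ℝ k f (x - z))‖ ≤
      (∫ z, nearKernel γ R z * ‖iteratedFDeriv ℝ k f x - iteratedFDeriv ℝ k f (x - z)‖) +
        (∫ z, farKernel γ R z) * ‖iteratedFDeriv ℝ k f x‖ +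
        ‖∫ z, farKernel γ R z • iteratedFDeriv ℝ k f (x - z)‖ := by
  obtain ⟨D, hD0, hD⟩ := exists_integral_farKernel_le hγ
  have h1 := hf.integrable_nearKernel_smul hγ hγ' R k x
  have h2 : Integrable fun z => farKernel γ R z • iteratedFDeriv ℝ k f x := (hD R hR).1.smul_const _
  have h3 := hf.integrable_farKernel_smul hγ hR k x
  have heq : ∀ z : Plane, ‖z‖ ^ (-(2 + γ)) •
      (iteratedFDeriv ℝ k f x - iteratedFDeriv ℝ k f (x - z)) =
      nearKernel γ R z • (iteratedFDeriv ℝ k f x - iteratedFDeriv ℝ k f (x - z)) +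
        (farKernel γ R z • iteratedFDeriv ℝ k f x -
          farKernel γ R z • iteratedFDeriv ℝ k f (x - z)) := fun z => by
    rw [← nearKernel_add_farKernel γ R z, add_smul, smul_sub (farKernel γ R z)]
  simp only [heq]
  have h4 : Integrable fun z => farKernel γ R z • iteratedFDeriv ℝ k f x -
      farKernel γ R z • iteratedFDeriv ℝ k f (x - z) := h2.sub h3
  rw [integral_add h1 h4, integral_sub h2 h3, integral_smul_const, add_assoc]
  refine (norm_add_le _ _).trans (add_le_add ?_ ((norm_sub_le _ _).trans (add_le_add ?_ le_rfl)))
  · refine (norm_integral_le_integral_norm _).trans (le_of_eq ?_)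
    congr 1
    funext z
    rw [norm_smul, Real.norm_of_nonneg (nearKernel_nonneg γ R z)]
  · rw [norm_smul, Real.norm_of_nonneg (integral_nonneg (farKernel_nonneg γ R))]

/-- A Hölder modulus with β > γ makes |z|^{-2-γ+β} integrable at 0, and its integral over |z| < R/4
scales as R^{β-γ}. -/
theorem exists_integral_nearKernel_holder_le (hγβ : γ < β) :
    ∃ C : ℝ, 0 ≤ C ∧ ∀ (d : Plane → ℝ) (A R : ℝ), 0 ≤ A → 0 < R → (∀ z, 0 ≤ d z) →
      (∀ z, ‖z‖ ≤ R / 4 → d z ≤ A * ‖z‖ ^ β) →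
      ∫ z, nearKernel γ R z * d z ≤ C * A * R ^ (β - γ) := by
  obtain ⟨C, hC0, hC⟩ := exists_integral_norm_rpow_ball_le (2 + γ - β)
  refine ⟨C, hC0, fun d A R hA hR hd hdb => ?_⟩
  have hi : Integrable ((Metric.ball (0:Plane) (R / 4)).indicator fun z : Plane =>
      A * ‖z‖ ^ (-(2 + γ - β))) := (integrable_indicator_iff measurableSet_ball).2
    ((integrableOn_norm_rpow_ball (by linarith)).const_mul A)
  calc _ ≤ ∫ z, (Metric.ball (0:Plane) (R / 4)).indicator (fun z : Plane =>
        A * ‖z‖ ^ (-(2 + γ - β))) z := by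
        refine integral_mono_of_nonneg (Eventually.of_forall fun z =>
          mul_nonneg (nearKernel_nonneg γ R z) (hd z)) hi ?_
        filter_upwards [compl_mem_ae_iff.2 (measure_singleton (0:Plane))] with z hz
        have hz0 : 0 < ‖z‖ := norm_pos_iff.2 hz
        rcases lt_or_ge ‖z‖ (R / 4) with h | h
        · rw [Set.indicator_of_mem (by simpa using h)]
          calc _ ≤ ‖z‖ ^ (-(2 + γ)) * (A * ‖z‖ ^ β) :=
                mul_le_mul (nearKernel_le γ R z) (hdb z h.le) (hd z) (by positivity)
            _ = A * (‖z‖ ^ (-(2 + γ)) * ‖z‖ ^ β) := by ring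
            _ = _ := by rw [← Real.rpow_add hz0]; congr 2; ring
        · rw [Set.indicator_of_notMem (by simpa using h), nearKernel_eq_zero hR h, zero_mul]
    _ = A * ∫ z in Metric.ball (0:Plane) (R / 4), ‖z‖ ^ (-(2 + γ - β)) := by
        rw [integral_indicator measurableSet_ball, integral_const_mul]
    _ ≤ A * (C * (R / 4) ^ (2 - (2 + γ - β))) := by gcongr; exact hC _ (by positivity)
    _ ≤ A * (C * R ^ (β - γ)) := by
        rw [show 2 - (2 + γ - β) = β - γ by ring]
        gcongr
        linarith
    _ = _ := by ring

theorem exists_integral_nearKernel_min_le (hγ : 0 < γ) (hγ' : γ < 1) :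
    ∃ C : ℝ, 0 ≤ C ∧ ∀ (d : Plane → ℝ) (A R : ℝ), 0 ≤ A → 0 < R → (∀ z, 0 ≤ d z) →
      (∀ z, ‖z‖ ≤ R / 4 → d z ≤ A * min 1 ‖z‖) →
      ∫ z, nearKernel γ R z * d z ≤ C * A := by
  refine ⟨∫ z : Plane, ‖z‖ ^ (-(2 + γ)) * min 1 ‖z‖, integral_nonneg fun z => by positivity,
    fun d A R hA hR hd hdb => ?_⟩
  have hi := (integrable_norm_rpow_mul_min hγ hγ').const_mul A
  calc _ ≤ ∫ z : Plane, A * (‖z‖ ^ (-(2 + γ)) * min 1 ‖z‖) := by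
        refine integral_mono_of_nonneg (Eventually.of_forall fun z =>
          mul_nonneg (nearKernel_nonneg γ R z) (hd z)) hi (Eventually.of_forall fun z => ?_)
        rcases le_or_gt ‖z‖ (R / 4) with h | h
        · calc _ ≤ ‖z‖ ^ (-(2 + γ)) * (A * min 1 ‖z‖) :=
                mul_le_mul (nearKernel_le γ R z) (hdb z h) (hd z) (by positivity)
            _ = _ := by ring
        · simp only [nearKernel_eq_zero hR h.le, zero_mul]
          positivity
    _ = _ := by rw [integral_const_mul, mul_comm]

theorem div_one_add_rpow_le {s C t : ℝ} (hs : 0 ≤ s) (ht : 0 < t) :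
    C / (1 + t) ^ s ≤ |C| * t ^ (-s) := by
  rw [Real.rpow_neg ht.le, ← div_eq_mul_inv]
  calc C / (1 + t) ^ s ≤ |C| / (1 + t) ^ s := by gcongr; exact le_abs_self C
    _ ≤ _ := by gcongr; linarith

theorem HolderBound.boundedDerivatives_heatFlow (hα : 1 / 2 < α) (hα' : α < 1) (hβ : 0 < β)
    (hβ' : β ≤ 1) {m : ℕ} {M : ℝ≥0} {v : UnitCircle → Plane} (hv : HolderBound m β M v) :
    BoundedDerivatives (heatFlow α (homogeneousField α v)) := by
  refine ⟨hv.contDiff_heatFlow hα hα' hβ hβ', fun k => ?_⟩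
  obtain ⟨C, hC0, hC⟩ := exists_iteratedFDeriv_heatFlow_le hα hα' hβ hβ' M k
  exact ⟨C, hC0, hC m v hv⟩

/-- The near part of the fractional Laplacian of the flow. -/
theorem exists_integral_nearKernel_heatFlow_le (hα : 1 / 2 < α) (hα' : α < 1) (hβ : 0 < β)
    (hβ' : β ≤ 1) (hγ : 0 < γ) (hγβ : γ < β) {m k : ℕ} (hmk : m ≤ k) (M : ℝ≥0) :
    ∃ C : ℝ, 0 ≤ C ∧ ∀ v : UnitCircle → Plane, HolderBound m β M v → ∀ x, 1 ≤ ‖x‖ →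
      ∫ z, nearKernel γ ‖x‖ z *
          ‖iteratedFDeriv ℝ k (heatFlow α (homogeneousField α v)) x -
            iteratedFDeriv ℝ k (heatFlow α (homogeneousField α v)) (x - z)‖ ≤
        C * ‖x‖ ^ (-(2 * α - 1 + γ + min (k : ℝ) (m + β - γ))) := by
  have hγ' : γ < 1 := by linarith
  -- At k = m the next derivative decays no better than m+β, so the Hölder bound at exponent β is
  -- used, and the factor |x|^{β-γ} gives exactly γ+m. For k > m the derivatives of orders k and k+1
  -- both decay with exponent m+β; interpolating them keeps the near integral bounded without any
  -- power of |x|.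
  rcases hmk.eq_or_lt with rfl | hlt
  · obtain ⟨A, hA0, hA⟩ := exists_iteratedFDeriv_heatFlow_sub_le hα hα' hβ hβ' m M
    obtain ⟨C, hC0, hC⟩ := exists_integral_nearKernel_holder_le hγβ
    refine ⟨C * A, by positivity, fun v hv x hx => ?_⟩
    have hx0 : 0 < ‖x‖ := by linarith
    refine (hC _ (A * ‖x‖ ^ (-(2 * α - 1 + m + β))) ‖x‖ (by positivity) hx0
      (fun z => norm_nonneg _) fun z hz => ?_).trans (le_of_eq ?_)
    · have := hA v hv x hx (x - z) (by rwa [sub_sub_cancel])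
      rwa [sub_sub_cancel] at this
    · rw [← mul_assoc, mul_assoc, ← Real.rpow_add hx0, min_eq_left (by linarith)]
      congr 2; ring
  · obtain ⟨A, hA0, hA⟩ := exists_iteratedFDeriv_heatFlow_le_of_lt hα hα' hβ hβ' hlt M
    obtain ⟨B, hB0, hB⟩ := exists_iteratedFDeriv_heatFlow_le_of_lt hα hα' hβ hβ'
      (hlt.trans (Nat.lt_succ_self k)) M
    obtain ⟨C, hC0, hC⟩ := exists_integral_nearKernel_min_le hγ hγ'
    refine ⟨C * (2 * A + B), by positivity, fun v hv x hx => ?_⟩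
    have hx0 : 0 < ‖x‖ := by linarith
    have hmem : ∀ y ∈ Metric.closedBall x (‖x‖ / 4), 3 / 4 * ‖x‖ ≤ ‖y‖ ∧ ‖y‖ ≤ 5 / 4 * ‖x‖ := by
      intro y hy
      rw [mem_closedBall_iff_norm'] at hy
      have h1 := norm_sub_norm_le x y
      have h2 := norm_sub_norm_le y x
      rw [norm_sub_rev] at h2
      constructor <;> linarith
    have hxm : x ∈ Metric.closedBall x (‖x‖ / 4) := Metric.mem_closedBall_self (by positivity)
    refine (hC _ ((2 * A + B) * ‖x‖ ^ (-(2 * α - 1 + m + β))) ‖x‖ (by positivity) hx0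
      (fun z => norm_nonneg _) fun z hz => ?_).trans (le_of_eq ?_)
    · have hzm : x - z ∈ Metric.closedBall x (‖x‖ / 4) := by
        rw [mem_closedBall_iff_norm', sub_sub_cancel]; exact hz
      rw [add_mul]
      refine le_mul_min_one (by positivity) (by positivity) (norm_nonneg z) ?_ ?_
      · calc _ ≤ A * ‖x‖ ^ (-(2 * α - 1 + m + β)) + A * ‖x‖ ^ (-(2 * α - 1 + m + β)) :=
              (norm_sub_le _ _).trans (add_le_add
                (hA v hv _ hx _ (hmem x hxm).1 (hmem x hxm).2)
                (hA v hv _ hx _ (hmem _ hzm).1 (hmem _ hzm).2))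
          _ = _ := by ring
      · have hcd := hv.contDiff_heatFlow hα hα' hβ hβ'
        have := (convex_closedBall x (‖x‖ / 4)).norm_image_sub_le_of_norm_fderiv_le (𝕜 := ℝ)
          (f := iteratedFDeriv ℝ k (heatFlow α (homogeneousField α v)))
          (C := B * ‖x‖ ^ (-(2 * α - 1 + m + β)))
          (fun y _ => (hcd.differentiable_iteratedFDeriv (m := k)
            (by exact_mod_cast ENat.natCast_lt_top k)).differentiableAt)
          (fun y hy => by
            rw [norm_fderiv_iteratedFDeriv]
            exact hB v hv _ hx _ (hmem y hy).1 (hmem y hy).2) hzm hxm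
        simpa using this
    · have : (m:ℝ) + 1 ≤ k := by exact_mod_cast hlt
      rw [min_eq_right (by linarith), ← mul_assoc]
      congr 2; ring

theorem exists_norm_integral_smul_sub_heatFlow_le (hα : 1 / 2 < α) (hα' : α < 1) (hβ : 0 < β)
    (hβ' : β ≤ 1) (hγ : 0 < γ) (hγβ : γ < β) {m k : ℕ} (hmk : m ≤ k) (M : ℝ≥0) :
    ∃ C : ℝ, 0 ≤ C ∧ ∀ v : UnitCircle → Plane, HolderBound m β M v → ∀ x, 1 ≤ ‖x‖ →
      ‖∫ z : Plane, ‖z‖ ^ (-(2 + γ)) •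
          (iteratedFDeriv ℝ k (heatFlow α (homogeneousField α v)) x -
            iteratedFDeriv ℝ k (heatFlow α (homogeneousField α v)) (x - z))‖ ≤
        C * ‖x‖ ^ (-(2 * α - 1 + γ + min (k : ℝ) (m + β - γ))) := by
  have hγ' : γ < 1 := by linarith
  have hm0 : (0:ℝ) ≤ m := m.cast_nonneg
  have hk0 : (0:ℝ) ≤ k := k.cast_nonneg
  obtain ⟨A, hA0, hA⟩ :=
    exists_integral_nearKernel_heatFlow_le hα hα' hβ hβ' hγ hγβ hmk M
  obtain ⟨D, hD0, hD⟩ := exists_integral_farKernel_le hγ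
  obtain ⟨B₀, hB₀⟩ := exists_iteratedFDeriv_heatFlow_decay hα hα' hβ hβ' M 0
  obtain ⟨B, hB⟩ := exists_iteratedFDeriv_heatFlow_decay hα hα' hβ hβ' M k
  -- With the derivatives on the kernel, only the size of U₀ itself enters, hence `B₀` from k = 0
  -- and the exponent 2α-1.
  obtain ⟨E, hE0, hE⟩ := exists_integral_farKernel_smul_le hγ (a := 2 * α - 1) (by linarith)
    (by linarith) k
  refine ⟨A + D * |B| + E * |B₀|, by positivity, fun v hv x hx => ?_⟩
  have hx0 : 0 < ‖x‖ := by linarith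
  have hf := hv.boundedDerivatives_heatFlow hα hα' hβ hβ'
  have hfb : ∀ y, y ≠ 0 → ‖heatFlow α (homogeneousField α v) y‖ ≤
      |B₀| * ‖y‖ ^ (-(2 * α - 1)) := fun y hy => by
    have h1 := hB₀ m v hv y
    rw [norm_iteratedFDeriv_zero, min_eq_left (by push_cast; linarith), Nat.cast_zero,
      add_zero] at h1
    exact h1.trans (div_one_add_rpow_le (by linarith) (norm_pos_iff.2 hy))
  have h2 : ‖iteratedFDeriv ℝ k (heatFlow α (homogeneousField α v)) x‖ ≤
      |B| * ‖x‖ ^ (-(2 * α - 1 + min (k : ℝ) (m + β))) :=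
    (hB m v hv x).trans (div_one_add_rpow_le (by
      have : 0 ≤ min (k : ℝ) (m + β) := by positivity
      linarith) hx0)
  -- Both far terms decay at least as fast as the near one, and |x| ≥ 1 allows all three to be
  -- compared at the weakest exponent.
  have hmin : min (k : ℝ) (m + β - γ) ≤ min (k : ℝ) (m + β) :=
    min_le_min le_rfl (by linarith)
  have e1 : ‖x‖ ^ (-γ) * ‖x‖ ^ (-(2 * α - 1 + min (k : ℝ) (m + β))) ≤
      ‖x‖ ^ (-(2 * α - 1 + γ + min (k : ℝ) (m + β - γ))) := by
    rw [← Real.rpow_add hx0]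
    exact Real.rpow_le_rpow_of_exponent_le hx (by linarith)
  have e2 : ‖x‖ ^ (-(2 * α - 1 + γ + k)) ≤
      ‖x‖ ^ (-(2 * α - 1 + γ + min (k : ℝ) (m + β - γ))) :=
    Real.rpow_le_rpow_of_exponent_le hx (by linarith [min_le_left (k:ℝ) (m + β - γ)])
  calc _ ≤ A * ‖x‖ ^ (-(2 * α - 1 + γ + min (k : ℝ) (m + β - γ))) +
        (D * ‖x‖ ^ (-γ)) * (|B| * ‖x‖ ^ (-(2 * α - 1 + min (k : ℝ) (m + β)))) +
        E * |B₀| * ‖x‖ ^ (-(2 * α - 1 + γ + k)) := by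
        refine (hf.norm_integral_smul_sub_le hγ hγ' hx0 k x).trans
          (add_le_add (add_le_add (hA v hv x hx) ?_) ?_)
        · exact mul_le_mul (hD _ hx0).2 h2 (norm_nonneg _) (by positivity)
        · exact hE _ _ hf (abs_nonneg _) hfb _ hx0 x
    _ = A * ‖x‖ ^ (-(2 * α - 1 + γ + min (k : ℝ) (m + β - γ))) +
        D * |B| * (‖x‖ ^ (-γ) * ‖x‖ ^ (-(2 * α - 1 + min (k : ℝ) (m + β)))) +
        E * |B₀| * ‖x‖ ^ (-(2 * α - 1 + γ + k)) := by ring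
    _ ≤ A * ‖x‖ ^ (-(2 * α - 1 + γ + min (k : ℝ) (m + β - γ))) +
        D * |B| * ‖x‖ ^ (-(2 * α - 1 + γ + min (k : ℝ) (m + β - γ))) +
        E * |B₀| * ‖x‖ ^ (-(2 * α - 1 + γ + min (k : ℝ) (m + β - γ))) := by gcongr
    _ = _ := by ring

theorem exists_norm_integral_smul_sub_heatFlow_le_const (hα : 1 / 2 < α) (hα' : α < 1)
    (hβ : 0 < β) (hβ' : β ≤ 1) (hγ : 0 < γ) (hγ' : γ < 1) (k : ℕ) (M : ℝ≥0) :
    ∃ C : ℝ, 0 ≤ C ∧ ∀ (m : ℕ) (v : UnitCircle → Plane), HolderBound m β M v → ∀ x,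
      ‖∫ z : Plane, ‖z‖ ^ (-(2 + γ)) •
          (iteratedFDeriv ℝ k (heatFlow α (homogeneousField α v)) x -
            iteratedFDeriv ℝ k (heatFlow α (homogeneousField α v)) (x - z))‖ ≤ C := by
  obtain ⟨A, hA0, hA⟩ := exists_iteratedFDeriv_heatFlow_le hα hα' hβ hβ' M k
  obtain ⟨B, hB0, hB⟩ := exists_iteratedFDeriv_heatFlow_le hα hα' hβ hβ' M (k + 1)
  refine ⟨(2 * A + B) * ∫ z : Plane, ‖z‖ ^ (-(2 + γ)) * min 1 ‖z‖,
    mul_nonneg (by positivity) (integral_nonneg fun z => by positivity), fun m v hv x => ?_⟩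
  have hcd := hv.contDiff_heatFlow hα hα' hβ hβ'
  rw [← integral_const_mul]
  refine norm_integral_le_of_norm_le ((integrable_norm_rpow_mul_min hγ hγ').const_mul _)
    (Eventually.of_forall fun z => ?_)
  rw [norm_smul, Real.norm_of_nonneg (by positivity)]
  have h : ‖iteratedFDeriv ℝ k (heatFlow α (homogeneousField α v)) x -
      iteratedFDeriv ℝ k (heatFlow α (homogeneousField α v)) (x - z)‖ ≤
      (2 * A + B) * min 1 ‖z‖ := by
    refine le_mul_min_one (by positivity) hB0 (norm_nonneg z) ?_ ?_
    · linarith [norm_sub_le (iteratedFDeriv ℝ k (heatFlow α (homogeneousField α v)) x)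
        (iteratedFDeriv ℝ k (heatFlow α (homogeneousField α v)) (x - z)), hA m v hv x,
        hA m v hv (x - z)]
    · have := convex_univ.norm_image_sub_le_of_norm_fderiv_le (𝕜 := ℝ)
        (f := iteratedFDeriv ℝ k (heatFlow α (homogeneousField α v))) (C := B)
        (fun y _ => (hcd.differentiable_iteratedFDeriv (m := k)
          (by exact_mod_cast ENat.natCast_lt_top k)).differentiableAt)
        (fun y _ => by rw [norm_fderiv_iteratedFDeriv]; exact hB m v hv y)
        (Set.mem_univ (x - z)) (Set.mem_univ x)
      simpa using this
  calc _ ≤ ‖z‖ ^ (-(2 + γ)) * ((2 * A + B) * min 1 ‖z‖) := by gcongr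
    _ = _ := by ring

theorem exists_iteratedFDeriv_fracLaplacian_decay (hα : 1 / 2 < α) (hα' : α < 1) (hβ : 0 < β)
    (hβ' : β ≤ 1) (hγ : 0 < γ) (hγβ : γ < β) (M : ℝ≥0) (k : ℕ) :
    ∃ C : ℝ, ∀ (m : ℕ) (v : UnitCircle → Plane), HolderBound m β M v → ∀ x,
      ‖iteratedFDeriv ℝ k (fracLaplacian (γ / 2) (heatFlow α (homogeneousField α v))) x‖ ≤
        C / (1 + ‖x‖) ^ (2 * α - 1 + γ + min (k : ℝ) (m + β - γ)) := by
  have hγ' : γ < 1 := by linarith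
  refine exists_bound_of_forall_le (P := fun m N v C => ∀ x,
    ‖iteratedFDeriv ℝ k (fracLaplacian (γ / 2) (heatFlow α (homogeneousField α v))) x‖ ≤
      C / (1 + ‖x‖) ^ (2 * α - 1 + γ + min (k : ℝ) (m + β - γ))) hβ hβ' M k ?_ ?_ ?_
  · intro m N v C C' hC h x
    exact (h x).trans (by gcongr)
  · intro m v C hm h x
    have : (k:ℝ) < m := by exact_mod_cast hm
    rw [min_eq_left (by linarith)]
    simpa only [min_eq_left (show (k:ℝ) ≤ k + β - γ by linarith)] using h x
  · intro m hm N
    obtain ⟨C, hC0, hC⟩ :=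
      exists_norm_integral_smul_sub_heatFlow_le_const hα hα' hβ hβ' hγ hγ' k N
    obtain ⟨D, hD0, hD⟩ :=
      exists_norm_integral_smul_sub_heatFlow_le hα hα' hβ hβ' hγ hγβ hm N
    have hs : 0 ≤ 2 * α - 1 + γ + min (k : ℝ) (m + β - γ) := by
      have : 0 ≤ min (k : ℝ) (m + β - γ) := le_min k.cast_nonneg (by
        have : (0:ℝ) ≤ m := m.cast_nonneg
        linarith)
      linarith
    refine ⟨|fracConst (γ / 2)| * ((C + D) * 2 ^ (2 * α - 1 + γ + min (k : ℝ) (m + β - γ))),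
      fun v hv x => ?_⟩
    rw [(hv.boundedDerivatives_heatFlow hα hα' hβ hβ').norm_iteratedFDeriv_fracLaplacian hγ hγ',
      mul_div_assoc]
    gcongr
    exact le_div_one_add_norm_rpow hs hC0 hD0 (hC m v hv x) (hD v hv x)

end FractionalDecay

end FracHeat

end

theorem mainTheorem7 (α β : ℝ) (hα : 1 / 2 < α) (hα' : α < 1) (hβ : 0 < β) (hβ' : β ≤ 1)
    (M : ℝ≥0) :
    -- the profile is well defined, smooth and divergence free
    (∀ (m : ℕ) (v : FracHeat.UnitCircle → FracHeat.Plane),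
      FracHeat.HolderBound m β M v →
      FracHeat.DivFreeOffOrigin (FracHeat.homogeneousField α v) →
      (∀ x : FracHeat.Plane, Integrable
        (fun y => FracHeat.heatKernel α (x - y) • FracHeat.homogeneousField α v y)) ∧
      ContDiff ℝ ∞ (FracHeat.heatFlow α (FracHeat.homogeneousField α v)) ∧
      ∀ x : FracHeat.Plane,
        FracHeat.divergence (FracHeat.heatFlow α (FracHeat.homogeneousField α v)) x = 0) ∧
    -- decay of its derivatives
    (∀ k : ℕ, ∃ C : ℝ, ∀ (m : ℕ) (v : FracHeat.UnitCircle → FracHeat.Plane),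
      FracHeat.HolderBound m β M v →
      FracHeat.DivFreeOffOrigin (FracHeat.homogeneousField α v) →
      ∀ x : FracHeat.Plane,
        ‖iteratedFDeriv ℝ k (FracHeat.heatFlow α (FracHeat.homogeneousField α v)) x‖ ≤
          C / (1 + ‖x‖) ^ (2 * α - 1 + min (k : ℝ) (m + β))) ∧
    -- its fractional Laplacians are well defined and smooth, and their derivatives decay
    (∀ γ : ℝ, 0 < γ → γ < β →
      (∀ (m : ℕ) (v : FracHeat.UnitCircle → FracHeat.Plane),
        FracHeat.HolderBound m β M v →
        FracHeat.DivFreeOffOrigin (FracHeat.homogeneousField α v) →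
        (∀ x : FracHeat.Plane, FracHeat.FracLaplacianExists (γ / 2)
          (FracHeat.heatFlow α (FracHeat.homogeneousField α v)) x) ∧
        ContDiff ℝ ∞ (FracHeat.fracLaplacian (γ / 2)
          (FracHeat.heatFlow α (FracHeat.homogeneousField α v)))) ∧
      ∀ k : ℕ, ∃ C : ℝ, ∀ (m : ℕ) (v : FracHeat.UnitCircle → FracHeat.Plane),
        FracHeat.HolderBound m β M v →
        FracHeat.DivFreeOffOrigin (FracHeat.homogeneousField α v) →
        ∀ x : FracHeat.Plane,
          ‖iteratedFDeriv ℝ k (FracHeat.fracLaplacian (γ / 2)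
              (FracHeat.heatFlow α (FracHeat.homogeneousField α v))) x‖ ≤
            C / (1 + ‖x‖) ^ (2 * α - 1 + γ + min (k : ℝ) (m + β - γ))) := by
  refine ⟨fun m v hv hdiv => ⟨hv.integrable_heatKernel_smul hα hα' hβ hβ',
    hv.contDiff_heatFlow hα hα' hβ hβ', hv.divergence_heatFlow hα hα' hβ hβ' hdiv⟩,
    fun k => ?_, fun γ hγ hγβ => ⟨fun m v hv _ => ?_, fun k => ?_⟩⟩
  · obtain ⟨C, hC⟩ := FracHeat.exists_iteratedFDeriv_heatFlow_decay hα hα' hβ hβ' M k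
    exact ⟨C, fun m v hv _ => hC m v hv⟩
  · have hf := hv.boundedDerivatives_heatFlow hα hα' hβ hβ'
    have hγ' : γ < 1 := hγβ.trans_le hβ'
    exact ⟨hf.fracLaplacianExists hγ hγ', hf.contDiff_fracLaplacian hγ hγ'⟩
  · obtain ⟨C, hC⟩ :=
      FracHeat.exists_iteratedFDeriv_fracLaplacian_decay hα hα' hβ hβ' hγ hγβ M k
    exact ⟨C, fun m v hv _ => hC m v hv⟩
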